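/- **Setting.** For a finite group $G$ and a commutative ring $R$, let $B_R(G,G)$ be the double Burnside $R$-algebra: the $R$-module freely generated by the isomorphism classes of finite $(G,G)$-bisets, modulo the relations $[M\sqcup N]=[M]+[N]$, with multiplication $[M]\cdot[N]=[M\times_G N]$, where $M\times_G N$ is the set of orbits of $G$ on $M\times N$ under $g(m,n)=(mg^{-1},gn)$. For a subgroup $U\le G\times G$, regard $(G\times G)/U$ as a $(G,G)$-biset via $h\cdot y\cdot g=(h,g^{-1})y$. Write $B_R=B_R(S_3,S_3)$ and view $B_{\mathbf Z}\to B_{\mathbf Q}$ via $[M]\mapsto[M]$. Put $a=(1,2)$, $b=(1,2,3)$, $V_0=1$, $V_1=\langle a\rangle$, $V_4=\langle b\rangle$, $V_5=S_3$. Let $H_{i,j}=[(S_3\times S_3)/(V_i\times V_j)]$ for $i,j\in\{0,1,4,5\}$, let $H^\Delta_t=[(S_3\times S_3)/\{(g,g):g\in V_t\}]$ for $t\in\{1,4,5\}$, and let $H_s=[(S_3\times S_3)/U_s]$ for $s\in\{6,7,8\}$, where $U_6=\langle(a,a),(1,b)\rangle$, $U_7=\langle(a,a),(b,1)\rangle$,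 $U_8=\langle(a,a),(b,1),(1,b)\rangle$. **The algebra $A$.** Let $\mathbf Q[\bar\eta,\bar\xi]=\mathbf Q[\eta,\xi]/(\eta^2,\eta\xi,\xi^2)$, and let $\pi:\mathbf Q[\bar\eta,\bar\xi]\to\mathbf Q$, $\pi(z_1+z_2\bar\eta+z_3\bar\xi)=z_1$. Let $$A=\begin{bmatrix}\mathbf Q^{3\times3}&0&0&\mathbf Q^{3\times1}\\0&\mathbf Q&0&\mathbf Q\\0&0&\mathbf Q&0\\\mathbf Q^{1\times3}&\mathbf Q&0&\mathbf Q[\bar\eta,\bar\xi]\end{bmatrix}$$ with elements $[s,t,u,v,w,x,y,z]:=\begin{bmatrix}s&0&0&t\\0&u&0&v\\0&0&w&0\\x&y&0&z\end{bmatrix}$, entrywise addition, and multiplication $$[s,t,u,v,w,x,y,z]\cdot[s',t',u',v',w',x',y',z']=\big[ss',\ st'+t\,\pi(z'),\ uu',\ uv'+v\,\pi(z'),\ ww',\ xs'+\pi(z)x',\ yu'+\pi(z)y',\ (xt')\bar\eta+yv'(\bar\xi-12\bar\eta)+zz'\big].$$ This is a $\mathbf Q$-algebra. Let $A_{\mathbf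 Z}\subseteq A$ be the subring of elements with entries in $\mathbf Z$, respectively in $\mathbf Z[\bar\eta,\bar\xi]$ at the last position. **The map $\gamma$.** In $B_{\mathbf Q}$ let $$\begin{aligned} b_{1,1} &= -\tfrac{1}{2}H_{0,0}+H_{1,0}+\tfrac{1}{2}H_{4,0} \\ b_{1,2} &= \tfrac{1}{2}H_{0,0}-H_{1,0}-\tfrac{1}{2}H_{0,1}-\tfrac{1}{2}H_{4,0}+H_{1,1}+\tfrac{1}{2}H_{4,1} \\ b_{1,3} &= -\tfrac{1}{8}H_{0,0}+\tfrac{1}{4}H_{1,0}+\tfrac{1}{2}H_{0,1}+\tfrac{1}{8}H_{4,0}-\tfrac{3}{8}H_{0,4}-H_{1,1}-\tfrac{1}{2}H_{4,1}+\tfrac{3}{4}H_{1,4}+\tfrac{3}{8}H_{4,4} \\ b_{2,1} &= -\tfrac{4}{3}H_{0,0}+2H_{1,0}+H_{4,0} \\ b_{2,2} &= \tfrac{4}{3}H_{0,0}-2H_{1,0}-\tfrac{4}{3}H_{0,1}-H_{4,0}+2H_{1,1}+H_{4,1} \\ b_{2,3} &= -\tfrac{1}{3}H_{0,0}+\tfrac{1}{2}H_{1,0}+\tfrac{4}{3}H_{0,1}+\tfrac{1}{4}H_{4,0}-H_{0,4}-2H_{1,1}-H_{4,1}+\tfrac{3}{2}H_{1,4}+\tfrac{3}{4}H_{4,4}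 \\ b_{3,1} &= -\tfrac{1}{3}H_{0,0}+H_{4,0} \\ b_{3,2} &= \tfrac{1}{3}H_{0,0}-\tfrac{1}{3}H_{0,1}-H_{4,0}+H_{4,1} \\ b_{3,3} &= -\tfrac{1}{12}H_{0,0}+\tfrac{1}{3}H_{0,1}+\tfrac{1}{4}H_{4,0}-\tfrac{1}{4}H_{0,4}+\tfrac{3}{4}H_{4,4}-H_{4,1} \\ c_1 &= -\tfrac{1}{8}H_{0,0}+\tfrac{1}{4}H_{1,0}+\tfrac{1}{4}H_{0,1}+\tfrac{1}{8}H_{4,0}+\tfrac{1}{8}H_{0,4}-\tfrac{1}{2}H_{1,1}-\tfrac{1}{4}H_{0,5}-\tfrac{1}{4}H_{4,1}-\tfrac{1}{4}H_{1,4}-\tfrac{1}{8}H_{4,4}+\tfrac{1}{2}H_{1,5}+\tfrac{1}{4}H_{4,5} \\ c_2 &= -\tfrac{1}{3}H_{0,0}+\tfrac{1}{2}H_{1,0}+\tfrac{2}{3}H_{0,1}+\tfrac{1}{4}H_{4,0}+\tfrac{1}{3}H_{0,4}-H_{1,1}-\tfrac{2}{3}H_{0,5}-\tfrac{1}{2}H_{4,1}-\tfrac{1}{2}H_{1,4}-\tfrac{1}{4}H_{4,4}+H_{1,5}+\tfrac{1}{2}H_{4,5}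 \\ c_3 &= -\tfrac{1}{12}H_{0,0}+\tfrac{1}{6}H_{0,1}+\tfrac{1}{4}H_{4,0}+\tfrac{1}{12}H_{0,4}-\tfrac{1}{6}H_{0,5}-\tfrac{1}{2}H_{4,1}-\tfrac{1}{4}H_{4,4}+\tfrac{1}{2}H_{4,5} \\ \varepsilon_2 &= -H_{0,0}+H_{1,0}+H_{0,1}+H^\Delta_1-2H_{1,1} \\ c_4 &= -\tfrac{1}{2}H_{0,0}+\tfrac{1}{2}H_{1,0}+\tfrac{1}{2}H_{0,1}+\tfrac{1}{2}H^\Delta_1+\tfrac{1}{2}H_{0,4}-H_{1,1}-\tfrac{1}{2}H_{0,5}-\tfrac{1}{2}H_6-\tfrac{1}{2}H_{1,4}+H_{1,5} \\ \varepsilon_3 &= -\tfrac{1}{4}H_{0,0}+\tfrac{1}{4}H_{4,0}+\tfrac{1}{4}H_{0,4}+\tfrac{1}{2}H^\Delta_4-\tfrac{3}{4}H_{4,4} \\ d_1 &= \tfrac{1}{6}H_{0,0}-\tfrac{1}{3}H_{1,0}-\tfrac{1}{6}H_{4,0}+\tfrac{1}{3}H_{5,0} \\ d_2 &= -\tfrac{1}{6}H_{0,0}+\tfrac{1}{3}H_{1,0}+\tfrac{1}{6}H_{0,1}+\tfrac{1}{6}H_{4,0}-\tfrac{1}{3}H_{1,1}-\tfrac{1}{3}H_{5,0}-\tfrac{1}{6}H_{4,1}+\tfrac{1}{3}H_{5,1}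 \\ d_3 &= \tfrac{1}{24}H_{0,0}-\tfrac{1}{12}H_{1,0}-\tfrac{1}{6}H_{0,1}-\tfrac{1}{24}H_{4,0}+\tfrac{1}{8}H_{0,4}+\tfrac{1}{3}H_{1,1}+\tfrac{1}{12}H_{5,0}+\tfrac{1}{6}H_{4,1}-\tfrac{1}{4}H_{1,4}-\tfrac{1}{8}H_{4,4}-\tfrac{1}{3}H_{5,1}+\tfrac{1}{4}H_{5,4} \\ d_4 &= -\tfrac{1}{2}H_{0,0}+\tfrac{1}{2}H_{1,0}+\tfrac{1}{2}H_{0,1}+\tfrac{1}{2}H^\Delta_1+\tfrac{1}{2}H_{4,0}-H_{1,1}-\tfrac{1}{2}H_{5,0}-\tfrac{1}{2}H_{4,1}-\tfrac{1}{2}H_7+H_{5,1} \\ \varepsilon_4 &= \tfrac{1}{2}H_{0,0}-H^\Delta_1-\tfrac{1}{2}H^\Delta_4+H^\Delta_5 \\ b' &= \tfrac{1}{24}H_{0,0}-\tfrac{1}{12}H_{1,0}-\tfrac{1}{12}H_{0,1}-\tfrac{1}{24}H_{4,0}-\tfrac{1}{24}H_{0,4}+\tfrac{1}{6}H_{1,1}+\tfrac{1}{12}H_{5,0}+\tfrac{1}{12}H_{0,5}+\tfrac{1}{12}H_{4,1}+\tfrac{1}{12}H_{1,4}+\tfrac{1}{24}H_{4,4}-\tfrac{1}{6}H_{1,5}-\tfrac{1}{6}H_{5,1}-\tfrac{1}{12}H_{4,5}-\tfrac{1}{12}H_{5,4}+\tfrac{1}{6}H_{5,5}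 \\ b'' &= \tfrac{1}{4}H_{0,0}-\tfrac{3}{4}H_{1,0}-\tfrac{3}{4}H_{0,1}+\tfrac{1}{4}H^\Delta_1-\tfrac{1}{4}H_{4,0}-\tfrac{1}{4}H_{0,4}+\tfrac{3}{2}H_{1,1}+\tfrac{3}{4}H_{5,0}+\tfrac{3}{4}H_{0,5}-\tfrac{1}{4}H_6+\tfrac{3}{4}H_{4,1}+\tfrac{3}{4}H_{1,4}-\tfrac{1}{4}H_7+\tfrac{1}{4}H_{4,4}-\tfrac{3}{2}H_{1,5}-\tfrac{3}{2}H_{5,1}-\tfrac{3}{4}H_{4,5}-\tfrac{3}{4}H_{5,4}+\tfrac{1}{4}H_8+\tfrac{3}{2}H_{5,5} \end{aligned}$$ Then the map $\gamma:A\to B_{\mathbf Q}$, $$\gamma\big([s,t,u,v,w,x,y,z_1+z_2\bar\eta+z_3\bar\xi]\big)=\sum_{i,j=1}^3s_{i,j}b_{i,j}+\sum_{i=1}^3t_ic_i+u\varepsilon_2+vc_4+w\varepsilon_3+\sum_{j=1}^3x_jd_j+yd_4+z_1\varepsilon_4+z_2b'+z_3b'',$$ is an isomorphism of $\mathbf Q$-algebras.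 **The map $\delta$.** Let $X_1,X_2,X_3$ be the following units of $A$: $X_1=[s,0,1,0,1,0,0,1]$ with $s=\begin{pmatrix}0&-2&0\\6&6&-4\\0&0&1\end{pmatrix}$; $X_2=[s,0,1,0,1,0,0,1]$ with $s=\begin{pmatrix}1&0&0\\0&1&0\\0&7&1\end{pmatrix}$; and $X_3=[I_3,(0,0,1)^{\mathrm t},1,0,1,(0,0,6),0,1]$. Let $$\delta:B_{\mathbf Z}\to A,\qquad \delta(y)=X_3^{-1}X_2^{-1}X_1^{-1}\,\gamma^{-1}(y)\,X_1X_2X_3 .$$ **Theorem.** The map $\delta$ is an injective ring morphism, its image lies in $A_{\mathbf Z}$, and $\delta(B_{\mathbf Z})=\Lambda$, where $\Lambda$ is the set of all elements $$\begin{bmatrix}s_{1,1}&s_{1,2}&s_{1,3}&0&0&t_1\\s_{2,1}&s_{2,2}&s_{2,3}&0&0&t_2\\s_{3,1}&s_{3,2}&s_{3,3}&0&0&t_3\\0&0&0&u&0&v\\0&0&0&0&w&0\\x_1&x_2&x_3&y&0&z_1+z_2\bar\eta+z_3\bar\xi\end{bmatrix}\in A_{\mathbf Z}$$ such that $2w-2z_1\equiv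 z_2\pmod 8$, $z_2\equiv z_3\equiv0\pmod4$, $x_1\equiv x_2\equiv x_3\equiv0\pmod4$, $y\equiv t_1\equiv t_2\equiv t_3\equiv v\equiv0\pmod2$, and $x_1\equiv x_2\equiv x_3\equiv z_2\equiv0\pmod3$. In particular $\Lambda$ is a subring of $A_{\mathbf Z}$ and $B_{\mathbf Z}(S_3,S_3)\cong\Lambda$ as rings. -/

import Mathlib

open scoped MulOpposite

noncomputable section

namespace DoubleBurnside

/-! ## Finite bisets -/

/-- A finite `(G,G)`-biset: a finite set with commuting left and right actions of `G`.
The right action `x · g` is `MulOpposite.op g • x`. -/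
structure Biset (G : Type) [Group G] where
  carrier : Type
  [fin : Finite carrier]
  [left : MulAction G carrier]
  [right : MulAction Gᵐᵒᵖ carrier]
  [comm : SMulCommClass G Gᵐᵒᵖ carrier]

attribute [instance] Biset.fin Biset.left Biset.right Biset.comm

namespace Biset

variable {G : Type} [Group G]

/-- Isomorphism of bisets: a bijection that commutes with both actions. -/
def Iso (X Y : Biset G) : Prop :=
  ∃ e : X.carrier ≃ Y.carrier, (∀ (g : G) (x : X.carrier), e (g • x) = g • e x) ∧
    ∀ (g : Gᵐᵒᵖ) (x : X.carrier), e (g • x) = g • e x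

theorem Iso.refl (X : Biset G) : Iso X X := ⟨Equiv.refl _, fun _ _ => rfl, fun _ _ => rfl⟩

theorem Iso.symm {X Y : Biset G} : Iso X Y → Iso Y X := by
  rintro ⟨e, h1, h2⟩
  exact ⟨e.symm, fun g y => by rw [Equiv.symm_apply_eq, h1, Equiv.apply_symm_apply],
    fun g y => by rw [Equiv.symm_apply_eq, h2, Equiv.apply_symm_apply]⟩

theorem Iso.trans {X Y Z : Biset G} : Iso X Y → Iso Y Z → Iso X Z := by
  rintro ⟨e, h1, h2⟩ ⟨f, k1, k2⟩
  exact ⟨e.trans f, fun g x => by simp [h1, k1], fun g x => by simp [h2, k2]⟩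

instance isoSetoid (G : Type) [Group G] : Setoid (Biset G) where
  r := Iso
  iseqv := ⟨Iso.refl, Iso.symm, Iso.trans⟩

/-- The disjoint union of two bisets. -/
def disjUnion (X Y : Biset G) : Biset G where
  carrier := X.carrier ⊕ Y.carrier
  left :=
    { smul := fun g => Sum.map (g • ·) (g • ·)
      one_smul := by rintro (x | y) <;> simp [HSMul.hSMul] <;> exact one_smul _ _
      mul_smul := by rintro g h (x | y) <;> simp [HSMul.hSMul] <;> exact mul_smul _ _ _ }
  right :=
    { smul := fun g => Sum.map (g • ·) (g • ·)
      one_smul := by rintro (x | y) <;> simp [HSMul.hSMul] <;> exact one_smul _ _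
      mul_smul := by rintro g h (x | y) <;> simp [HSMul.hSMul] <;> exact mul_smul _ _ _ }
  comm := ⟨by
    rintro g h (x | y)
    · exact congrArg Sum.inl (smul_comm g h x)
    · exact congrArg Sum.inr (smul_comm g h y)⟩

/-- Two pairs are related if they lie in the same orbit of the left `G`-action
`g (m, n) = (m g⁻¹, g n)` on `M × N`. -/
instance tensorSetoid (M N : Biset G) : Setoid (M.carrier × N.carrier) where
  r p q := ∃ g : G, q = (MulOpposite.op g⁻¹ • p.1, g • p.2)
  iseqv := by
    refine ⟨fun p => ⟨1, by simp⟩, ?_, ?_⟩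
    · rintro p q ⟨g, rfl⟩
      exact ⟨g⁻¹, by simp [smul_smul]⟩
    · rintro p q r ⟨g, rfl⟩ ⟨h, rfl⟩
      exact ⟨h * g, by simp [smul_smul]⟩

/-- The set of `G`-orbits on `M × N`. -/
def TensorCarrier (M N : Biset G) : Type := Quotient (tensorSetoid M N)

/-- `h · [m, n] = [h · m, n]`. -/
instance (M N : Biset G) : MulAction G (TensorCarrier M N) where
  smul h := Quotient.map (fun p => (h • p.1, p.2)) (by
    rintro p q ⟨g, rfl⟩
    exact ⟨g, by simp [smul_comm h]⟩)
  one_smul := by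
    rintro ⟨p⟩
    exact congrArg (Quotient.mk _) (Prod.ext (one_smul G p.1) rfl)
  mul_smul := by
    rintro g h ⟨p⟩
    exact congrArg (Quotient.mk _) (Prod.ext (mul_smul g h p.1) rfl)

/-- `[m, n] · h = [m, n · h]`. -/
instance (M N : Biset G) : MulAction Gᵐᵒᵖ (TensorCarrier M N) where
  smul h := Quotient.map (fun p => (p.1, h • p.2)) (by
    rintro p q ⟨g, rfl⟩
    exact ⟨g, by simp [smul_comm g h]⟩)
  one_smul := by
    rintro ⟨p⟩
    exact congrArg (Quotient.mk _) (Prod.ext rfl (one_smul Gᵐᵒᵖ p.2))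
  mul_smul := by
    rintro g h ⟨p⟩
    exact congrArg (Quotient.mk _) (Prod.ext rfl (mul_smul g h p.2))

/-- The tensor product of two bisets: the set of `G`-orbits on `M × N`, with the left action of
`G` on `M` and the right action of `G` on `N`. -/
def tensor (M N : Biset G) : Biset G where
  carrier := TensorCarrier M N
  fin := inferInstanceAs (Finite (Quotient (tensorSetoid M N)))
  comm := ⟨by
    rintro g h ⟨p⟩
    rfl⟩

/-- The biset `G`, with left and right multiplication. -/
def unit (G : Type) [Group G] [Finite G] : Biset G where
  carrier := G

/-- The underlying set of the biset `(G × G)/U`. -/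
def CosetCarrier (U : Subgroup (G × G)) : Type := (G × G) ⧸ U

instance (U : Subgroup (G × G)) : MulAction (G × G) (CosetCarrier U) :=
  inferInstanceAs (MulAction (G × G) ((G × G) ⧸ U))

/-- `h · y = (h, 1) y`. -/
instance (U : Subgroup (G × G)) : MulAction G (CosetCarrier U) where
  smul h y := ((h, 1) : G × G) • y
  one_smul y := one_smul (G × G) y
  mul_smul g h y := by
    change ((g * h, 1) : G × G) • y = ((g, 1) : G × G) • ((h, 1) : G × G) • y
    rw [smul_smul, Prod.mk_mul_mk, mul_one]

/-- `y · g = (1, g⁻¹) y`. -/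
instance (U : Subgroup (G × G)) : MulAction Gᵐᵒᵖ (CosetCarrier U) where
  smul g y := ((1, g.unop⁻¹) : G × G) • y
  one_smul y := by
    change ((1, (1 : Gᵐᵒᵖ).unop⁻¹) : G × G) • y = y
    rw [MulOpposite.unop_one, inv_one]
    exact one_smul (G × G) y
  mul_smul g h y := by
    change ((1, (g * h).unop⁻¹) : G × G) • y =
      ((1, g.unop⁻¹) : G × G) • ((1, h.unop⁻¹) : G × G) • y
    rw [smul_smul, Prod.mk_mul_mk, mul_one, MulOpposite.unop_mul, mul_inv_rev]

/-- The biset `(G × G)/U`, where `h · y · g = (h, g⁻¹) y`. -/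
def ofSubgroup [Finite G] (U : Subgroup (G × G)) : Biset G where
  carrier := CosetCarrier U
  fin := inferInstanceAs (Finite ((G × G) ⧸ U))
  comm := ⟨fun g h y => by
    change ((g, 1) : G × G) • ((1, h.unop⁻¹) : G × G) • y =
      ((1, h.unop⁻¹) : G × G) • ((g, 1) : G × G) • y
    rw [smul_smul, smul_smul]
    simp⟩

theorem tensor_congr {M M' N N' : Biset G} : Iso M M' → Iso N N' →
    Iso (tensor M N) (tensor M' N') := by
  rintro ⟨e, h1, h2⟩ ⟨f, k1, k2⟩
  refine ⟨Quotient.congr (e.prodCongr f) ?_, ?_, ?_⟩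
  · rintro ⟨a, b⟩ ⟨c, d⟩
    constructor
    · rintro ⟨g, h⟩
      refine ⟨g, ?_⟩
      simp only [Prod.mk.injEq] at h
      simp [h.1, h.2, h2, k1]
    · rintro ⟨g, h⟩
      refine ⟨g, ?_⟩
      simp only [Equiv.prodCongr_apply, Prod.map, Prod.mk.injEq] at h
      rw [← h2, ← k1] at h
      exact Prod.ext (e.injective h.1) (f.injective h.2)
  · rintro g ⟨a, b⟩
    exact congrArg (Quotient.mk _) (Prod.ext (h1 g a) rfl)
  · rintro g ⟨a, b⟩
    exact congrArg (Quotient.mk _) (Prod.ext rfl (k2 g b))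

theorem disjUnion_congr {M M' N N' : Biset G} : Iso M M' → Iso N N' →
    Iso (disjUnion M N) (disjUnion M' N') := by
  rintro ⟨e, h1, h2⟩ ⟨f, k1, k2⟩
  refine ⟨e.sumCongr f, ?_, ?_⟩
  · rintro g (a | b)
    · exact congrArg Sum.inl (h1 g a)
    · exact congrArg Sum.inr (k1 g b)
  · rintro g (a | b)
    · exact congrArg Sum.inl (h2 g a)
    · exact congrArg Sum.inr (k2 g b)

theorem tensor_assoc (L M N : Biset G) :
    Iso (tensor (tensor L M) N) (tensor L (tensor M N)) := by
  refine ⟨⟨?_, ?_, ?_, ?_⟩, ?_, ?_⟩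
  · refine Quotient.lift (fun p : (tensor L M).carrier × N.carrier =>
      (Quotient.lift (fun q : L.carrier × M.carrier =>
        (Quotient.mk _ (q.1, Quotient.mk _ (q.2, p.2)) : (tensor L (tensor M N)).carrier)) ?_
          p.1)) ?_
    · rintro q _ ⟨g, rfl⟩
      exact Quotient.sound ⟨g, rfl⟩
    · rintro ⟨⟨q⟩, n⟩ _ ⟨g, rfl⟩
      exact congrArg (Quotient.mk _) (Prod.ext rfl (Quotient.sound ⟨g, rfl⟩))
  · refine Quotient.lift (fun p : L.carrier × (tensor M N).carrier =>
      (Quotient.lift (fun q : M.carrier × N.carrier =>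
        (Quotient.mk _ (Quotient.mk _ (p.1, q.1), q.2) : (tensor (tensor L M) N).carrier)) ?_
          p.2)) ?_
    · rintro q _ ⟨g, rfl⟩
      exact Quotient.sound ⟨g, rfl⟩
    · rintro ⟨l, ⟨q⟩⟩ _ ⟨g, rfl⟩
      exact congrArg (Quotient.mk _) (Prod.ext (Quotient.sound ⟨g, rfl⟩) rfl)
  · rintro ⟨⟨⟨l, m⟩⟩, n⟩; rfl
  · rintro ⟨l, ⟨⟨m, n⟩⟩⟩; rfl
  · rintro g ⟨⟨⟨l, m⟩⟩, n⟩; rfl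
  · rintro g ⟨⟨⟨l, m⟩⟩, n⟩; rfl

theorem unit_tensor [Finite G] (M : Biset G) : Iso (tensor (unit G) M) M := by
  refine ⟨⟨Quotient.lift (fun p : G × M.carrier => p.1 • p.2) ?_,
    fun m => Quotient.mk _ ((1 : G), m), ?_, ?_⟩, ?_, ?_⟩
  · rintro ⟨(h : G), m⟩ _ ⟨g, rfl⟩
    change h • m = (h * g⁻¹) • g • m
    rw [smul_smul, inv_mul_cancel_right]
  · rintro ⟨⟨(h : G), m⟩⟩
    refine Quotient.sound ⟨h⁻¹, Prod.ext ?_ (inv_smul_smul h m).symm⟩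
    change h = 1 * h⁻¹⁻¹
    rw [one_mul, inv_inv]
  · intro m; exact one_smul G m
  · rintro g ⟨⟨(h : G), m⟩⟩; exact mul_smul g h m
  · rintro g ⟨⟨(h : G), m⟩⟩; exact smul_comm h g m

theorem tensor_unit [Finite G] (M : Biset G) : Iso (tensor M (unit G)) M := by
  refine ⟨⟨Quotient.lift (fun p : M.carrier × G => MulOpposite.op p.2 • p.1) ?_,
    fun m => Quotient.mk _ (m, (1 : G)), ?_, ?_⟩, ?_, ?_⟩
  · rintro ⟨m, (h : G)⟩ _ ⟨g, rfl⟩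
    change MulOpposite.op h • m = MulOpposite.op (g * h) • MulOpposite.op g⁻¹ • m
    rw [smul_smul, ← MulOpposite.op_mul, inv_mul_cancel_left]
  · rintro ⟨⟨m, (h : G)⟩⟩
    refine Quotient.sound ⟨h, Prod.ext ?_ ?_⟩
    · change m = MulOpposite.op h⁻¹ • MulOpposite.op h • m
      rw [smul_smul, ← MulOpposite.op_mul, mul_inv_cancel, MulOpposite.op_one, one_smul]
    · change h = h * 1
      rw [mul_one]
  · intro m; exact one_smul Gᵐᵒᵖ m
  · rintro g ⟨⟨m, (h : G)⟩⟩; exact (smul_comm g (MulOpposite.op h) m).symm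
  · rintro g ⟨⟨m, (h : G)⟩⟩
    change MulOpposite.op (h * g.unop) • m = g • MulOpposite.op h • m
    rw [smul_smul]; rfl

theorem tensor_disjUnion (L M N : Biset G) :
    Iso (tensor L (disjUnion M N)) (disjUnion (tensor L M) (tensor L N)) := by
  refine ⟨⟨?_, ?_, ?_, ?_⟩, ?_, ?_⟩
  · refine Quotient.lift (fun p : L.carrier × (M.carrier ⊕ N.carrier) =>
      (p.2.elim (fun m => Sum.inl (Quotient.mk _ (p.1, m)))
        (fun n => Sum.inr (Quotient.mk _ (p.1, n))) :
        (disjUnion (tensor L M) (tensor L N)).carrier)) ?_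
    rintro ⟨l, (m | n)⟩ _ ⟨g, rfl⟩
    · exact congrArg Sum.inl (Quotient.sound ⟨g, rfl⟩)
    · exact congrArg Sum.inr (Quotient.sound ⟨g, rfl⟩)
  · refine Sum.elim
      (Quotient.map (fun p => (p.1, Sum.inl p.2)) ?_)
      (Quotient.map (fun p => (p.1, Sum.inr p.2)) ?_)
    · rintro p _ ⟨g, rfl⟩; exact ⟨g, rfl⟩
    · rintro p _ ⟨g, rfl⟩; exact ⟨g, rfl⟩
  · rintro ⟨l, (m | n)⟩ <;> rfl
  · rintro (⟨l, m⟩ | ⟨l, n⟩) <;> rfl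
  · rintro g ⟨l, (m | n)⟩ <;> rfl
  · rintro g ⟨l, (m | n)⟩ <;> rfl

theorem disjUnion_tensor (L M N : Biset G) :
    Iso (tensor (disjUnion M N) L) (disjUnion (tensor M L) (tensor N L)) := by
  refine ⟨⟨?_, ?_, ?_, ?_⟩, ?_, ?_⟩
  · refine Quotient.lift (fun p : (M.carrier ⊕ N.carrier) × L.carrier =>
      (p.1.elim (fun m => Sum.inl (Quotient.mk _ (m, p.2)))
        (fun n => Sum.inr (Quotient.mk _ (n, p.2))) :
        (disjUnion (tensor M L) (tensor N L)).carrier)) ?_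
    rintro ⟨(m | n), l⟩ _ ⟨g, rfl⟩
    · exact congrArg Sum.inl (Quotient.sound ⟨g, rfl⟩)
    · exact congrArg Sum.inr (Quotient.sound ⟨g, rfl⟩)
  · refine Sum.elim
      (Quotient.map (fun p => (Sum.inl p.1, p.2)) ?_)
      (Quotient.map (fun p => (Sum.inr p.1, p.2)) ?_)
    · rintro p _ ⟨g, rfl⟩; exact ⟨g, rfl⟩
    · rintro p _ ⟨g, rfl⟩; exact ⟨g, rfl⟩
  · rintro ⟨(m | n), l⟩ <;> rfl
  · rintro (⟨m, l⟩ | ⟨n, l⟩) <;> rfl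
  · rintro g ⟨(m | n), l⟩ <;> rfl
  · rintro g ⟨(m | n), l⟩ <;> rfl

end Biset

/-! ## The double Burnside algebra -/

/-- The isomorphism classes of finite `(G,G)`-bisets. -/
def IsoClass (G : Type) [Group G] := Quotient (Biset.isoSetoid G)

/-- The isomorphism class of a biset. -/
def Biset.isoClass {G : Type} [Group G] (M : Biset G) : IsoClass G := Quotient.mk _ M

/-- The isomorphism classes form a monoid under the tensor product. -/
instance (G : Type) [Group G] [Finite G] : Monoid (IsoClass G) where
  mul := Quotient.map₂ Biset.tensor fun _ _ h _ _ k => Biset.tensor_congr h k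
  one := Quotient.mk _ (Biset.unit G)
  mul_assoc := by
    rintro ⟨a⟩ ⟨b⟩ ⟨c⟩
    exact Quotient.sound (Biset.tensor_assoc a b c)
  one_mul := by
    rintro ⟨a⟩
    exact Quotient.sound (Biset.unit_tensor a)
  mul_one := by
    rintro ⟨a⟩
    exact Quotient.sound (Biset.tensor_unit a)

section Algebra

variable (R : Type) [CommRing R] (G : Type) [Group G] [Finite G]

/-- The basis element of the free `R`-module on the isomorphism classes given by `M`. -/
def freeClass {G : Type} [Group G] [Finite G] (M : Biset G) : MonoidAlgebra R (IsoClass G) :=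
  MonoidAlgebra.single M.isoClass 1

/-- The elements `[M ⊔ N] - [M] - [N]`. -/
def relators : Set (MonoidAlgebra R (IsoClass G)) :=
  {r | ∃ M N : Biset G, r = freeClass R (M.disjUnion N) - freeClass R M - freeClass R N}

/-- The `R`-submodule of relations, generated by the elements `[M ⊔ N] - [M] - [N]`. -/
def relSubmodule : Submodule R (MonoidAlgebra R (IsoClass G)) :=
  Submodule.span R (relators R G)

theorem freeClass_mul (M N : Biset G) :
    freeClass R M * freeClass R N = freeClass R (M.tensor N) := by
  rw [freeClass, freeClass, MonoidAlgebra.single_mul_single, mul_one]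
  rfl

theorem freeClass_congr {M N : Biset G} (h : M.Iso N) : freeClass R M = freeClass R N := by
  unfold freeClass
  rw [show M.isoClass = N.isoClass from Quotient.sound h]

theorem mul_mem_relSubmodule (a x : MonoidAlgebra R (IsoClass G)) (hx : x ∈ relSubmodule R G) :
    a * x ∈ relSubmodule R G := by
  induction a using MonoidAlgebra.induction_linear with
  | zero => simp
  | add f g hf hg => rw [add_mul]; exact add_mem hf hg
  | single c r =>
    obtain ⟨L, rfl⟩ : ∃ L : Biset G, L.isoClass = c := Quotient.exists_rep c
    have e : MonoidAlgebra.single L.isoClass r = r • freeClass R L := by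
      simp [freeClass]
    rw [e, smul_mul_assoc]
    refine Submodule.smul_mem _ _ ?_
    induction hx using Submodule.span_induction with
    | zero => simp
    | add f g _ _ hf hg => rw [mul_add]; exact add_mem hf hg
    | smul s f _ hf => rw [mul_smul_comm]; exact Submodule.smul_mem _ _ hf
    | mem f hf =>
      obtain ⟨M, N, rfl⟩ := hf
      rw [mul_sub, mul_sub, freeClass_mul, freeClass_mul, freeClass_mul,
        freeClass_congr R G (Biset.tensor_disjUnion L M N)]
      exact Submodule.subset_span ⟨_, _, rfl⟩

theorem relSubmodule_mul_mem (a x : MonoidAlgebra R (IsoClass G)) (hx : x ∈ relSubmodule R G) :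
    x * a ∈ relSubmodule R G := by
  induction a using MonoidAlgebra.induction_linear with
  | zero => simp
  | add f g hf hg => rw [mul_add]; exact add_mem hf hg
  | single c r =>
    obtain ⟨L, rfl⟩ : ∃ L : Biset G, L.isoClass = c := Quotient.exists_rep c
    have e : MonoidAlgebra.single L.isoClass r = r • freeClass R L := by
      simp [freeClass]
    rw [e, mul_smul_comm]
    refine Submodule.smul_mem _ _ ?_
    induction hx using Submodule.span_induction with
    | zero => simp
    | add f g _ _ hf hg => rw [add_mul]; exact add_mem hf hg
    | smul s f _ hf => rw [smul_mul_assoc]; exact Submodule.smul_mem _ _ hf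
    | mem f hf =>
      obtain ⟨M, N, rfl⟩ := hf
      rw [sub_mul, sub_mul, freeClass_mul, freeClass_mul, freeClass_mul,
        freeClass_congr R G (Biset.disjUnion_tensor L M N)]
      exact Submodule.subset_span ⟨_, _, rfl⟩

/-- The submodule of relations, as a (two-sided) ideal for the multiplication given on
isomorphism classes by the tensor product. -/
def relIdeal : Ideal (MonoidAlgebra R (IsoClass G)) where
  carrier := relSubmodule R G
  add_mem' := add_mem
  zero_mem' := zero_mem _
  smul_mem' a x hx := mul_mem_relSubmodule R G a x hx

instance : (relIdeal R G).IsTwoSided where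
  mul_mem_of_left b ha := relSubmodule_mul_mem R G b _ ha

/-- The double Burnside `R`-algebra `B_R(G,G)`. -/
abbrev Burnside : Type 1 := MonoidAlgebra R (IsoClass G) ⧸ relIdeal R G

/-- The class `[M]` of a biset. -/
def cls {G : Type} [Group G] [Finite G] (M : Biset G) : Burnside R G :=
  Ideal.Quotient.mk (relIdeal R G) (freeClass R M)

/-- Extension of scalars along `f : R → S`: the ring morphism `B_R(G,G) → B_S(G,G)` with
`r [M] ↦ f(r) [M]`. -/
def Burnside.map {R S : Type} [CommRing R] [CommRing S] (f : R →+* S)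
    (G : Type) [Group G] [Finite G] : Burnside R G →+* Burnside S G :=
  Ideal.Quotient.lift (relIdeal R G)
    ((Ideal.Quotient.mk (relIdeal S G)).comp (MonoidAlgebra.mapRingHom (IsoClass G) f)) (by
      intro x hx
      rw [RingHom.comp_apply, Ideal.Quotient.eq_zero_iff_mem]
      change x ∈ relSubmodule R G at hx
      change _ ∈ relSubmodule S G
      induction hx using Submodule.span_induction with
      | zero => simp
      | add f g _ _ hf hg => rw [map_add]; exact add_mem hf hg
      | smul s x _ hx =>
        have : MonoidAlgebra.mapRingHom (IsoClass G) f (s • x) =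
            f s • MonoidAlgebra.mapRingHom (IsoClass G) f x := by
          ext; simp
        rw [this]; exact Submodule.smul_mem _ _ hx
      | mem x hx =>
        obtain ⟨M, N, rfl⟩ := hx
        refine Submodule.subset_span ⟨M, N, ?_⟩
        simp [freeClass, map_sub])

end Algebra

/-! ## The algebra `A` -/

/-- The ideal `(η², ηξ, ξ²)` of `ℚ[η, ξ]`, where `η = X 0` and `ξ = X 1`. -/
def sqIdeal : Ideal (MvPolynomial (Fin 2) ℚ) :=
  Ideal.span {MvPolynomial.X 0 ^ 2, MvPolynomial.X 0 * MvPolynomial.X 1, MvPolynomial.X 1 ^ 2}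

/-- The local ring `ℚ[η, ξ]/(η², ηξ, ξ²)`. -/
def LocRing : Type := MvPolynomial (Fin 2) ℚ ⧸ sqIdeal

instance : CommRing LocRing := inferInstanceAs (CommRing (MvPolynomial (Fin 2) ℚ ⧸ sqIdeal))
instance : Algebra ℚ LocRing := inferInstanceAs (Algebra ℚ (MvPolynomial (Fin 2) ℚ ⧸ sqIdeal))

/-- The residue class map `ℚ[η, ξ] → ℚ[η, ξ]/(η², ηξ, ξ²)`. -/
def LocRing.mk : MvPolynomial (Fin 2) ℚ →+* LocRing := Ideal.Quotient.mk sqIdeal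

theorem LocRing.mk_eq_zero {p : MvPolynomial (Fin 2) ℚ} : LocRing.mk p = 0 ↔ p ∈ sqIdeal :=
  Ideal.Quotient.eq_zero_iff_mem

theorem LocRing.mk_surjective : Function.Surjective LocRing.mk := Ideal.Quotient.mk_surjective

/-- The residue class of `η`. -/
def eta : LocRing := LocRing.mk (MvPolynomial.X 0)

/-- The residue class of `ξ`. -/
def xi : LocRing := LocRing.mk (MvPolynomial.X 1)

/-- The `ℚ`-algebra morphism `a + b η + c ξ ↦ a`. -/
def aug : LocRing →ₐ[ℚ] ℚ :=
  Ideal.Quotient.liftₐ sqIdeal (MvPolynomial.aeval fun _ => 0) (by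
    intro p hp
    have h : sqIdeal ≤ RingHom.ker (MvPolynomial.aeval (R := ℚ) fun _ : Fin 2 => (0 : ℚ)) := by
      rw [sqIdeal, Ideal.span_le]
      rintro q (rfl | rfl | rfl) <;> simp [RingHom.mem_ker]
    exact h hp)

@[simp] theorem aug_eta : aug eta = 0 := by
  change MvPolynomial.aeval (R := ℚ) (fun _ : Fin 2 => (0 : ℚ)) (MvPolynomial.X 0) = 0
  simp

@[simp] theorem aug_xi : aug xi = 0 := by
  change MvPolynomial.aeval (R := ℚ) (fun _ : Fin 2 => (0 : ℚ)) (MvPolynomial.X 1) = 0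
  simp

@[simp] theorem eta_mul_eta : eta * eta = 0 := by
  rw [eta, ← map_mul, LocRing.mk_eq_zero, ← pow_two]
  exact Ideal.subset_span (by simp)

@[simp] theorem eta_mul_xi : eta * xi = 0 := by
  rw [eta, xi, ← map_mul, LocRing.mk_eq_zero]
  exact Ideal.subset_span (by simp)

@[simp] theorem xi_mul_eta : xi * eta = 0 := by rw [mul_comm, eta_mul_xi]

@[simp] theorem xi_mul_xi : xi * xi = 0 := by
  rw [xi, ← map_mul, LocRing.mk_eq_zero, ← pow_two]
  exact Ideal.subset_span (by simp)

theorem mul_eq_aug_smul (n : LocRing) (h0 : eta * n = 0) (h1 : xi * n = 0) (z : LocRing) :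
    z * n = aug z • n := by
  obtain ⟨p, rfl⟩ := LocRing.mk_surjective z
  induction p using MvPolynomial.induction_on with
  | C a =>
    have e : LocRing.mk (MvPolynomial.C a) = algebraMap ℚ LocRing a := rfl
    rw [e, AlgHom.commutes, Algebra.smul_def]; rfl
  | add p q hp hq => rw [map_add, add_mul, hp, hq, map_add, add_smul]
  | mul_X p i hp =>
    have hi : LocRing.mk (MvPolynomial.X i) * n = 0 ∧
        aug (LocRing.mk (MvPolynomial.X i)) = 0 := by
      fin_cases i
      · exact ⟨h0, aug_eta⟩
      · exact ⟨h1, aug_xi⟩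
    rw [map_mul, mul_assoc, hi.1, map_mul, hi.2]
    simp

@[simp] theorem mul_eta (z : LocRing) : z * eta = aug z • eta :=
  mul_eq_aug_smul eta (by simp) (by simp) z

@[simp] theorem mul_xi (z : LocRing) : z * xi = aug z • xi :=
  mul_eq_aug_smul xi (by simp) (by simp) z

/-- The elements of `A`, written as matrices
```
⎡ s  0  0  t ⎤
⎢ 0  u  0  v ⎥
⎢ 0  0  w  0 ⎥
⎣ x  y  0  z ⎦
```
with entries in the summands `A i j` that are not zero. -/
@[ext] structure A where
  s : Matrix (Fin 3) (Fin 3) ℚ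
  t : Matrix (Fin 3) (Fin 1) ℚ
  u : ℚ
  v : ℚ
  w : ℚ
  x : Matrix (Fin 1) (Fin 3) ℚ
  y : ℚ
  z : LocRing

namespace A

/-- `A` is, as a vector space, the direct sum of its entries. -/
def equivProd : A ≃ Matrix (Fin 3) (Fin 3) ℚ × Matrix (Fin 3) (Fin 1) ℚ × ℚ × ℚ × ℚ ×
    Matrix (Fin 1) (Fin 3) ℚ × ℚ × LocRing where
  toFun a := (a.s, a.t, a.u, a.v, a.w, a.x, a.y, a.z)
  invFun p := ⟨p.1, p.2.1, p.2.2.1, p.2.2.2.1, p.2.2.2.2.1, p.2.2.2.2.2.1, p.2.2.2.2.2.2.1,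
    p.2.2.2.2.2.2.2⟩
  left_inv _ := rfl
  right_inv _ := rfl

instance : AddCommGroup A := equivProd.addCommGroup
instance : Module ℚ A := equivProd.module ℚ

section
variable (a b : A) (q : ℚ)

@[simp] theorem zero_s : (0 : A).s = 0 := rfl
@[simp] theorem zero_t : (0 : A).t = 0 := rfl
@[simp] theorem zero_u : (0 : A).u = 0 := rfl
@[simp] theorem zero_v : (0 : A).v = 0 := rfl
@[simp] theorem zero_w : (0 : A).w = 0 := rfl
@[simp] theorem zero_x : (0 : A).x = 0 := rfl
@[simp] theorem zero_y : (0 : A).y = 0 := rfl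
@[simp] theorem zero_z : (0 : A).z = 0 := rfl
@[simp] theorem add_s : (a + b).s = a.s + b.s := rfl
@[simp] theorem add_t : (a + b).t = a.t + b.t := rfl
@[simp] theorem add_u : (a + b).u = a.u + b.u := rfl
@[simp] theorem add_v : (a + b).v = a.v + b.v := rfl
@[simp] theorem add_w : (a + b).w = a.w + b.w := rfl
@[simp] theorem add_x : (a + b).x = a.x + b.x := rfl
@[simp] theorem add_y : (a + b).y = a.y + b.y := rfl
@[simp] theorem add_z : (a + b).z = a.z + b.z := rfl
@[simp] theorem neg_s : (-a).s = -a.s := rfl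
@[simp] theorem neg_t : (-a).t = -a.t := rfl
@[simp] theorem neg_u : (-a).u = -a.u := rfl
@[simp] theorem neg_v : (-a).v = -a.v := rfl
@[simp] theorem neg_w : (-a).w = -a.w := rfl
@[simp] theorem neg_x : (-a).x = -a.x := rfl
@[simp] theorem neg_y : (-a).y = -a.y := rfl
@[simp] theorem neg_z : (-a).z = -a.z := rfl
@[simp] theorem smul_s : (q • a).s = q • a.s := rfl
@[simp] theorem smul_t : (q • a).t = q • a.t := rfl
@[simp] theorem smul_u : (q • a).u = q * a.u := rfl
@[simp] theorem smul_v : (q • a).v = q * a.v := rfl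
@[simp] theorem smul_w : (q • a).w = q * a.w := rfl
@[simp] theorem smul_x : (q • a).x = q • a.x := rfl
@[simp] theorem smul_y : (q • a).y = q * a.y := rfl
@[simp] theorem smul_z : (q • a).z = q • a.z := rfl
end

instance : One A where
  one := ⟨1, 0, 1, 0, 1, 0, 0, 1⟩

/-- The multiplication of `A`. It is the multiplication of matrices, where `ℚ[η,ξ]/(η²,ηξ,ξ²)`
acts on the other summands via `a + b η + c ξ ↦ a`, where the products of the last column with the
last row, outside the last diagonal entry, are zero, and where the products of the last row with
the last column are `(x, t) ↦ (x t) η` and `(y, v) ↦ y v (ξ - 12 η)`. -/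
instance : Mul A where
  mul a b :=
    { s := a.s * b.s
      t := a.s * b.t + aug b.z • a.t
      u := a.u * b.u
      v := a.u * b.v + a.v * aug b.z
      w := a.w * b.w
      x := a.x * b.s + aug a.z • b.x
      y := a.y * b.u + aug a.z * b.y
      z := (a.x * b.t) 0 0 • eta + (a.y * b.v) • (xi - (12 : ℚ) • eta) + a.z * b.z }

section
variable (a b : A)

@[simp] theorem one_s : (1 : A).s = 1 := rfl
@[simp] theorem one_t : (1 : A).t = 0 := rfl
@[simp] theorem one_u : (1 : A).u = 1 := rfl
@[simp] theorem one_v : (1 : A).v = 0 := rfl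
@[simp] theorem one_w : (1 : A).w = 1 := rfl
@[simp] theorem one_x : (1 : A).x = 0 := rfl
@[simp] theorem one_y : (1 : A).y = 0 := rfl
@[simp] theorem one_z : (1 : A).z = 1 := rfl
@[simp] theorem mul_s : (a * b).s = a.s * b.s := rfl
@[simp] theorem mul_t : (a * b).t = a.s * b.t + aug b.z • a.t := rfl
@[simp] theorem mul_u : (a * b).u = a.u * b.u := rfl
@[simp] theorem mul_v : (a * b).v = a.u * b.v + a.v * aug b.z := rfl
@[simp] theorem mul_w : (a * b).w = a.w * b.w := rfl
@[simp] theorem mul_x : (a * b).x = a.x * b.s + aug a.z • b.x := rfl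
@[simp] theorem mul_y : (a * b).y = a.y * b.u + aug a.z * b.y := rfl
@[simp] theorem mul_z : (a * b).z =
    (a.x * b.t) 0 0 • eta + (a.y * b.v) • (xi - (12 : ℚ) • eta) + a.z * b.z := rfl
end

theorem aug_sub : aug (xi - (12 : ℚ) • eta) = 0 := by simp

theorem mul_sub_eta (z : LocRing) : z * (xi - (12 : ℚ) • eta) = aug z • (xi - (12 : ℚ) • eta) :=
  mul_eq_aug_smul _ (by simp [mul_sub]) (by simp [mul_sub]) z

theorem left_distrib' (a b c : A) : a * (b + c) = a * b + a * c := by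
  ext1
  case z => simp only [mul_z, add_t, add_v, add_z, Matrix.mul_add, Matrix.add_apply, add_smul,
    mul_add]; abel
  all_goals simp [mul_add, Matrix.mul_add, add_smul]
  all_goals abel

theorem right_distrib' (a b c : A) : (a + b) * c = a * c + b * c := by
  ext1
  case z => simp only [mul_z, add_x, add_y, add_z, Matrix.add_mul, Matrix.add_apply, add_smul,
    add_mul]; abel
  all_goals simp [add_mul, Matrix.add_mul, add_smul]
  all_goals abel

theorem aug_mul_z (a b : A) : aug (a * b).z = aug a.z * aug b.z := by
  simp only [mul_z, map_add, map_smul, map_mul, aug_eta, aug_sub, smul_zero, zero_add]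

theorem mul_assoc' (a b c : A) : a * b * c = a * (b * c) := by
  ext1
  case z =>
    have h1 : ∀ n z : LocRing, (z * n = aug z • n) → n * z = aug z • n := fun n z h => by
      rw [mul_comm, h]
    simp only [mul_z, mul_x, mul_y, mul_t, mul_v, add_mul, mul_add, smul_mul_assoc, mul_smul_comm,
      h1 _ _ (mul_eta c.z), h1 _ _ (mul_sub_eta c.z), mul_eta, mul_sub_eta, Matrix.add_mul,
      Matrix.mul_add, Matrix.add_apply, add_smul, Matrix.smul_mul, Matrix.mul_smul,
      Matrix.smul_apply, smul_smul, smul_eq_mul, Matrix.mul_assoc, mul_assoc]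
    module
  case t =>
    simp only [mul_t, mul_s, aug_mul_z, Matrix.mul_add, Matrix.mul_smul, smul_add, smul_smul,
      Matrix.mul_assoc, add_assoc, mul_comm]
  case x =>
    simp only [mul_x, mul_s, aug_mul_z, Matrix.add_mul, Matrix.smul_mul, smul_add, smul_smul,
      Matrix.mul_assoc, add_assoc]
  case s => simp [Matrix.mul_assoc]
  case u => simp [mul_assoc]
  case w => simp [mul_assoc]
  case v => simp only [mul_v, mul_u, aug_mul_z]; ring
  case y => simp only [mul_y, mul_u, aug_mul_z]; ring

instance : Ring A :=
  { (inferInstance : AddCommGroup A), (inferInstance : One A), (inferInstance : Mul A) with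
    left_distrib := left_distrib'
    right_distrib := right_distrib'
    zero_mul := fun a => by ext1 <;> simp
    mul_zero := fun a => by ext1 <;> simp
    mul_assoc := mul_assoc'
    one_mul := fun a => by ext1 <;> simp
    mul_one := fun a => by ext1 <;> simp }

instance : Algebra ℚ A :=
  Algebra.ofModule
    (fun q a b => by
      ext1
      case z => simp [smul_smul, mul_assoc]
      case s | t | x => simp [smul_smul, mul_comm q]
      all_goals simp; try ring)
    (fun q a b => by
      ext1
      case z => simp [smul_smul, mul_left_comm]
      case s | t | x => simp [smul_smul, mul_comm q]
      all_goals simp; try ring)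

end A

/-! ## The basis of `B_ℚ(S₃,S₃)` -/

/-- The symmetric group `S₃`, acting on `{0, 1, 2}`. -/
abbrev S3 : Type := Equiv.Perm (Fin 3)

/-- The transposition `(1,2)`. -/
def a : S3 := Equiv.swap 0 1

/-- The cycle `(1,2,3)`, that is `1 ↦ 2 ↦ 3 ↦ 1`. -/
def b : S3 := finRotate 3

def V0 : Subgroup S3 := ⊥
def V1 : Subgroup S3 := Subgroup.closure {a}
def V4 : Subgroup S3 := Subgroup.closure {b}
def V5 : Subgroup S3 := ⊤

/-- `Δ(V) = {(g, g) : g ∈ V}`. -/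
def diag (V : Subgroup S3) : Subgroup (S3 × S3) :=
  V.map ((MonoidHom.id S3).prod (MonoidHom.id S3))

def U6 : Subgroup (S3 × S3) := Subgroup.closure {(a, a), (1, b)}
def U7 : Subgroup (S3 × S3) := Subgroup.closure {(a, a), (b, 1)}
def U8 : Subgroup (S3 × S3) := Subgroup.closure {(a, a), (b, 1), (1, b)}

/-- The class `[(S₃ × S₃)/U]` in `B_ℚ(S₃,S₃)`. -/
def H (U : Subgroup (S3 × S3)) : Burnside ℚ S3 := cls ℚ (Biset.ofSubgroup U)

def H00 : Burnside ℚ S3 := H (V0.prod V0)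
def H01 : Burnside ℚ S3 := H (V0.prod V1)
def H04 : Burnside ℚ S3 := H (V0.prod V4)
def H05 : Burnside ℚ S3 := H (V0.prod V5)
def H10 : Burnside ℚ S3 := H (V1.prod V0)
def H11 : Burnside ℚ S3 := H (V1.prod V1)
def H14 : Burnside ℚ S3 := H (V1.prod V4)
def H15 : Burnside ℚ S3 := H (V1.prod V5)
def H40 : Burnside ℚ S3 := H (V4.prod V0)
def H41 : Burnside ℚ S3 := H (V4.prod V1)
def H44 : Burnside ℚ S3 := H (V4.prod V4)
def H45 : Burnside ℚ S3 := H (V4.prod V5)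
def H50 : Burnside ℚ S3 := H (V5.prod V0)
def H51 : Burnside ℚ S3 := H (V5.prod V1)
def H54 : Burnside ℚ S3 := H (V5.prod V4)
def H55 : Burnside ℚ S3 := H (V5.prod V5)
def H6 : Burnside ℚ S3 := H U6
def H7 : Burnside ℚ S3 := H U7
def H8 : Burnside ℚ S3 := H U8
def HΔ1 : Burnside ℚ S3 := H (diag V1)
def HΔ4 : Burnside ℚ S3 := H (diag V4)
def HΔ5 : Burnside ℚ S3 := H (diag V5)

def e : Burnside ℚ S3 :=
  (-1/2 : ℚ) • H00 + H10 + (1/2 : ℚ) • H40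

def b_e_g : Burnside ℚ S3 :=
  (1/2 : ℚ) • H00 - H10 - (1/2 : ℚ) • H01 - (1/2 : ℚ) • H40 + H11 + (1/2 : ℚ) • H41

def b_e_h : Burnside ℚ S3 :=
  (-1/8 : ℚ) • H00 + (1/4 : ℚ) • H10 + (1/2 : ℚ) • H01 + (1/8 : ℚ) • H40 - (3/8 : ℚ) • H04
    - H11 - (1/2 : ℚ) • H41 + (3/4 : ℚ) • H14 + (3/8 : ℚ) • H44

def b_g_e : Burnside ℚ S3 :=
  (-4/3 : ℚ) • H00 + (2 : ℚ) • H10 + H40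

def g : Burnside ℚ S3 :=
  (4/3 : ℚ) • H00 - (2 : ℚ) • H10 - (4/3 : ℚ) • H01 - H40 + (2 : ℚ) • H11 + H41

def b_g_h : Burnside ℚ S3 :=
  (-1/3 : ℚ) • H00 + (1/2 : ℚ) • H10 + (4/3 : ℚ) • H01 + (1/4 : ℚ) • H40 - H04 - (2 : ℚ) • H11
    - H41 + (3/2 : ℚ) • H14 + (3/4 : ℚ) • H44

def b_h_e : Burnside ℚ S3 :=
  (-1/3 : ℚ) • H00 + H40

def b_h_g : Burnside ℚ S3 :=
  (1/3 : ℚ) • H00 - (1/3 : ℚ) • H01 - H40 + H41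

def h : Burnside ℚ S3 :=
  (-1/12 : ℚ) • H00 + (1/3 : ℚ) • H01 + (1/4 : ℚ) • H40 - (1/4 : ℚ) • H04 + (3/4 : ℚ) • H44
    - H41

def b_e_ε4 : Burnside ℚ S3 :=
  (-1/8 : ℚ) • H00 + (1/4 : ℚ) • H10 + (1/4 : ℚ) • H01 + (1/8 : ℚ) • H40 + (1/8 : ℚ) • H04
    - (1/2 : ℚ) • H11 - (1/4 : ℚ) • H05 - (1/4 : ℚ) • H41 - (1/4 : ℚ) • H14
    - (1/8 : ℚ) • H44 + (1/2 : ℚ) • H15 + (1/4 : ℚ) • H45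

def b_g_ε4 : Burnside ℚ S3 :=
  (-1/3 : ℚ) • H00 + (1/2 : ℚ) • H10 + (2/3 : ℚ) • H01 + (1/4 : ℚ) • H40 + (1/3 : ℚ) • H04
    - H11 - (2/3 : ℚ) • H05 - (1/2 : ℚ) • H41 - (1/2 : ℚ) • H14 - (1/4 : ℚ) • H44 + H15
    + (1/2 : ℚ) • H45

def b_h_ε4 : Burnside ℚ S3 :=
  (-1/12 : ℚ) • H00 + (1/6 : ℚ) • H01 + (1/4 : ℚ) • H40 + (1/12 : ℚ) • H04 - (1/6 : ℚ) • H05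
    - (1/2 : ℚ) • H41 - (1/4 : ℚ) • H44 + (1/2 : ℚ) • H45

def ε2 : Burnside ℚ S3 :=
  -H00 + H10 + H01 + HΔ1 - (2 : ℚ) • H11

def b_ε2_ε4 : Burnside ℚ S3 :=
  (-1/2 : ℚ) • H00 + (1/2 : ℚ) • H10 + (1/2 : ℚ) • H01 + (1/2 : ℚ) • HΔ1 + (1/2 : ℚ) • H04
    - H11 - (1/2 : ℚ) • H05 - (1/2 : ℚ) • H6 - (1/2 : ℚ) • H14 + H15

def ε3 : Burnside ℚ S3 :=
  (-1/4 : ℚ) • H00 + (1/4 : ℚ) • H40 + (1/4 : ℚ) • H04 + (1/2 : ℚ) • HΔ4 - (3/4 : ℚ) • H44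

def b_ε4_e : Burnside ℚ S3 :=
  (1/6 : ℚ) • H00 - (1/3 : ℚ) • H10 - (1/6 : ℚ) • H40 + (1/3 : ℚ) • H50

def b_ε4_g : Burnside ℚ S3 :=
  (-1/6 : ℚ) • H00 + (1/3 : ℚ) • H10 + (1/6 : ℚ) • H01 + (1/6 : ℚ) • H40 - (1/3 : ℚ) • H11
    - (1/3 : ℚ) • H50 - (1/6 : ℚ) • H41 + (1/3 : ℚ) • H51

def b_ε4_h : Burnside ℚ S3 :=
  (1/24 : ℚ) • H00 - (1/12 : ℚ) • H10 - (1/6 : ℚ) • H01 - (1/24 : ℚ) • H40 + (1/8 : ℚ) • H04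
    + (1/3 : ℚ) • H11 + (1/12 : ℚ) • H50 + (1/6 : ℚ) • H41 - (1/4 : ℚ) • H14
    - (1/8 : ℚ) • H44 - (1/3 : ℚ) • H51 + (1/4 : ℚ) • H54

def b_ε4_ε2 : Burnside ℚ S3 :=
  (-1/2 : ℚ) • H00 + (1/2 : ℚ) • H10 + (1/2 : ℚ) • H01 + (1/2 : ℚ) • HΔ1 + (1/2 : ℚ) • H40
    - H11 - (1/2 : ℚ) • H50 - (1/2 : ℚ) • H41 - (1/2 : ℚ) • H7 + H51

def ε4 : Burnside ℚ S3 :=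
  (1/2 : ℚ) • H00 - HΔ1 - (1/2 : ℚ) • HΔ4 + HΔ5

def b'_ε4_ε4 : Burnside ℚ S3 :=
  (1/24 : ℚ) • H00 - (1/12 : ℚ) • H10 - (1/12 : ℚ) • H01 - (1/24 : ℚ) • H40 - (1/24 : ℚ) • H04
    + (1/6 : ℚ) • H11 + (1/12 : ℚ) • H50 + (1/12 : ℚ) • H05 + (1/12 : ℚ) • H41
    + (1/12 : ℚ) • H14 + (1/24 : ℚ) • H44 - (1/6 : ℚ) • H15 - (1/6 : ℚ) • H51
    - (1/12 : ℚ) • H45 - (1/12 : ℚ) • H54 + (1/6 : ℚ) • H55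

def b''_ε4_ε4 : Burnside ℚ S3 :=
  (1/4 : ℚ) • H00 - (3/4 : ℚ) • H10 - (3/4 : ℚ) • H01 + (1/4 : ℚ) • HΔ1 - (1/4 : ℚ) • H40
    - (1/4 : ℚ) • H04 + (3/2 : ℚ) • H11 + (3/4 : ℚ) • H50 + (3/4 : ℚ) • H05 - (1/4 : ℚ) • H6
    + (3/4 : ℚ) • H41 + (3/4 : ℚ) • H14 - (1/4 : ℚ) • H7 + (1/4 : ℚ) • H44 - (3/2 : ℚ) • H15
    - (3/2 : ℚ) • H51 - (3/4 : ℚ) • H45 - (3/4 : ℚ) • H54 + (1/4 : ℚ) • H8 + (3/2 : ℚ) • H55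

/-- The isomorphism `γ : A → B_ℚ(S₃,S₃)` is the one that is given, entry by entry, by the basis
elements above. -/
def IsGamma (γ : A ≃ₐ[ℚ] Burnside ℚ S3) : Prop :=
  ∀ (r : Matrix (Fin 3) (Fin 3) ℚ) (t : Matrix (Fin 3) (Fin 1) ℚ) (u v w : ℚ)
    (x : Matrix (Fin 1) (Fin 3) ℚ) (y z1 z2 z3 : ℚ),
    γ { s := r, t := t, u := u, v := v, w := w, x := x, y := y,
        z := z1 • 1 + z2 • eta + z3 • xi } =
      r 0 0 • e + r 0 1 • b_e_g + r 0 2 • b_e_h +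
      r 1 0 • b_g_e + r 1 1 • g + r 1 2 • b_g_h +
      r 2 0 • b_h_e + r 2 1 • b_h_g + r 2 2 • h +
      t 0 0 • b_e_ε4 + t 1 0 • b_g_ε4 + t 2 0 • b_h_ε4 +
      u • ε2 + v • b_ε2_ε4 + w • ε3 +
      x 0 0 • b_ε4_e + x 0 1 • b_ε4_g + x 0 2 • b_ε4_h +
      y • b_ε4_ε2 +
      z1 • ε4 + z2 • b'_ε4_ε4 + z3 • b''_ε4_ε4

/-! ## The morphism `δ` -/

/-- The unit `x₁` of `A`, with its inverse. -/
def x1 : Aˣ where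
  val := ⟨!![0, -2, 0; 6, 6, -4; 0, 0, 1], 0, 1, 0, 1, 0, 0, 1⟩
  inv := ⟨!![1/2, 1/6, 2/3; -1/2, 0, 0; 0, 0, 1], 0, 1, 0, 1, 0, 0, 1⟩
  val_inv := by
    ext1 <;> simp
    ext i j
    fin_cases i <;> fin_cases j <;> norm_num [Matrix.mul_apply, Fin.sum_univ_three]
  inv_val := by
    ext1 <;> simp
    ext i j
    fin_cases i <;> fin_cases j <;> norm_num [Matrix.mul_apply, Fin.sum_univ_three]

/-- The unit `x₂` of `A`, with its inverse. -/
def x2 : Aˣ where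
  val := ⟨!![1, 0, 0; 0, 1, 0; 0, 7, 1], 0, 1, 0, 1, 0, 0, 1⟩
  inv := ⟨!![1, 0, 0; 0, 1, 0; 0, -7, 1], 0, 1, 0, 1, 0, 0, 1⟩
  val_inv := by
    ext1 <;> simp
    ext i j
    fin_cases i <;> fin_cases j <;> norm_num [Matrix.mul_apply, Fin.sum_univ_three]
  inv_val := by
    ext1 <;> simp
    ext i j
    fin_cases i <;> fin_cases j <;> norm_num [Matrix.mul_apply, Fin.sum_univ_three]

/-- The unit `x₃` of `A`, with its inverse. -/
def x3 : Aˣ where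
  val := ⟨1, !![0; 0; 1], 1, 0, 1, !![0, 0, 6], 0, 1⟩
  inv := ⟨1, !![0; 0; -1], 1, 0, 1, !![0, 0, -6], 0, 1 + (6 : ℚ) • eta⟩
  val_inv := by
    ext1 <;> simp
    · ext i j
      fin_cases i <;> fin_cases j <;> simp
    · ext i j
      fin_cases i <;> fin_cases j <;> simp
  inv_val := by
    ext1 <;> simp
    · ext i j
      fin_cases i <;> fin_cases j <;> simp
    · ext i j
      fin_cases i <;> fin_cases j <;> simp

/-- The ring morphism `δ : B_ℤ(S₃,S₃) → A`,
`y ↦ x₃⁻¹ x₂⁻¹ x₁⁻¹ γ⁻¹(y) x₁ x₂ x₃`. -/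
def delta (γ : A ≃ₐ[ℚ] Burnside ℚ S3) : Burnside ℤ S3 →+* A where
  toFun y := ↑x3⁻¹ * ↑x2⁻¹ * ↑x1⁻¹ * γ.symm (Burnside.map (Int.castRingHom ℚ) S3 y) *
    ↑x1 * ↑x2 * ↑x3
  map_zero' := by simp
  map_one' := by simp [mul_assoc]
  map_add' p q := by simp [mul_add, add_mul]
  map_mul' p q := by simp [mul_assoc]

/-! ## The order `A_ℤ` and the congruences -/

/-- The element of `A` with the integral entries
```
⎡ s  0  0  t                 ⎤
⎢ 0  u  0  v                 ⎥
⎢ 0  0  w  0                 ⎥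
⎣ x  y  0  z1 + z2 η + z3 ξ  ⎦
```
-/
def intElt (s : Matrix (Fin 3) (Fin 3) ℤ) (t : Fin 3 → ℤ) (u v w : ℤ) (x : Fin 3 → ℤ)
    (y z1 z2 z3 : ℤ) : A where
  s := s.map (fun n : ℤ => (n : ℚ))
  t := Matrix.of fun i _ => (t i : ℚ)
  u := u
  v := v
  w := w
  x := Matrix.of fun _ j => (x j : ℚ)
  y := y
  z := (z1 : ℚ) • 1 + (z2 : ℚ) • eta + (z3 : ℚ) • xi

theorem intElt_one : (1 : A) = intElt 1 0 1 0 1 0 0 1 0 0 := by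
  ext1 <;> simp [intElt] <;> rfl

theorem intElt_zero : (0 : A) = intElt 0 0 0 0 0 0 0 0 0 0 := by
  ext1 <;> simp [intElt] <;> rfl

theorem intElt_add (s t u v w x y z1 z2 z3 s' t' u' v' w' x' y' z1' z2' z3') :
    intElt s t u v w x y z1 z2 z3 + intElt s' t' u' v' w' x' y' z1' z2' z3' =
      intElt (s + s') (t + t') (u + u') (v + v') (w + w') (x + x') (y + y') (z1 + z1') (z2 + z2')
        (z3 + z3') := by
  ext1
  case z => simp [intElt]; module
  all_goals simp [intElt] <;> ext <;> simp

theorem intElt_neg (s t u v w x y z1 z2 z3) :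
    -intElt s t u v w x y z1 z2 z3 =
      intElt (-s) (-t) (-u) (-v) (-w) (-x) (-y) (-z1) (-z2) (-z3) := by
  ext1
  case z => simp [intElt]; module
  all_goals simp [intElt] <;> ext <;> simp

theorem intElt_mul (s t u v w x y z1 z2 z3 s' t' u' v' w' x' y' z1' z2' z3') :
    intElt s t u v w x y z1 z2 z3 * intElt s' t' u' v' w' x' y' z1' z2' z3' =
      intElt (s * s') (fun i => s i 0 * t' 0 + s i 1 * t' 1 + s i 2 * t' 2 + z1' * t i) (u * u')
        (u * v' + v * z1') (w * w')
        (fun j => x 0 * s' 0 j + x 1 * s' 1 j + x 2 * s' 2 j + z1 * x' j) (y * u' + z1 * y')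
        (z1 * z1')
        (x 0 * t' 0 + x 1 * t' 1 + x 2 * t' 2 - 12 * (y * v') + z1 * z2' + z2 * z1')
        (y * v' + z1 * z3' + z3 * z1') := by
  ext1
  case z =>
    simp [intElt, Matrix.mul_apply, Fin.sum_univ_three, mul_add, add_mul]
    module
  all_goals simp [intElt]
  all_goals ext i j
  all_goals simp [Matrix.mul_apply, Fin.sum_univ_three]

/-- The order `A_ℤ`: the elements of `A` with integral entries, the last one being in
`ℤ[η, ξ]/(η², ηξ, ξ²)`. -/
def AZ : Subring A where
  carrier := {p | ∃ s t u v w x y z1 z2 z3, p = intElt s t u v w x y z1 z2 z3}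
  zero_mem' := ⟨_, _, _, _, _, _, _, _, _, _, intElt_zero⟩
  one_mem' := ⟨_, _, _, _, _, _, _, _, _, _, intElt_one⟩
  add_mem' := by
    rintro _ _ ⟨s, t, u, v, w, x, y, z1, z2, z3, rfl⟩
      ⟨s', t', u', v', w', x', y', z1', z2', z3', rfl⟩
    exact ⟨_, _, _, _, _, _, _, _, _, _, intElt_add ..⟩
  neg_mem' := by
    rintro _ ⟨s, t, u, v, w, x, y, z1, z2, z3, rfl⟩
    exact ⟨_, _, _, _, _, _, _, _, _, _, intElt_neg ..⟩
  mul_mem' := by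
    rintro _ _ ⟨s, t, u, v, w, x, y, z1, z2, z3, rfl⟩
      ⟨s', t', u', v', w', x', y', z1', z2', z3', rfl⟩
    exact ⟨_, _, _, _, _, _, _, _, _, _, intElt_mul ..⟩

/-- The congruences that cut `Λ` out of `A_ℤ`. -/
structure Congruences (t : Fin 3 → ℤ) (v w : ℤ) (x : Fin 3 → ℤ) (y z1 z2 z3 : ℤ) : Prop where
  wz : 2 * w - 2 * z1 ≡ z2 [ZMOD 8]
  zz : z2 ≡ z3 [ZMOD 4]
  z3_four : z3 ≡ 0 [ZMOD 4]
  x_four : ∀ j, x j ≡ 0 [ZMOD 4]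
  y_two : y ≡ 0 [ZMOD 2]
  t_two : ∀ i, t i ≡ 0 [ZMOD 2]
  v_two : v ≡ 0 [ZMOD 2]
  x_three : ∀ j, x j ≡ 0 [ZMOD 3]
  z2_three : z2 ≡ 0 [ZMOD 3]

theorem Congruences.iff {t : Fin 3 → ℤ} {v w : ℤ} {x : Fin 3 → ℤ} {y z1 z2 z3 : ℤ} :
    Congruences t v w x y z1 z2 z3 ↔
      (∃ k m : ℤ, z2 = 12 * k ∧ w = z1 + 6 * k + 4 * m) ∧ 4 ∣ z3 ∧ (∀ j, 12 ∣ x j) ∧ 2 ∣ y ∧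
        (∀ i, 2 ∣ t i) ∧ 2 ∣ v := by
  constructor
  · rintro ⟨h1, h2, h3, h4, h5, h6, h7, h8, h9⟩
    simp only [Int.ModEq] at *
    refine ⟨⟨z2 / 12, (w - z1 - 6 * (z2 / 12)) / 4, by omega, by omega⟩, by omega, ?_, by omega,
      fun i => ?_, by omega⟩
    · intro j
      have := h4 j
      have := h8 j
      omega
    · have := h6 i
      omega
  · rintro ⟨⟨k, m, rfl, rfl⟩, h3, h4, h5, h6, h7⟩
    constructor
    all_goals simp only [Int.ModEq] at *
    case x_four => intro j; have := h4 j; omega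
    case x_three => intro j; have := h4 j; omega
    case t_two => intro i; have := h6 i; omega
    all_goals omega

/-- The subring `Λ` of `A`: the elements of `A_ℤ` that satisfy the congruences. -/
def Lam : Subring A where
  carrier := {p | ∃ s t u v w x y z1 z2 z3, p = intElt s t u v w x y z1 z2 z3 ∧
    Congruences t v w x y z1 z2 z3}
  zero_mem' := ⟨_, _, _, _, _, _, _, _, _, _, intElt_zero, by
    rw [Congruences.iff]
    exact ⟨⟨0, 0, by simp⟩, by simp⟩⟩
  one_mem' := ⟨_, _, _, _, _, _, _, _, _, _, intElt_one, by
    rw [Congruences.iff]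
    exact ⟨⟨0, 0, by simp⟩, by simp⟩⟩
  add_mem' := by
    rintro _ _ ⟨s, t, u, v, w, x, y, z1, z2, z3, rfl, h⟩
      ⟨s', t', u', v', w', x', y', z1', z2', z3', rfl, h'⟩
    refine ⟨_, _, _, _, _, _, _, _, _, _, intElt_add .., ?_⟩
    rw [Congruences.iff] at *
    obtain ⟨⟨k, m, rfl, rfl⟩, h3, h4, h5, h6, h7⟩ := h
    obtain ⟨⟨k', m', rfl, rfl⟩, h3', h4', h5', h6', h7'⟩ := h'
    exact ⟨⟨k + k', m + m', by ring, by ring⟩, dvd_add h3 h3', fun j => dvd_add (h4 j) (h4' j),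
      dvd_add h5 h5', fun j => dvd_add (h6 j) (h6' j), dvd_add h7 h7'⟩
  neg_mem' := by
    rintro _ ⟨s, t, u, v, w, x, y, z1, z2, z3, rfl, h⟩
    refine ⟨_, _, _, _, _, _, _, _, _, _, intElt_neg .., ?_⟩
    rw [Congruences.iff] at *
    obtain ⟨⟨k, m, rfl, rfl⟩, h3, h4, h5, h6, h7⟩ := h
    exact ⟨⟨-k, -m, by ring, by ring⟩, h3.neg_right, fun j => (h4 j).neg_right, h5.neg_right,
      fun j => (h6 j).neg_right, h7.neg_right⟩
  mul_mem' := by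
    rintro _ _ ⟨s, t, u, v, w, x, y, z1, z2, z3, rfl, h⟩
      ⟨s', t', u', v', w', x', y', z1', z2', z3', rfl, h'⟩
    refine ⟨_, _, _, _, _, _, _, _, _, _, intElt_mul .., ?_⟩
    rw [Congruences.iff] at *
    obtain ⟨⟨k, m, rfl, rfl⟩, ⟨c, rfl⟩, h4, ⟨d, rfl⟩, h6, ⟨f, rfl⟩⟩ := h
    obtain ⟨⟨k', m', rfl, rfl⟩, ⟨c', rfl⟩, h4', ⟨d', rfl⟩, h6', ⟨f', rfl⟩⟩ := h'
    choose X hX using h4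
    choose X' hX' using h4'
    choose T hT using h6
    choose T' hT' using h6'
    refine ⟨⟨X 0 * t' 0 + X 1 * t' 1 + X 2 * t' 2 - 4 * d * f' + z1 * k' + k * z1',
      z1 * m' + m * z1' + (6 * k + 4 * m) * m' + 6 * m * k' + 9 * k * k'
        - 3 * (X 0 * T' 0 + X 1 * T' 1 + X 2 * T' 2) + 6 * d * f', ?_, ?_⟩,
      ⟨d * f' + z1 * c' + c * z1', by ring⟩, fun j => ?_,
      ⟨d * u' + z1 * d', by ring⟩, fun i => ?_, ⟨u * f' + f * z1', by ring⟩⟩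
    · rw [hX 0, hX 1, hX 2]; ring
    · rw [hT' 0, hT' 1, hT' 2]; ring
    · exact ⟨X 0 * s' 0 j + X 1 * s' 1 j + X 2 * s' 2 j + z1 * X' j, by
        rw [hX 0, hX 1, hX 2, hX' j]; ring⟩
    · exact ⟨s i 0 * T' 0 + s i 1 * T' 1 + s i 2 * T' 2 + z1' * T i, by
        rw [hT' 0, hT' 1, hT' 2, hT i]; ring⟩

end DoubleBurnside

end

/-! The theorem reduces to linear algebra over a list of 22 generators. A `(G,G)`-biset is a set
with an action of `G × G`, hence the sum of its orbits. Each orbit is `(G × G)/U` for a stabilizer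
`U`, and conjugate `U` give isomorphic bisets. Up to conjugacy `S₃ × S₃` has 22 subgroups
(`exists_isConjRep`), so 22 classes `transCls R i` span `B_R`, over `ℤ` and over `ℚ` alike
(`span_transCls`). The Mackey formula `cls_ofSubgroup_mul` gives their products: one transitive
biset for each double coset.

The map `δ` is constructed before `γ`. The linear map `deltaLin` from `B_ℚ` to `A` has tabulated
integral values on the 22 generators. Its existence does not presuppose that these form a basis:
`[M] ↦ ∑ w (stab m)`, summed over the points of `M`, respects isomorphisms and disjoint unions for
every function `w` on subgroups (`exists_linearMap_stab`). Multiplicativity of `deltaLin` amounts to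
the 22² products of generators (`mulCoord_deltaCoord`).

Bijectivity follows from a single matrix identity, `lamCoord_single`, which writes each member of a
`ℤ`-basis of `Λ` as an integral combination of the 22 images. Since `Λ` spans `A` over `ℚ`, the map
`deltaLin` is surjective. Since `A` has dimension 22, the 22 images are then linearly independent,
so `deltaLin` is injective, and so is its restriction to `B_ℤ`. The same identity shows that `Λ`
lies in the image of `B_ℤ`; conversely each of the 22 images satisfies the congruences.

Finally, `γ` is the inverse of `deltaLin`, preceded by conjugation with `X = X₁X₂X₃`, so that `δ` is
the restriction of `deltaLin` by construction. What remains is that `γ` has the prescribed values: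
`E X = X · deltaLin b` for each coordinate vector `E` of `A` and its prescribed image `b`
(`mulCoord_unitCoord`).

The finite checks are run by the kernel on integers, with subgroups of `S₃ × S₃` encoded as 36-bit
masks. -/

open scoped MulOpposite
noncomputable section
namespace DoubleBurnside

/-! ## Decomposition of bisets into orbits -/

namespace Biset

variable {G : Type} [Group G]

/-- The left action of `G × G` on a biset: `(h, g) m = h · m · g⁻¹`. -/
def act (M : Biset G) (p : G × G) (m : M.carrier) : M.carrier :=
  p.1 • MulOpposite.op p.2⁻¹ • m

theorem act_one (M : Biset G) (m : M.carrier) : M.act 1 m = m := by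
  simp [act]

theorem act_mul (M : Biset G) (p q : G × G) (m : M.carrier) :
    M.act (p * q) m = M.act p (M.act q m) := by
  simp only [act, Prod.fst_mul, Prod.snd_mul, mul_inv_rev, MulOpposite.op_mul, mul_smul]
  rw [← smul_comm q.1 (MulOpposite.op p.2⁻¹)]

theorem act_inv_act (M : Biset G) (p : G × G) (m : M.carrier) :
    M.act p⁻¹ (M.act p m) = m := by
  rw [← act_mul, inv_mul_cancel, act_one]

theorem smul_eq_act (M : Biset G) (g : G) (m : M.carrier) : g • m = M.act (g, 1) m := by
  simp [act]

theorem op_smul_eq_act (M : Biset G) (g : Gᵐᵒᵖ) (m : M.carrier) :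
    g • m = M.act (1, g.unop⁻¹) m := by
  simp [act]

/-- The stabilizer of an element of a biset in `G × G`. -/
def stab (M : Biset G) (m : M.carrier) : Subgroup (G × G) where
  carrier := {p | M.act p m = m}
  one_mem' := M.act_one m
  mul_mem' {p q} hp hq := by
    change M.act (p * q) m = m
    rw [act_mul, hq, hp]
  inv_mem' {p} hp := by
    change M.act p⁻¹ m = m
    conv_lhs => rw [← show M.act p m = m from hp]
    exact M.act_inv_act p m

theorem mem_stab {M : Biset G} {m : M.carrier} {p : G × G} : p ∈ M.stab m ↔ M.act p m = m :=
  Iff.rfl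

/-- The orbit relation of `G × G` on a biset. -/
def orbitRel (M : Biset G) : Setoid M.carrier where
  r m n := ∃ p, M.act p m = n
  iseqv := ⟨fun m => ⟨1, M.act_one m⟩, by
    rintro m n ⟨p, rfl⟩
    exact ⟨p⁻¹, M.act_inv_act p m⟩, by
    rintro m n k ⟨p, rfl⟩ ⟨q, rfl⟩
    exact ⟨q * p, M.act_mul q p m⟩⟩

/-- The orbits of `G × G` on a biset. -/
def Orbits (M : Biset G) : Type := Quotient M.orbitRel

/-- The orbit of an element. -/
def orb (M : Biset G) (m : M.carrier) : M.Orbits := Quotient.mk M.orbitRel m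

instance (M : Biset G) : Finite M.Orbits := inferInstanceAs (Finite (Quotient M.orbitRel))

theorem orb_eq_orb {M : Biset G} {m n : M.carrier} :
    M.orb m = M.orb n ↔ ∃ p, M.act p m = n :=
  Quotient.eq (r := M.orbitRel)

theorem orb_act (M : Biset G) (p : G × G) (m : M.carrier) : M.orb (M.act p m) = M.orb m :=
  (orb_eq_orb.2 ⟨p, rfl⟩).symm

theorem orb_smul (M : Biset G) (g : G) (m : M.carrier) : M.orb (g • m) = M.orb m := by
  rw [smul_eq_act, orb_act]

theorem orb_op_smul (M : Biset G) (g : Gᵐᵒᵖ) (m : M.carrier) : M.orb (g • m) = M.orb m := by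
  rw [op_smul_eq_act, orb_act]

/-- The union of a set of orbits. -/
def sub (M : Biset G) (P : Set M.Orbits) : Biset G where
  carrier := {m : M.carrier // M.orb m ∈ P}
  left :=
    { smul := fun g m => ⟨g • m.1, by rw [orb_smul]; exact m.2⟩
      one_smul := fun m => Subtype.ext (one_smul G m.1)
      mul_smul := fun g h m => Subtype.ext (mul_smul g h m.1) }
  right :=
    { smul := fun g m => ⟨g • m.1, by rw [orb_op_smul]; exact m.2⟩
      one_smul := fun m => Subtype.ext (one_smul Gᵐᵒᵖ m.1)
      mul_smul := fun g h m => Subtype.ext (mul_smul g h m.1) }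
  comm :=
    letI : SMul G {m : M.carrier // M.orb m ∈ P} :=
      ⟨fun g m => ⟨g • m.1, by rw [orb_smul]; exact m.2⟩⟩
    letI : SMul Gᵐᵒᵖ {m : M.carrier // M.orb m ∈ P} :=
      ⟨fun g m => ⟨g • m.1, by rw [orb_op_smul]; exact m.2⟩⟩
    ⟨fun g h m => Subtype.ext (smul_comm g h m.1)⟩

theorem sub_union (M : Biset G) {P Q : Set M.Orbits} (hPQ : Disjoint P Q) :
    Iso (disjUnion (M.sub P) (M.sub Q)) (M.sub (P ∪ Q)) := by
  refine ⟨Equiv.ofBijective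
    (fun x => (Sum.elim (fun m => ⟨m.1, Or.inl m.2⟩) (fun m => ⟨m.1, Or.inr m.2⟩)
      (x : (M.sub P).carrier ⊕ (M.sub Q).carrier) : (M.sub (P ∪ Q)).carrier)) ⟨?_, ?_⟩, ?_, ?_⟩
  · rintro (x | x) (y | y) hxy
    · have h := congrArg Subtype.val hxy
      exact congrArg Sum.inl (Subtype.ext h)
    · exact absurd (congrArg Subtype.val hxy)
        fun h : x.1 = y.1 => Set.disjoint_left.1 hPQ x.2 (h ▸ y.2)
    · exact absurd (congrArg Subtype.val hxy)
        fun h : x.1 = y.1 => Set.disjoint_left.1 hPQ (h ▸ y.2) x.2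
    · have h := congrArg Subtype.val hxy
      exact congrArg Sum.inr (Subtype.ext h)
  · rintro ⟨m, hm | hm⟩
    · exact ⟨Sum.inl ⟨m, hm⟩, rfl⟩
    · exact ⟨Sum.inr ⟨m, hm⟩, rfl⟩
  · rintro g (x | x) <;> rfl
  · rintro g (x | x) <;> rfl

theorem sub_univ (M : Biset G) : Iso (M.sub Set.univ) M :=
  ⟨Equiv.subtypeUnivEquiv fun _ => trivial, fun _ _ => rfl, fun _ _ => rfl⟩

/-- The coset `p U` as an element of `(G × G)/U`. -/
def cosetMk [Finite G] (U : Subgroup (G × G)) (p : G × G) : (ofSubgroup U).carrier :=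
  (QuotientGroup.mk p : (G × G) ⧸ U)

theorem cosetMk_surjective [Finite G] (U : Subgroup (G × G)) :
    Function.Surjective (cosetMk U) :=
  QuotientGroup.mk_surjective

theorem cosetMk_eq_iff [Finite G] {U : Subgroup (G × G)} {p q : G × G} :
    cosetMk U p = cosetMk U q ↔ p⁻¹ * q ∈ U :=
  QuotientGroup.eq

theorem act_cosetMk [Finite G] (U : Subgroup (G × G)) (p q : G × G) :
    (ofSubgroup U).act p (cosetMk U q) = cosetMk U (p * q) := by
  change cosetMk U ((p.1, 1) * ((1, (p.2⁻¹)⁻¹) * q)) = _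
  rw [← mul_assoc]
  simp

/-- A map of sets that commutes with `act` is a morphism of bisets. -/
theorem iso_of_act {M N : Biset G} (e : M.carrier ≃ N.carrier)
    (he : ∀ p m, e (M.act p m) = N.act p (e m)) : Iso M N :=
  ⟨e, fun g m => by rw [smul_eq_act, he, ← smul_eq_act],
    fun g m => by rw [op_smul_eq_act, he, ← op_smul_eq_act]⟩

/-- The orbit of `m` is isomorphic to `(G × G)/U`, where `U` is the stabilizer of `m`. -/
theorem ofSubgroup_stab_iso [Finite G] (M : Biset G) (m : M.carrier) :
    Iso (ofSubgroup (M.stab m)) (M.sub {M.orb m}) := by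
  -- One equivalence serves twice: left to right the map `p U ↦ p m` is well defined, right to left
  -- it is injective.
  have key : ∀ p q : G × G, p⁻¹ * q ∈ M.stab m ↔ M.act p m = M.act q m := by
    intro p q
    rw [mem_stab, act_mul]
    constructor
    · intro h
      rw [← h, ← act_mul, mul_inv_cancel, act_one, h]
    · intro h
      rw [← h, act_inv_act]
  let f : (ofSubgroup (M.stab m)).carrier → (M.sub {M.orb m}).carrier :=
    Quotient.lift (s := QuotientGroup.leftRel (M.stab m))
      (fun p => (⟨M.act p m, M.orb_act p m⟩ : (M.sub {M.orb m}).carrier))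
      (fun p q hpq => Subtype.ext ((key p q).1 (QuotientGroup.leftRel_apply.1 hpq)))
  refine iso_of_act (Equiv.ofBijective f ⟨?_, ?_⟩) ?_
  · rintro ⟨p⟩ ⟨q⟩ h
    exact QuotientGroup.eq.2 ((key p q).2 (congrArg Subtype.val h))
  · rintro ⟨n, hn⟩
    obtain ⟨p, hp⟩ := orb_eq_orb.1 (Eq.symm hn)
    exact ⟨cosetMk _ p, Subtype.ext hp⟩
  · intro p y
    obtain ⟨q, rfl⟩ := cosetMk_surjective _ y
    rw [act_cosetMk]
    exact Subtype.ext (M.act_mul p q m)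

/-- Consequently the stabilizers occurring in a transitive biset form one full conjugacy class. -/
theorem stab_cosetMk [Finite G] (U : Subgroup (G × G)) (c : G × G) :
    (ofSubgroup U).stab (cosetMk U c) = U.map (MulAut.conj c).toMonoidHom := by
  ext p
  rw [mem_stab, act_cosetMk, Subgroup.mem_map, eq_comm, cosetMk_eq_iff]
  constructor
  · intro h
    exact ⟨c⁻¹ * (p * c), h, by simp [mul_assoc]⟩
  · rintro ⟨u, hu, rfl⟩
    simpa [mul_assoc] using hu

/-- Conjugate subgroups give isomorphic bisets. -/
theorem ofSubgroup_conj_iso [Finite G] (U : Subgroup (G × G)) (c : G × G) :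
    Iso (ofSubgroup U) (ofSubgroup (U.map (MulAut.conj c).toMonoidHom)) := by
  -- The biset `(G × G)/U` is a single orbit, so the orbit-stabilizer isomorphism at the point `c
  -- U`, whose stabilizer is the conjugate of `U` by `c`, describes all of it.
  have ho : ({(ofSubgroup U).orb (cosetMk U c)} : Set _) = Set.univ := by
    refine Set.eq_univ_of_forall fun o => ?_
    obtain ⟨y, rfl⟩ : ∃ y, (ofSubgroup U).orb y = o := Quotient.exists_rep o
    obtain ⟨q, rfl⟩ := cosetMk_surjective U y
    refine orb_eq_orb.2 ⟨c * q⁻¹, ?_⟩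
    rw [act_cosetMk, inv_mul_cancel_right]
  have h := ofSubgroup_stab_iso (ofSubgroup U) (cosetMk U c)
  rw [stab_cosetMk, ho] at h
  exact (h.trans (sub_univ _)).symm

end Biset

/-! ### Classes of bisets as sums over orbits -/

section Classes

variable (R : Type) [CommRing R] {G : Type} [Group G] [Finite G]

theorem cls_congr {M N : Biset G} (h : M.Iso N) : cls R M = cls R N := by
  rw [cls, cls, freeClass_congr R G h]

theorem cls_mul (M N : Biset G) : cls R M * cls R N = cls R (M.tensor N) := by
  rw [cls, cls, cls, ← map_mul, freeClass_mul]

theorem cls_disjUnion (M N : Biset G) : cls R (M.disjUnion N) = cls R M + cls R N := by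
  rw [cls, cls, cls, ← map_add, ← sub_eq_zero, ← map_sub, Ideal.Quotient.eq_zero_iff_mem]
  refine Submodule.subset_span ⟨M, N, ?_⟩
  abel

/-- The empty biset is the disjoint union of two copies of itself, so its class `x` satisfies `x + x
= x`. -/
theorem cls_sub_empty (M : Biset G) : cls R (M.sub ∅) = 0 := by
  have h := cls_congr R (M.sub_union (Set.disjoint_empty (∅ : Set M.Orbits)))
  rw [cls_disjUnion, Set.union_empty] at h
  exact add_eq_right.1 h

theorem cls_sub_finset (M : Biset G) (s : Finset M.Orbits) :
    cls R (M.sub ↑s) = ∑ o ∈ s, cls R (M.sub {o}) := by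
  classical
  induction s using Finset.induction_on with
  | empty => rw [Finset.coe_empty, cls_sub_empty, Finset.sum_empty]
  | insert o s ho ih =>
    rw [Finset.sum_insert ho, ← ih, ← cls_disjUnion, Finset.coe_insert, Set.insert_eq]
    refine (cls_congr R (M.sub_union ?_)).symm
    rw [Set.disjoint_singleton_left]
    exact ho

/-- A biset is the sum of its orbits, for any choice of representatives. -/
theorem cls_eq_sum {ι : Type*} (M : Biset G) (s : Finset ι) (x : ι → M.carrier)
    (hinj : ∀ i ∈ s, ∀ j ∈ s, M.orb (x i) = M.orb (x j) → i = j)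
    (hsurj : ∀ m, ∃ i ∈ s, M.orb (x i) = M.orb m) :
    cls R M = ∑ i ∈ s, cls R (Biset.ofSubgroup (M.stab (x i))) := by
  classical
  have : (↑(s.image fun i => M.orb (x i)) : Set M.Orbits) = Set.univ := by
    refine Set.eq_univ_of_forall fun o => ?_
    obtain ⟨m, rfl⟩ : ∃ m, M.orb m = o := Quotient.exists_rep o
    obtain ⟨i, hi, him⟩ := hsurj m
    exact Finset.mem_coe.2 (Finset.mem_image.2 ⟨i, hi, him⟩)
  rw [← cls_congr R M.sub_univ, ← this, cls_sub_finset, Finset.sum_image hinj]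
  exact Finset.sum_congr rfl fun i _ => (cls_congr R (M.ofSubgroup_stab_iso (x i))).symm

/-- The double Burnside algebra is spanned by the classes of the transitive bisets. -/
theorem span_cls_ofSubgroup :
    Submodule.span R (Set.range fun U : Subgroup (G × G) => cls R (Biset.ofSubgroup U)) = ⊤ := by
  classical
  refine eq_top_iff.2 fun y _ => ?_
  obtain ⟨f, rfl⟩ := Ideal.Quotient.mk_surjective y
  induction f using MonoidAlgebra.induction_linear with
  | zero => rw [map_zero]; exact zero_mem _
  | add f g hf hg => rw [map_add]; exact add_mem (hf trivial) (hg trivial)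
  | single c r =>
    obtain ⟨M, rfl⟩ : ∃ M : Biset G, M.isoClass = c := Quotient.exists_rep c
    have e : Ideal.Quotient.mk (relIdeal R G) (MonoidAlgebra.single M.isoClass r) =
        r • cls R M := by
      have : MonoidAlgebra.single M.isoClass r = r • freeClass R M := by simp [freeClass]
      rw [this]
      rfl
    have := Fintype.ofFinite M.Orbits
    rw [e, cls_eq_sum R M Finset.univ (fun o : M.Orbits => Quotient.out (s := M.orbitRel) o)]
    · exact Submodule.smul_mem _ _ (Submodule.sum_mem _ fun o _ =>
        Submodule.subset_span ⟨_, rfl⟩)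
    · intro o _ o' _ h
      have h1 : ∀ o : M.Orbits, M.orb (Quotient.out (s := M.orbitRel) o) = o :=
        fun o => Quotient.out_eq (s := M.orbitRel) o
      rwa [h1, h1] at h
    · intro m
      exact ⟨M.orb m, Finset.mem_univ _, Quotient.out_eq (s := M.orbitRel) _⟩

end Classes

/-! ## The Mackey formula -/

section Mackey

variable {G : Type} [Group G]

/-- The composition `U * ᵐV = {(h, g) : (h, k) ∈ U and (m⁻¹ k m, g) ∈ V for some k}`. -/
def starConj (U V : Subgroup (G × G)) (m : G) : Subgroup (G × G) where
  carrier := {p | ∃ k, (p.1, k) ∈ U ∧ (m⁻¹ * k * m, p.2) ∈ V}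
  one_mem' := ⟨1, U.one_mem, by simp [Prod.mk_one_one, V.one_mem]⟩
  mul_mem' := by
    rintro p q ⟨k, hk, hk'⟩ ⟨l, hl, hl'⟩
    exact ⟨k * l, U.mul_mem hk hl, by simpa [mul_assoc] using V.mul_mem hk' hl'⟩
  inv_mem' := by
    rintro p ⟨k, hk, hk'⟩
    exact ⟨k⁻¹, U.inv_mem hk, by simpa [mul_assoc] using V.inv_mem hk'⟩

theorem mem_starConj {U V : Subgroup (G × G)} {m : G} {p : G × G} :
    p ∈ starConj U V m ↔ ∃ k, (p.1, k) ∈ U ∧ (m⁻¹ * k * m, p.2) ∈ V := Iff.rfl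

/-- The double coset relation of `p₂(U)` and `p₁(V)`. -/
def DoubleCosetRel (U V : Subgroup (G × G)) (m n : G) : Prop :=
  ∃ k, (∃ h, (h, k) ∈ U) ∧ ∃ g, (m⁻¹ * k * n, g) ∈ V

variable [Finite G]

/-- The element `[(x, y)U, (z, w)V]` of the tensor product of `(G × G)/U` and `(G × G)/V`. -/
def tensorMk (U V : Subgroup (G × G)) (p q : G × G) :
    ((Biset.ofSubgroup U).tensor (Biset.ofSubgroup V)).carrier :=
  Quotient.mk _ (Biset.cosetMk U p, Biset.cosetMk V q)

/-- The element `k` is the one of the middle group that carries the first pair of cosets to the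
second. -/
theorem tensorMk_eq_iff {U V : Subgroup (G × G)} {p q p' q' : G × G} :
    tensorMk U V p q = tensorMk U V p' q' ↔
      ∃ k, p⁻¹ * (1, k⁻¹) * p' ∈ U ∧ q⁻¹ * (k⁻¹, 1) * q' ∈ V := by
  refine (Quotient.eq (r := Biset.tensorSetoid _ _)).trans ?_
  refine exists_congr fun k => ?_
  refine Prod.ext_iff.trans ?_
  change Biset.cosetMk U p' = MulOpposite.op k⁻¹ • Biset.cosetMk U p ∧
    Biset.cosetMk V q' = k • Biset.cosetMk V q ↔ _
  rw [Biset.op_smul_eq_act, Biset.smul_eq_act, Biset.act_cosetMk, Biset.act_cosetMk,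
    eq_comm (a := Biset.cosetMk U p'), eq_comm (a := Biset.cosetMk V q'),
    Biset.cosetMk_eq_iff, Biset.cosetMk_eq_iff]
  simp [mul_assoc]

theorem act_tensorMk (U V : Subgroup (G × G)) (r p q : G × G) :
    ((Biset.ofSubgroup U).tensor (Biset.ofSubgroup V)).act r (tensorMk U V p q) =
      tensorMk U V ((r.1, 1) * p) ((1, r.2) * q) := by
  have h1 : r.1 • Biset.cosetMk U p = Biset.cosetMk U ((r.1, 1) * p) := by
    rw [Biset.smul_eq_act, Biset.act_cosetMk]
  have h2 : MulOpposite.op r.2⁻¹ • Biset.cosetMk V q = Biset.cosetMk V ((1, r.2) * q) := by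
    rw [Biset.op_smul_eq_act, Biset.act_cosetMk]
    simp
  rw [tensorMk, tensorMk, ← h1, ← h2]
  rfl

/-- The pair `(h, g)` moves the point to `[(h, 1)U, (m, g)V]`. This is the old point iff some `k`
satisfies `(h, k⁻¹) ∈ U` and `(m⁻¹ k⁻¹ m, g) ∈ V`; replacing `k` by `k⁻¹` gives the composition of
`U` with the twist of `V`. -/
theorem stab_tensorMk (U V : Subgroup (G × G)) (m : G) :
    ((Biset.ofSubgroup U).tensor (Biset.ofSubgroup V)).stab (tensorMk U V 1 (m, 1)) =
      starConj U V m := by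
  ext p
  rw [Biset.mem_stab, act_tensorMk, eq_comm, tensorMk_eq_iff, mem_starConj,
    (Equiv.inv G).exists_congr_left]
  simp [mul_assoc]

theorem orb_tensorMk {U V : Subgroup (G × G)} {m n : G} :
    ((Biset.ofSubgroup U).tensor (Biset.ofSubgroup V)).orb (tensorMk U V 1 (m, 1)) =
      ((Biset.ofSubgroup U).tensor (Biset.ofSubgroup V)).orb (tensorMk U V 1 (n, 1)) ↔
      DoubleCosetRel U V m n := by
  rw [eq_comm, Biset.orb_eq_orb]
  simp only [act_tensorMk]
  simp only [eq_comm (b := tensorMk U V 1 (m, 1)), tensorMk_eq_iff]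
  constructor
  · rintro ⟨p, k, h1, h2⟩
    exact ⟨k⁻¹, ⟨p.1, by simpa using h1⟩, ⟨p.2, by simpa [mul_assoc] using h2⟩⟩
  · rintro ⟨k, ⟨h, hh⟩, ⟨g, hg⟩⟩
    exact ⟨(h, g), k⁻¹, by simpa using hh, by simpa [mul_assoc] using hg⟩

/-- In `[(x, y)U, (z, w)V]` the outer entries `x` and `w` are absorbed by the action of `G × G`, and
`y` passes through the tensor product to the second factor. What is left is `m = y⁻¹ z`. -/
theorem exists_orb_tensorMk (U V : Subgroup (G × G))
    (t : ((Biset.ofSubgroup U).tensor (Biset.ofSubgroup V)).carrier) :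
    ∃ m : G, ((Biset.ofSubgroup U).tensor (Biset.ofSubgroup V)).orb (tensorMk U V 1 (m, 1)) =
      ((Biset.ofSubgroup U).tensor (Biset.ofSubgroup V)).orb t := by
  obtain ⟨⟨y, z⟩, rfl⟩ := Quotient.exists_rep t
  obtain ⟨p, rfl⟩ := Biset.cosetMk_surjective U y
  obtain ⟨q, rfl⟩ := Biset.cosetMk_surjective V z
  refine ⟨p.2⁻¹ * q.1, Biset.orb_eq_orb.2 ⟨(p.1, q.2), ?_⟩⟩
  refine (act_tensorMk U V _ _ _).trans (tensorMk_eq_iff.2 ⟨p.2, ?_, ?_⟩)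
  · convert U.one_mem using 1
    ext <;> simp
  · convert V.one_mem using 1
    ext <;> simp

/-- The Mackey formula, for a set `s` of representatives of the double cosets of `p₂(U)` and
`p₁(V)`. -/
theorem cls_ofSubgroup_mul (R : Type) [CommRing R] {ι : Type*} (U V : Subgroup (G × G))
    (s : Finset ι) (x : ι → G)
    (hinj : ∀ i ∈ s, ∀ j ∈ s, DoubleCosetRel U V (x i) (x j) → i = j)
    (hsurj : ∀ m, ∃ i ∈ s, DoubleCosetRel U V (x i) m) :
    cls R (Biset.ofSubgroup U) * cls R (Biset.ofSubgroup V) =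
      ∑ i ∈ s, cls R (Biset.ofSubgroup (starConj U V (x i))) := by
  rw [cls_mul, cls_eq_sum R _ s fun i => tensorMk U V 1 (x i, 1)]
  · simp only [stab_tensorMk]
  · intro i hi j hj h
    exact hinj i hi j hj (orb_tensorMk.1 h)
  · intro t
    obtain ⟨m, hm⟩ := exists_orb_tensorMk U V t
    obtain ⟨i, hi, him⟩ := hsurj m
    exact ⟨i, hi, (orb_tensorMk.2 him).trans hm⟩

end Mackey

/-! ## Linear maps on the double Burnside algebra -/

section Lift

variable (R : Type) [CommRing R] {G : Type} [Group G] [Finite G]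

/-- The linear map `[M] ↦ ∑ m ∈ M, w (stab m)`. -/
theorem exists_linearMap_stab {E : Type*} [AddCommGroup E] [Module R E]
    (w : Subgroup (G × G) → E) :
    ∃ f : Burnside R G →ₗ[R] E, ∀ M : Biset G, f (cls R M) = ∑ᶠ m : M.carrier, w (M.stab m) := by
  classical
  -- An isomorphism of bisets preserves stabilizers, so the sum depends on the isomorphism class
  -- only.
  have hiso : ∀ M N : Biset G, M.Iso N →
      ∑ᶠ m : M.carrier, w (M.stab m) = ∑ᶠ m : N.carrier, w (N.stab m) := by
    rintro M N ⟨e, h1, h2⟩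
    refine finsum_eq_of_bijective e e.bijective fun m => congrArg w ?_
    ext p
    rw [Biset.mem_stab, Biset.mem_stab, ← e.injective.eq_iff (a := M.act p m)]
    rw [Biset.act, h1, h2]
    rfl
  let f0 : IsoClass G → E := Quotient.lift (fun M : Biset G => ∑ᶠ m : M.carrier, w (M.stab m)) hiso
  let f1 : MonoidAlgebra R (IsoClass G) →ₗ[R] E :=
    (Finsupp.linearCombination R f0).comp (MonoidAlgebra.coeffLinearEquiv R).toLinearMap
  have hf1 : ∀ M : Biset G, f1 (freeClass R M) = ∑ᶠ m : M.carrier, w (M.stab m) := by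
    intro M
    simp [f1, freeClass]
    rfl
  have hker : (relIdeal R G).restrictScalars R ≤ LinearMap.ker f1 := by
    refine Submodule.span_le.2 ?_
    rintro _ ⟨M, N, rfl⟩
    -- The stabilizer of a point of `M ⊔ N` is its stabilizer in the summand containing it, so the
    -- sum splits and the relators are killed.
    have h : ∑ᶠ m : (M.disjUnion N).carrier, w ((M.disjUnion N).stab m) =
        ∑ᶠ m : M.carrier, w (M.stab m) + ∑ᶠ m : N.carrier, w (N.stab m) := by
      have := Fintype.ofFinite M.carrier
      have := Fintype.ofFinite N.carrier
      refine (finsum_eq_sum_of_fintype (α := M.carrier ⊕ N.carrier) _).trans ?_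
      rw [Fintype.sum_sum_type, finsum_eq_sum_of_fintype, finsum_eq_sum_of_fintype]
      congr 1
      · refine Finset.sum_congr rfl fun m _ => congrArg w ?_
        ext p
        exact Sum.inl_injective.eq_iff
      · refine Finset.sum_congr rfl fun m _ => congrArg w ?_
        ext p
        exact Sum.inr_injective.eq_iff
    change f1 _ = 0
    rw [map_sub, map_sub, hf1, hf1, hf1, h, sub_sub, sub_self]
  -- The quotient is formed by an ideal of the monoid algebra, whereas `f1` is only `R`-linear;
  -- scalars are restricted to `R` before descending.
  refine ⟨(Submodule.liftQ _ f1 hker).comp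
    (Submodule.Quotient.restrictScalarsEquiv R (relIdeal R G)).symm.toLinearMap, fun M => ?_⟩
  exact hf1 M

/-- There are `U.index` points, and their stabilizers are conjugate to `U`, so a conjugation
invariant `w` contributes the same value at each. -/
theorem finsum_stab_ofSubgroup {E : Type*} [AddCommGroup E] (w : Subgroup (G × G) → E)
    (hw : ∀ (U : Subgroup (G × G)) c, w (U.map (MulAut.conj c).toMonoidHom) = w U)
    (U : Subgroup (G × G)) :
    ∑ᶠ m : (Biset.ofSubgroup U).carrier, w ((Biset.ofSubgroup U).stab m) = U.index • w U := by
  have : Fintype (Biset.ofSubgroup U).carrier := Fintype.ofFinite _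
  rw [finsum_eq_sum_of_fintype, Finset.sum_congr rfl fun m _ => ?_, Finset.sum_const]
  · rw [Finset.card_univ, ← Nat.card_eq_fintype_card]
    rfl
  · obtain ⟨c, rfl⟩ := Biset.cosetMk_surjective U m
    rw [Biset.stab_cosetMk, hw]

end Lift

/-! ## Subgroups of `S₃ × S₃` as bit masks

The elements of `S₃` are numbered from `0` to `5`, those of `S₃ × S₃` from `0` to `35`, and a
subgroup is encoded by the number whose binary digits are its characteristic function. -/

/-- The multiplication of `S₃` on the numbers `r + 3 f` of the elements `b ^ r * a ^ f`. -/
def mul6 (i j : ℕ) : ℕ := (i % 3 + (1 + i / 3) * (j % 3)) % 3 + 3 * ((i / 3 + j / 3) % 2)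

/-- The inversion of `S₃` on the numbers of the elements. -/
def inv6 (i : ℕ) : ℕ := bif Nat.blt i 3 then (3 - i) % 3 else i

/-- The element of `S₃` with number `i`. -/
def el (i : ℕ) : S3 := b ^ (i % 3) * a ^ (i / 3)

def mul36 (p q : ℕ) : ℕ := 6 * mul6 (p / 6) (q / 6) + mul6 (p % 6) (q % 6)

def inv36 (p : ℕ) : ℕ := 6 * inv6 (p / 6) + inv6 (p % 6)

/-- The element of `S₃ × S₃` with number `p`. -/
def elPair (p : ℕ) : S3 × S3 := (el (p / 6), el (p % 6))

theorem mul6_lt (i j : ℕ) : mul6 i j < 6 := by unfold mul6; omega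

theorem inv6_lt {i : ℕ} (hi : i < 6) : inv6 i < 6 := by
  unfold inv6
  cases h : Nat.blt i 3 <;> simp <;> omega

/-- Since `a b a⁻¹ = b⁻¹`, moving `a ^ f` past `b ^ s` multiplies `s` by `(-1) ^ f`; modulo 3 and
for `f ≤ 1` this sign is the factor `1 + f` in `mul6`. -/
theorem el_mul {i j : ℕ} (hi : i < 6) (hj : j < 6) : el (mul6 i j) = el i * el j := by
  have : ∀ i < 6, ∀ j < 6, el (mul6 i j) = el i * el j := by decide +kernel
  exact this i hi j hj

theorem el_inv {i : ℕ} (hi : i < 6) : el (inv6 i) = (el i)⁻¹ := by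
  have : ∀ i < 6, el (inv6 i) = (el i)⁻¹ := by decide +kernel
  exact this i hi

theorem el_injective {i j : ℕ} (hi : i < 6) (hj : j < 6) (h : el i = el j) : i = j := by
  have : ∀ i < 6, ∀ j < 6, el i = el j → i = j := by decide +kernel
  exact this i hi j hj h

theorem exists_el (x : S3) : ∃ i < 6, el i = x := by
  have : ∀ x : S3, ∃ i < 6, el i = x := by decide +kernel
  exact this x

theorem el_zero : el 0 = 1 := by simp [el]

theorem mul36_lt (p q : ℕ) : mul36 p q < 36 := by
  have := mul6_lt (p / 6) (q / 6)
  have := mul6_lt (p % 6) (q % 6)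
  unfold mul36
  omega

theorem inv36_lt {p : ℕ} (hp : p < 36) : inv36 p < 36 := by
  have := inv6_lt (i := p / 6) (by omega)
  have := inv6_lt (i := p % 6) (by omega)
  unfold inv36
  omega

theorem elPair_six_mul_add {i j : ℕ} (hj : j < 6) : elPair (6 * i + j) = (el i, el j) := by
  rw [elPair, show (6 * i + j) / 6 = i by omega, show (6 * i + j) % 6 = j by omega]

theorem elPair_mul {p q : ℕ} (hp : p < 36) (hq : q < 36) :
    elPair (mul36 p q) = elPair p * elPair q := by
  rw [mul36, elPair_six_mul_add (mul6_lt _ _), el_mul (by omega) (by omega),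
    el_mul (by omega) (by omega)]
  rfl

theorem elPair_inv {p : ℕ} (hp : p < 36) : elPair (inv36 p) = (elPair p)⁻¹ := by
  rw [inv36, elPair_six_mul_add (inv6_lt (by omega)), el_inv (by omega), el_inv (by omega)]
  rfl

theorem elPair_injective {p q : ℕ} (hp : p < 36) (hq : q < 36) (h : elPair p = elPair q) :
    p = q := by
  have h1 := el_injective (by omega) (by omega) (Prod.ext_iff.1 h).1
  have h2 := el_injective (by omega) (by omega) (Prod.ext_iff.1 h).2
  omega

theorem exists_elPair (x : S3 × S3) : ∃ p < 36, elPair p = x := by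
  obtain ⟨i, hi, h1⟩ := exists_el x.1
  obtain ⟨j, hj, h2⟩ := exists_el x.2
  exact ⟨6 * i + j, by omega, by rw [elPair_six_mul_add hj, h1, h2]⟩

theorem elPair_zero : elPair 0 = 1 := by simp [elPair, el_zero]

/-- The number `n` encodes the subgroup `U`. -/
def HasMask (U : Subgroup (S3 × S3)) (n : ℕ) : Prop :=
  ∀ p < 36, elPair p ∈ U ↔ n.testBit p = true

theorem HasMask.ext {U V : Subgroup (S3 × S3)} {n : ℕ} (hU : HasMask U n) (hV : HasMask V n) :
    U = V := by
  ext x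
  obtain ⟨p, hp, rfl⟩ := exists_elPair x
  rw [hU p hp, hV p hp]

/-- `HasMask` says nothing about the digits from position 36 on; the two bounds make them vanish. -/
theorem HasMask.unique {U : Subgroup (S3 × S3)} {m n : ℕ} (hm : HasMask U m) (hn : HasMask U n)
    (hm' : m < 2 ^ 36) (hn' : n < 2 ^ 36) : m = n := by
  refine Nat.eq_of_testBit_eq fun p => ?_
  rcases lt_or_ge p 36 with hp | hp
  · rw [Bool.eq_iff_iff, ← hm p hp, ← hn p hp]
  · rw [Nat.testBit_lt_two_pow (hm'.trans_le (Nat.pow_le_pow_right two_pos hp)),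
      Nat.testBit_lt_two_pow (hn'.trans_le (Nat.pow_le_pow_right two_pos hp))]

/-- The number whose binary digits are the values of `f` below `n`. -/
def bitsOf (f : ℕ → Bool) : ℕ → ℕ
  | 0 => 0
  | n + 1 => bitsOf f n ||| bif f n then 1 <<< n else 0

theorem testBit_bitsOf (f : ℕ → Bool) (n p : ℕ) :
    (bitsOf f n).testBit p = (decide (p < n) && f p) := by
  induction n with
  | zero => simp [bitsOf]
  | succ n ih =>
    rw [bitsOf, Nat.testBit_or, ih]
    cases hf : f n
    · rcases lt_trichotomy p n with h | rfl | h
      · simp [h, h.trans (Nat.lt_succ_self n)]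
      · simp [hf]
      · simp [not_lt.2 h.le, not_lt.2 (Nat.succ_le_of_lt h)]
    · rw [cond_true, Nat.one_shiftLeft, Nat.testBit_two_pow]
      rcases lt_trichotomy p n with h | rfl | h
      · simp [h, h.trans (Nat.lt_succ_self n), h.ne']
      · simp [hf]
      · simp [not_lt.2 h.le, not_lt.2 (Nat.succ_le_of_lt h), h.ne]

/-- The mask of the conjugate of a subgroup by the element with number `c`. -/
def conjMask (c n : ℕ) : ℕ := bitsOf (fun p => n.testBit (mul36 (mul36 (inv36 c) p) c)) 36

theorem HasMask.conj {U : Subgroup (S3 × S3)} {n : ℕ} (hU : HasMask U n) {c : ℕ} (hc : c < 36) :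
    HasMask (U.map (MulAut.conj (elPair c)).toMonoidHom) (conjMask c n) := by
  intro p hp
  have hU' := hU _ (mul36_lt (mul36 (inv36 c) p) c)
  rw [elPair_mul (mul36_lt _ _) hc, elPair_mul (inv36_lt hc) hp, elPair_inv hc] at hU'
  rw [conjMask, testBit_bitsOf, decide_eq_true hp, Bool.true_and, ← hU', Subgroup.mem_map]
  constructor
  · rintro ⟨u, hu, h⟩
    rw [← h]
    simpa [mul_assoc] using hu
  · intro h
    exact ⟨_, h, by simp [mul_assoc]⟩

/-- The union of the masks `f p`, where `p` runs through the elements of the mask `n`. -/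
def bindMask (f : ℕ → ℕ) (n : ℕ) : ℕ → ℕ
  | 0 => 0
  | k + 1 => bindMask f n k ||| bif n.testBit k then f k else 0

theorem testBit_bindMask (f : ℕ → ℕ) (n k p : ℕ) :
    (bindMask f n k).testBit p = true ↔ ∃ q < k, n.testBit q = true ∧ (f q).testBit p = true := by
  induction k with
  | zero => simp [bindMask]
  | succ k ih =>
    rw [bindMask, Nat.testBit_or, Bool.or_eq_true, ih]
    simp only [Nat.lt_succ_iff_lt_or_eq, or_and_right, exists_or, exists_eq_left]
    cases h : n.testBit k <;> simp

/-- The mask of `{(h, g) : (h, k) ∈ U and (m⁻¹ k m, g) ∈ V for some k}`. -/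
def starMask (n n' m : ℕ) : ℕ :=
  bindMask (fun p => ((n' >>> (6 * mul6 (mul6 (inv6 m) (p % 6)) m)) % 64) <<< (6 * (p / 6))) n 36

theorem HasMask.starConj {U V : Subgroup (S3 × S3)} {n n' m : ℕ} (hU : HasMask U n)
    (hV : HasMask V n') (hm : m < 6) :
    HasMask (starConj U V (el m)) (starMask n n' m) := by
  intro p hp
  -- A mask consists of six blocks of six digits, block `r` listing the `g` with `(el r, g)` in the
  -- subgroup. The expression cuts block `r` out of `n'` and moves it to block `q / 6`.
  have hbit : ∀ q r, (((n' >>> (6 * r)) % 64) <<< (6 * (q / 6))).testBit p = true ↔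
      q / 6 = p / 6 ∧ n'.testBit (6 * r + p % 6) = true := by
    intro q r
    rw [show 64 = 2 ^ 6 from rfl, Nat.testBit_shiftLeft, Nat.testBit_mod_two_pow,
      Nat.testBit_shiftRight]
    simp only [Bool.and_eq_true, decide_eq_true_eq]
    constructor
    · rintro ⟨h1, h2, h3⟩
      have h4 : p - 6 * (q / 6) = p % 6 := by omega
      exact ⟨by omega, h4 ▸ h3⟩
    · rintro ⟨h1, h2⟩
      have h4 : p - 6 * (q / 6) = p % 6 := by omega
      exact ⟨by omega, by omega, h4 ▸ h2⟩
  rw [starMask, testBit_bindMask, mem_starConj]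
  simp only [hbit]
  constructor
  · rintro ⟨x, h1, h2⟩
    obtain ⟨k, hk, rfl⟩ := exists_el x
    refine ⟨6 * (p / 6) + k, by omega, ?_, by omega, ?_⟩
    · rw [← hU _ (by omega), elPair_six_mul_add hk]
      exact h1
    · rw [show (6 * (p / 6) + k) % 6 = k by omega]
      have := mul6_lt (mul6 (inv6 m) k) m
      rw [← hV _ (by omega), elPair_six_mul_add (by omega), el_mul (mul6_lt _ _) hm,
        el_mul (inv6_lt hm) hk, el_inv hm]
      exact h2
  · rintro ⟨q, hq, h1, h2, h3⟩
    refine ⟨el (q % 6), ?_, ?_⟩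
    · rw [elPair, ← h2]
      exact (hU q hq).2 h1
    · have := mul6_lt (mul6 (inv6 m) (q % 6)) m
      rw [← hV _ (by omega), elPair_six_mul_add (by omega), el_mul (mul6_lt _ _) hm,
        el_mul (inv6_lt hm) (by omega), el_inv hm] at h3
      exact h3

/-- The mask of the subgroup generated by `gs`, by depth first search. -/
def reach (gs : List ℕ) : ℕ → List ℕ → ℕ → ℕ
  | 0, _, n => n
  | _ + 1, [], n => n
  | f + 1, p :: st, n =>
    bif n.testBit p then reach gs f st n
    else reach gs f (gs.map (mul36 p) ++ st) (n ||| 1 <<< p)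

/-- Only elements that are products of generators are ever marked. This soundness is all that is
used about the search; no claim is needed that the fuel suffices or that the result is closed, since
the opposite inclusions are checked on the resulting numbers. -/
theorem reach_subset {U : Subgroup (S3 × S3)} {gs : List ℕ}
    (hgs : ∀ s ∈ gs, s < 36 ∧ elPair s ∈ U) (f : ℕ) (st : List ℕ) (n : ℕ)
    (hst : ∀ s ∈ st, s < 36 ∧ elPair s ∈ U)
    (hn : ∀ p < 36, n.testBit p = true → elPair p ∈ U) :
    ∀ p < 36, (reach gs f st n).testBit p = true → elPair p ∈ U := by
  induction f generalizing st n with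
  | zero => exact hn
  | succ f ih =>
    cases st with
    | nil => exact hn
    | cons q st =>
      rw [reach]
      have hq := hst q List.mem_cons_self
      have hst' : ∀ s ∈ st, s < 36 ∧ elPair s ∈ U := fun s hs => hst s (List.mem_cons_of_mem _ hs)
      cases n.testBit q
      · refine ih _ _ ?_ ?_
        · intro s hs
          rcases List.mem_append.1 hs with hs | hs
          · obtain ⟨t, ht, rfl⟩ := List.mem_map.1 hs
            exact ⟨mul36_lt _ _, by
              rw [elPair_mul hq.1 (hgs t ht).1]; exact U.mul_mem hq.2 (hgs t ht).2⟩
          · exact hst' s hs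
        · intro p hp h
          rw [Nat.testBit_or, Bool.or_eq_true] at h
          rcases h with h | h
          · exact hn p hp h
          · rw [Nat.one_shiftLeft, Nat.testBit_two_pow, decide_eq_true_iff] at h
            exact h ▸ hq.2
      · exact ih _ _ hst' hn

/-! ## The conjugacy classes of subgroups of `S₃ × S₃` -/

/-- Representatives of the conjugacy classes of subgroups of `S₃ × S₃`. -/
def rep : Fin 22 → Subgroup (S3 × S3) :=
  ![V0.prod V0, V0.prod V1, V0.prod V4, V0.prod V5, V1.prod V0, V1.prod V1, V1.prod V4,
    V1.prod V5, V4.prod V0, V4.prod V1, V4.prod V4, V4.prod V5, V5.prod V0, V5.prod V1,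
    V5.prod V4, V5.prod V5, diag V1, diag V4, diag V5, U6, U7, U8]

/-- The masks of the subgroups `rep i`. -/
def maskList : List ℕ := [
  1, 9, 7, 63, 262145, 2359305, 1835015, 16515135, 4161, 37449, 29127, 262143, 1090785345,
  9817068105, 7635497415, 68719476735, 2097153, 16513, 34630287489, 14680071, 8726253633,
  61083775431]

/-- The numbers of generators of the subgroups `rep i`. -/
def genList : List (List ℕ) := [
  [], [3], [1], [1, 3], [18], [18, 3], [18, 1], [18, 1, 3], [6], [6, 3], [6, 1], [6, 1, 3],
  [6, 18], [6, 18, 3], [6, 18, 1], [6, 18, 1, 3], [21], [7], [7, 21], [21, 1], [21, 6],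
  [21, 6, 1]]

/-- The masks of all subgroups, each with the index `i` of its conjugacy class and the number of an
element that conjugates `rep i` to it. -/
def conjTable : List (ℕ × ℕ × ℕ) := [
  (1, 0, 0), (9, 1, 0), (33, 1, 1), (17, 1, 2), (7, 2, 0), (63, 3, 0), (262145, 4, 0),
  (1073741825, 4, 6), (16777217, 4, 12), (2359305, 5, 0), (8650785, 5, 1), (4456465, 5, 2),
  (9663676425, 5, 6), (35433480225, 5, 7), (18253611025, 5, 8), (150994953, 5, 12),
  (553648161, 5, 13), (285212689, 5, 14), (1835015, 6, 0), (7516192775, 6, 6),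
  (117440519, 6, 12), (16515135, 7, 0), (67645734975, 7, 6), (1056964671, 7, 12), (4161, 8, 0),
  (37449, 9, 0), (137313, 9, 1), (70737, 9, 2), (29127, 10, 0), (262143, 11, 0),
  (1090785345, 12, 0), (9817068105, 13, 0), (35995916385, 13, 1), (18543350865, 13, 2),
  (7635497415, 14, 0), (68719476735, 15, 0), (2097153, 16, 0), (8388609, 16, 1),
  (4194305, 16, 2), (8589934593, 16, 6), (34359738369, 16, 7), (17179869185, 16, 8),
  (134217729, 16, 12), (536870913, 16, 13), (268435457, 16, 14), (16513, 17, 0), (8449, 17, 3),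
  (34630287489, 18, 0), (17322492033, 18, 1), (9131016321, 18, 2), (17718845697, 18, 3),
  (8866767105, 18, 4), (34498158849, 18, 5), (14680071, 19, 0), (60129542151, 19, 6),
  (939524103, 19, 12), (8726253633, 20, 0), (34905002049, 20, 1), (17452503105, 20, 2),
  (61083775431, 21, 0)]

def maskOf (i : ℕ) : ℕ := maskList.getD i 0

def gensOf (i : ℕ) : List ℕ := genList.getD i []

/-- The entry of a mask in a table, or `(22, 0)` if there is none. -/
def findMask (n : ℕ) : List (ℕ × ℕ × ℕ) → ℕ × ℕ
  | [] => (22, 0)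
  | (k, v) :: l => bif Nat.beq k n then v else findMask n l

theorem mem_of_findMask {n : ℕ} {l : List (ℕ × ℕ × ℕ)} (h : (findMask n l).1 < 22) :
    (n, findMask n l) ∈ l := by
  induction l with
  | nil => simp [findMask] at h
  | cons x l ih =>
    obtain ⟨k, v⟩ := x
    rw [findMask] at h ⊢
    cases hk : Nat.beq k n
    · rw [hk] at h
      exact List.mem_cons_of_mem _ (ih h)
    · rw [Nat.eq_of_beq_eq_true hk]
      exact List.mem_cons_self

/-- Soundness of the table: every entry really is the stated conjugate of the stated representative,
in particular the mask of a subgroup. -/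
theorem conjTable_spec : ∀ x ∈ conjTable,
    x.2.1 < 22 ∧ x.2.2 < 36 ∧ conjMask x.2.2 (maskOf x.2.1) = x.1 := by
  decide +kernel

/-- Completeness of the table on the conjugates of the representatives. Because the lookup returns
`i` for every conjugate of `rep i`, no two representatives are conjugate. -/
theorem findMask_conjMask : ∀ i < 22, ∀ c < 36,
    (findMask (conjMask c (maskOf i)) conjTable).1 = i := by
  decide +kernel

/-- The subgroup generated by `rep i` and the element with number `p` is again in the table. -/
theorem reach_mem_table : ∀ i < 22, ∀ p < 36,
    (fun n => (findMask n conjTable).1 < 22 ∧ n &&& maskOf i = maskOf i ∧ n.testBit p = true)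
      (reach (p :: gensOf i) 250 [0] 0) := by
  -- The fuel 250 is ample: each of at most 36 marked elements pushes at most five successors, so at
  -- most 181 stack entries are processed.
  decide +kernel

/-! ### Masks of the 22 representatives -/

/-- The number `n`, below `2 ^ 6`, encodes the subgroup `V` of `S₃`. -/
def HasMask6 (V : Subgroup S3) (n : ℕ) : Prop := ∀ i < 6, el i ∈ V ↔ n.testBit i = true

theorem hasMask6_V0 : HasMask6 V0 1 := by
  have : ∀ i < 6, el i = 1 ↔ Nat.testBit 1 i = true := by decide +kernel
  exact fun i hi => Subgroup.mem_bot.trans (this i hi)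

theorem mem_closure_iff_of_finset {G : Type*} [Group G] {S : Set G} (F : Finset G)
    (hS : ∀ x ∈ S, x ∈ F) (h1 : 1 ∈ F) (hmul : ∀ x ∈ F, ∀ y ∈ F, x * y ∈ F)
    (hinv : ∀ x ∈ F, x⁻¹ ∈ F) (hF : ∀ x ∈ F, x ∈ Subgroup.closure S) (x : G) :
    x ∈ Subgroup.closure S ↔ x ∈ F :=
  ⟨fun hx => (Subgroup.closure_le (K := ⟨⟨⟨(F : Set G), fun hx hy => hmul _ hx _ hy⟩, h1⟩,
    fun hx => hinv _ hx⟩)).2 hS hx, hF x⟩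

theorem mem_V1 (x : S3) : x ∈ V1 ↔ x ∈ ({1, a} : Finset S3) := by
  refine mem_closure_iff_of_finset _ (by simp) (by simp) (by decide +kernel)
    (by decide +kernel) ?_ x
  have ha : a ∈ Subgroup.closure {a} := Subgroup.subset_closure rfl
  simp [ha]

theorem mem_V4 (x : S3) : x ∈ V4 ↔ x ∈ ({1, b, b * b} : Finset S3) := by
  refine mem_closure_iff_of_finset _ (by simp) (by simp) (by decide +kernel)
    (by decide +kernel) ?_ x
  have hb : b ∈ Subgroup.closure {b} := Subgroup.subset_closure rfl
  simp [hb, mul_mem hb hb]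

theorem hasMask6_V1 : HasMask6 V1 9 := by
  have : ∀ i < 6, el i ∈ ({1, a} : Finset S3) ↔ Nat.testBit 9 i = true := by decide +kernel
  exact fun i hi => (mem_V1 _).trans (this i hi)

theorem hasMask6_V4 : HasMask6 V4 7 := by
  have : ∀ i < 6, el i ∈ ({1, b, b * b} : Finset S3) ↔ Nat.testBit 7 i = true := by
    decide +kernel
  exact fun i hi => (mem_V4 _).trans (this i hi)

theorem hasMask6_V5 : HasMask6 V5 63 := by
  have : ∀ i < 6, Nat.testBit 63 i = true := by decide +kernel
  exact fun i hi => iff_of_true (Subgroup.mem_top _) (this i hi)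

theorem HasMask6.prod {V W : Subgroup S3} {n n' k : ℕ} (hV : HasMask6 V n) (hW : HasMask6 W n')
    (hk : ∀ p < 36, k.testBit p = (n.testBit (p / 6) && n'.testBit (p % 6))) :
    HasMask (V.prod W) k := by
  intro p hp
  rw [hk p hp, Bool.and_eq_true, ← hV _ (by omega), ← hW _ (by omega)]
  exact Subgroup.mem_prod

theorem HasMask6.diag {V : Subgroup S3} {n k : ℕ} (hV : HasMask6 V n)
    (hk : ∀ p < 36, k.testBit p = (Nat.beq (p / 6) (p % 6) && n.testBit (p / 6))) :
    HasMask (diag V) k := by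
  intro p hp
  rw [hk p hp, Bool.and_eq_true, ← hV _ (by omega), Nat.beq_eq]
  constructor
  · rintro ⟨x, hx, h⟩
    obtain ⟨h1, h2⟩ := Prod.ext_iff.1 h
    exact ⟨el_injective (by omega) (by omega) (h1.symm.trans h2), by
      change (elPair p).1 ∈ V
      rw [← h1]
      exact hx⟩
  · rintro ⟨h1, h2⟩
    refine ⟨_, h2, ?_⟩
    rw [elPair, ← h1]
    rfl

/-- Two bounds meet: the set with mask `n` contains the generators and is closed under the group
operations, so it contains the closure; it is also a search result, so by `reach_subset` it lies in
the closure. -/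
theorem hasMask_closure {S : Set (S3 × S3)} {gs : List ℕ} {n : ℕ} (f : ℕ)
    (hS : ∀ x, x ∈ S ↔ ∃ s ∈ gs, elPair s = x) (hgs : ∀ s ∈ gs, s < 36 ∧ n.testBit s = true)
    (hn : reach gs f [0] 0 = n) (h0 : n.testBit 0 = true)
    (hmul : ∀ p < 36, ∀ q < 36, n.testBit p = true → n.testBit q = true →
      n.testBit (mul36 p q) = true)
    (hinv : ∀ p < 36, n.testBit p = true → n.testBit (inv36 p) = true) :
    HasMask (Subgroup.closure S) n := by
  classical
  intro p hp
  rw [mem_closure_iff_of_finset (((Finset.range 36).filter fun p => n.testBit p = true).image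
    elPair)]
  · simp only [Finset.mem_image, Finset.mem_filter, Finset.mem_range]
    exact ⟨fun ⟨q, hq, h⟩ => elPair_injective hq.1 hp h ▸ hq.2, fun h => ⟨p, ⟨hp, h⟩, rfl⟩⟩
  all_goals simp only [Finset.mem_image, Finset.mem_filter, Finset.mem_range]
  · intro x hx
    obtain ⟨s, hs, rfl⟩ := (hS x).1 hx
    exact ⟨s, hgs s hs, rfl⟩
  · exact ⟨0, ⟨by omega, h0⟩, elPair_zero⟩
  · rintro _ ⟨p, hp, rfl⟩ _ ⟨q, hq, rfl⟩
    exact ⟨_, ⟨mul36_lt p q, hmul p hp.1 q hq.1 hp.2 hq.2⟩, elPair_mul hp.1 hq.1⟩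
  · rintro _ ⟨p, hp, rfl⟩
    exact ⟨_, ⟨inv36_lt hp.1, hinv p hp.1 hp.2⟩, elPair_inv hp.1⟩
  · rintro _ ⟨p, hp, rfl⟩
    refine reach_subset (gs := gs) (fun s hs => ⟨(hgs s hs).1, Subgroup.subset_closure
      ((hS _).2 ⟨s, hs, rfl⟩)⟩) f [0] 0 ?_ (by simp) p hp.1 (hn ▸ hp.2)
    intro s hs
    rw [List.mem_singleton.1 hs, elPair_zero]
    exact ⟨by omega, one_mem _⟩

theorem elPair_generators : elPair 21 = (a, a) ∧ elPair 1 = (1, b) ∧ elPair 6 = (b, 1) := by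
  decide +kernel

theorem hasMask_rep (i : Fin 22) : HasMask (rep i) (maskOf i) := by
  obtain ⟨e1, e2, e3⟩ := elPair_generators
  fin_cases i
  · exact hasMask6_V0.prod hasMask6_V0 (by decide +kernel)
  · exact hasMask6_V0.prod hasMask6_V1 (by decide +kernel)
  · exact hasMask6_V0.prod hasMask6_V4 (by decide +kernel)
  · exact hasMask6_V0.prod hasMask6_V5 (by decide +kernel)
  · exact hasMask6_V1.prod hasMask6_V0 (by decide +kernel)
  · exact hasMask6_V1.prod hasMask6_V1 (by decide +kernel)
  · exact hasMask6_V1.prod hasMask6_V4 (by decide +kernel)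
  · exact hasMask6_V1.prod hasMask6_V5 (by decide +kernel)
  · exact hasMask6_V4.prod hasMask6_V0 (by decide +kernel)
  · exact hasMask6_V4.prod hasMask6_V1 (by decide +kernel)
  · exact hasMask6_V4.prod hasMask6_V4 (by decide +kernel)
  · exact hasMask6_V4.prod hasMask6_V5 (by decide +kernel)
  · exact hasMask6_V5.prod hasMask6_V0 (by decide +kernel)
  · exact hasMask6_V5.prod hasMask6_V1 (by decide +kernel)
  · exact hasMask6_V5.prod hasMask6_V4 (by decide +kernel)
  · exact hasMask6_V5.prod hasMask6_V5 (by decide +kernel)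
  · exact hasMask6_V1.diag (by decide +kernel)
  · exact hasMask6_V4.diag (by decide +kernel)
  · exact hasMask6_V5.diag (by decide +kernel)
  · refine hasMask_closure (gs := [21, 1]) 100 (fun x => ?_) (by decide +kernel)
      (by decide +kernel) (by decide +kernel) (by decide +kernel) (by decide +kernel)
    simp [e1, e2, eq_comm]
  · refine hasMask_closure (gs := [21, 6]) 100 (fun x => ?_) (by decide +kernel)
      (by decide +kernel) (by decide +kernel) (by decide +kernel) (by decide +kernel)
    simp [e1, e3, eq_comm]
  · refine hasMask_closure (gs := [21, 6, 1]) 100 (fun x => ?_) (by decide +kernel)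
      (by decide +kernel) (by decide +kernel) (by decide +kernel) (by decide +kernel)
    simp [e1, e2, e3, eq_comm]

/-! ### Classification of the subgroups up to conjugacy -/

/-- The subgroup `U` is conjugate to `rep i`. -/
def IsConjRep (U : Subgroup (S3 × S3)) (i : Fin 22) : Prop :=
  ∃ c, U = (rep i).map (MulAut.conj c).toMonoidHom

theorem map_conj_map_conj {G : Type*} [Group G] (U : Subgroup G) (c d : G) :
    (U.map (MulAut.conj c).toMonoidHom).map (MulAut.conj d).toMonoidHom =
      U.map (MulAut.conj (d * c)).toMonoidHom := by
  rw [Subgroup.map_map]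
  congr 1
  ext x
  simp [mul_assoc]

theorem IsConjRep.map {U : Subgroup (S3 × S3)} {i : Fin 22} (h : IsConjRep U i) (d : S3 × S3) :
    IsConjRep (U.map (MulAut.conj d).toMonoidHom) i := by
  obtain ⟨c, rfl⟩ := h
  exact ⟨d * c, map_conj_map_conj _ c d⟩

theorem isConjRep_rep (i : Fin 22) : IsConjRep (rep i) i :=
  ⟨1, by
    ext x
    simp⟩

/-- A subgroup whose mask is in the table is conjugate to the representative given there. -/
theorem HasMask.isConjRep {U : Subgroup (S3 × S3)} {n : ℕ} (hU : HasMask U n)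
    (hn : (findMask n conjTable).1 < 22) : IsConjRep U ⟨(findMask n conjTable).1, hn⟩ := by
  obtain ⟨_, h2, h3⟩ := conjTable_spec _ (mem_of_findMask hn)
  refine ⟨elPair (findMask n conjTable).2, hU.ext ?_⟩
  have := (hasMask_rep ⟨(findMask n conjTable).1, hn⟩).conj h2
  rwa [h3] at this

theorem bitsOf_lt (f : ℕ → Bool) (n : ℕ) : bitsOf f n < 2 ^ n :=
  Nat.lt_pow_two_of_testBit _ fun i hi => by
    rw [testBit_bitsOf, decide_eq_false (not_lt.2 hi), Bool.false_and]

/-- The subgroup determines its mask below `2 ^ 36`, and the table lookup recovers the index of the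
representative from this mask. -/
theorem IsConjRep.unique {U : Subgroup (S3 × S3)} {i j : Fin 22} (hi : IsConjRep U i)
    (hj : IsConjRep U j) : i = j := by
  obtain ⟨c, rfl⟩ := hi
  obtain ⟨d, hd⟩ := hj
  obtain ⟨p, hp, rfl⟩ := exists_elPair c
  obtain ⟨q, hq, rfl⟩ := exists_elPair d
  have h1 := (hasMask_rep i).conj hp
  have h2 := (hasMask_rep j).conj hq
  rw [← hd] at h2
  have h := h1.unique h2 (bitsOf_lt _ _) (bitsOf_lt _ _)
  rw [Fin.ext_iff, ← findMask_conjMask i i.2 p hp, h, findMask_conjMask j j.2 q hq]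

theorem gensOf_spec : ∀ i < 22, ∀ s ∈ gensOf i, s < 36 ∧ (maskOf i).testBit s = true := by
  decide +kernel

/-- The search result `n` is an entry of the table, hence the mask of an actual subgroup. That
subgroup contains `x` and `rep i` by comparison of digits, and it lies in their join by
`reach_subset`. Adjoining a generator thus never leaves the list of classes. -/
theorem exists_isConjRep_closure_sup_rep (x : S3 × S3) (i : Fin 22) :
    ∃ j, IsConjRep (Subgroup.closure {x} ⊔ rep i) j := by
  obtain ⟨p, hp, rfl⟩ := exists_elPair x
  have hx : elPair p ∈ Subgroup.closure {elPair p} := Subgroup.subset_closure rfl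
  obtain ⟨h1, h2, h3⟩ := reach_mem_table i i.2 p hp
  set n := reach (p :: gensOf i) 250 [0] 0 with hn
  obtain ⟨_, h4, h5⟩ := conjTable_spec _ (mem_of_findMask h1)
  have hW := (hasMask_rep ⟨_, h1⟩).conj h4
  simp only [h5] at hW
  refine ⟨⟨(findMask n conjTable).1, h1⟩, elPair (findMask n conjTable).2, le_antisymm ?_ ?_⟩
  · rw [sup_le_iff, Subgroup.closure_le, Set.singleton_subset_iff]
    refine ⟨(hW p hp).2 h3, fun y hy => ?_⟩
    obtain ⟨q, hq, rfl⟩ := exists_elPair y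
    rw [hW q hq]
    have := congrArg (fun k => Nat.testBit k q) h2
    simp only [Nat.testBit_and, (hasMask_rep i q hq).1 hy, Bool.and_true] at this
    exact this
  · intro y hy
    obtain ⟨q, hq, rfl⟩ := exists_elPair y
    refine reach_subset (gs := p :: gensOf i) ?_ 250 [0] 0 ?_ (by simp) q hq ((hW q hq).1 hy)
    · intro s hs
      rcases List.mem_cons.1 hs with rfl | hs
      · exact ⟨hp, Subgroup.mem_sup_left hx⟩
      · obtain ⟨h6, h7⟩ := gensOf_spec i i.2 s hs
        exact ⟨h6, Subgroup.mem_sup_right ((hasMask_rep i s h6).2 h7)⟩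
    · intro s hs
      rw [List.mem_singleton.1 hs, elPair_zero]
      exact ⟨by omega, one_mem _⟩

/-- Every subgroup of `S₃ × S₃` is conjugate to one of the `22` representatives. -/
theorem exists_isConjRep (U : Subgroup (S3 × S3)) : ∃ i, IsConjRep U i := by
  have key : ∀ s : Set (S3 × S3), s.Finite → ∃ i, IsConjRep (Subgroup.closure s) i := by
    intro s hs
    induction s, hs using Set.Finite.induction_on with
    | empty =>
      refine ⟨0, 1, ?_⟩
      rw [Subgroup.closure_empty, show rep 0 = ⊥ from Subgroup.bot_prod_bot, Subgroup.map_bot]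
    | insert _ _ ih =>
      rename_i x s _ _
      obtain ⟨i, c, hc⟩ := ih
      -- The subgroup so far is the conjugate of `rep i` by `c`. Conjugating back by `c⁻¹` turns the
      -- new generator `x` into `c⁻¹ x c` and reduces to adjoining an element to `rep i` itself.
      obtain ⟨j, hj⟩ := exists_isConjRep_closure_sup_rep (c⁻¹ * x * c) i
      refine ⟨j, ?_⟩
      have := hj.map c
      rw [Subgroup.map_sup, ← hc, MonoidHom.map_closure, Set.image_singleton,
        ← Subgroup.closure_union] at this
      rw [Set.insert_eq]
      convert this using 4
      simp [mul_assoc]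
  have := key U (Set.toFinite _)
  rwa [Subgroup.closure_eq] at this

/-- The index of the conjugacy class of a subgroup. -/
def conjIndex (U : Subgroup (S3 × S3)) : Fin 22 := (exists_isConjRep U).choose

theorem IsConjRep.conjIndex_eq {U : Subgroup (S3 × S3)} {i : Fin 22} (h : IsConjRep U i) :
    conjIndex U = i :=
  (exists_isConjRep U).choose_spec.unique h

theorem conjIndex_map_conj (U : Subgroup (S3 × S3)) (c : S3 × S3) :
    conjIndex (U.map (MulAut.conj c).toMonoidHom) = conjIndex U :=
  ((exists_isConjRep U).choose_spec.map c).conjIndex_eq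

theorem cls_ofSubgroup_eq (R : Type) [CommRing R] {U : Subgroup (S3 × S3)} {i : Fin 22}
    (h : IsConjRep U i) : cls R (Biset.ofSubgroup U) = cls R (Biset.ofSubgroup (rep i)) := by
  obtain ⟨c, rfl⟩ := h
  exact (cls_congr R (Biset.ofSubgroup_conj_iso (rep i) c)).symm

/-! ## Coordinates of `A` -/

/-- The elements of `A` in terms of their coordinates. -/
def coordMap : (Fin 22 → ℚ) →ₗ[ℚ] A where
  toFun c :=
    { s := !![c 0, c 1, c 2; c 3, c 4, c 5; c 6, c 7, c 8]
      t := !![c 9; c 10; c 11]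
      u := c 12
      v := c 13
      w := c 14
      x := !![c 15, c 16, c 17]
      y := c 18
      z := c 19 • 1 + c 20 • eta + c 21 • xi }
  map_add' c d := by
    ext1
    case z => simp only [Pi.add_apply, A.add_z]; module
    all_goals simp
  map_smul' r c := by
    ext1
    case z => simp only [Pi.smul_apply, smul_eq_mul, RingHom.id_apply, A.smul_z]; module
    all_goals simp

theorem coordMap_apply (c : Fin 22 → ℚ) : coordMap c =
    ⟨!![c 0, c 1, c 2; c 3, c 4, c 5; c 6, c 7, c 8], !![c 9; c 10; c 11], c 12, c 13, c 14,
      !![c 15, c 16, c 17], c 18, c 19 • 1 + c 20 • eta + c 21 • xi⟩ := rfl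

/-- The algebra morphism from `ℚ[η, ξ]/(η², ηξ, ξ²)` to the dual numbers with `η ↦ r ε` and
`ξ ↦ q ε`. -/
def toDual (r q : ℚ) : LocRing →ₐ[ℚ] DualNumber ℚ :=
  Ideal.Quotient.liftₐ sqIdeal
    (MvPolynomial.aeval ![TrivSqZeroExt.inr r, TrivSqZeroExt.inr q]) (by
      intro p hp
      have h : sqIdeal ≤ RingHom.ker (MvPolynomial.aeval (R := ℚ)
          (![TrivSqZeroExt.inr r, TrivSqZeroExt.inr q] : Fin 2 → DualNumber ℚ)) := by
        rw [sqIdeal, Ideal.span_le]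
        rintro q (rfl | rfl | rfl) <;> simp [RingHom.mem_ker, pow_two]
      exact h hp)

theorem toDual_eta (r q : ℚ) : toDual r q eta = TrivSqZeroExt.inr r := by
  change MvPolynomial.aeval (R := ℚ) _ (MvPolynomial.X 0) = _
  simp

theorem toDual_xi (r q : ℚ) : toDual r q xi = TrivSqZeroExt.inr q := by
  change MvPolynomial.aeval (R := ℚ) _ (MvPolynomial.X 1) = _
  simp

/-- The coefficients are read off by three maps: `aug`, and the two morphisms to the dual numbers
sending `(η, ξ)` to `(ε, 0)` and to `(0, ε)`. -/
theorem LocRing.coord_eq_zero {z1 z2 z3 : ℚ}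
    (h : z1 • (1 : LocRing) + z2 • eta + z3 • xi = 0) : z1 = 0 ∧ z2 = 0 ∧ z3 = 0 := by
  have h1 := congrArg aug h
  have h2 := congrArg (fun z => (toDual 1 0 z).snd) h
  have h3 := congrArg (fun z => (toDual 0 1 z).snd) h
  simp [toDual_eta, toDual_xi] at h1 h2 h3
  exact ⟨h1, h2, h3⟩

/-- Multiplying by a variable leaves only the constant term of the other factor, so monomials of
higher degree contribute nothing. -/
theorem LocRing.exists_coord (z : LocRing) :
    ∃ z1 z2 z3 : ℚ, z = z1 • (1 : LocRing) + z2 • eta + z3 • xi := by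
  obtain ⟨p, rfl⟩ := LocRing.mk_surjective z
  induction p using MvPolynomial.induction_on with
  | C r => exact ⟨r, 0, 0, by
      rw [zero_smul, zero_smul, add_zero, add_zero, ← Algebra.algebraMap_eq_smul_one]; rfl⟩
  | add p q hp hq =>
    obtain ⟨z1, z2, z3, hp⟩ := hp
    obtain ⟨y1, y2, y3, hq⟩ := hq
    exact ⟨z1 + y1, z2 + y2, z3 + y3, by rw [map_add, hp, hq]; module⟩
  | mul_X p i hp =>
    rw [map_mul]
    fin_cases i
    · exact ⟨0, aug (LocRing.mk p), 0, by
        rw [zero_smul, zero_smul, zero_add, add_zero]; exact mul_eta _⟩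
    · exact ⟨0, 0, aug (LocRing.mk p), by
        rw [zero_smul, zero_smul, zero_add, zero_add]; exact mul_xi _⟩

theorem coordMap_injective : Function.Injective coordMap := by
  refine (injective_iff_map_eq_zero _).2 fun c hc => ?_
  rw [coordMap_apply, A.ext_iff] at hc
  obtain ⟨hs, ht, hu, hv, hw, hx, hy, hz⟩ := hc
  obtain ⟨h1, h2, h3⟩ := LocRing.coord_eq_zero hz
  have hs' := fun i j => congrFun (congrFun hs i) j
  have ht' := fun i => congrFun (congrFun ht i) 0
  have hx' := fun i => congrFun (congrFun hx 0) i
  simp [Fin.forall_fin_succ] at hs' ht' hx' hu hv hw hy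
  obtain ⟨⟨h4, h5, h6⟩, ⟨h7, h8, h9⟩, h10, h11, h12⟩ := hs'
  obtain ⟨h13, h14, h15⟩ := ht'
  obtain ⟨h16, h17, h18⟩ := hx'
  funext k
  fin_cases k <;> assumption

theorem coordMap_surjective : Function.Surjective coordMap := by
  rintro ⟨s, t, u, v, w, x, y, z⟩
  obtain ⟨z1, z2, z3, rfl⟩ := LocRing.exists_coord z
  refine ⟨![s 0 0, s 0 1, s 0 2, s 1 0, s 1 1, s 1 2, s 2 0, s 2 1, s 2 2, t 0 0, t 1 0, t 2 0,
    u, v, w, x 0 0, x 0 1, x 0 2, y, z1, z2, z3], ?_⟩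
  rw [coordMap_apply]
  ext1
  case s => ext i j; fin_cases i <;> fin_cases j <;> rfl
  case t => ext i j; fin_cases i <;> fin_cases j <;> rfl
  case x => ext i j; fin_cases i <;> fin_cases j <;> rfl
  all_goals rfl

/-- The multiplication of `A` in coordinates. -/
def mulCoord {R : Type} [CommRing R] (p q : Fin 22 → R) (k : Fin 22) : R :=
  [p 0 * q 0 + p 1 * q 3 + p 2 * q 6, p 0 * q 1 + p 1 * q 4 + p 2 * q 7,
    p 0 * q 2 + p 1 * q 5 + p 2 * q 8, p 3 * q 0 + p 4 * q 3 + p 5 * q 6,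
    p 3 * q 1 + p 4 * q 4 + p 5 * q 7, p 3 * q 2 + p 4 * q 5 + p 5 * q 8,
    p 6 * q 0 + p 7 * q 3 + p 8 * q 6, p 6 * q 1 + p 7 * q 4 + p 8 * q 7,
    p 6 * q 2 + p 7 * q 5 + p 8 * q 8,
    p 0 * q 9 + p 1 * q 10 + p 2 * q 11 + q 19 * p 9,
    p 3 * q 9 + p 4 * q 10 + p 5 * q 11 + q 19 * p 10,
    p 6 * q 9 + p 7 * q 10 + p 8 * q 11 + q 19 * p 11,
    p 12 * q 12, p 12 * q 13 + p 13 * q 19, p 14 * q 14,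
    p 15 * q 0 + p 16 * q 3 + p 17 * q 6 + p 19 * q 15,
    p 15 * q 1 + p 16 * q 4 + p 17 * q 7 + p 19 * q 16,
    p 15 * q 2 + p 16 * q 5 + p 17 * q 8 + p 19 * q 17,
    p 18 * q 12 + p 19 * q 18, p 19 * q 19,
    p 15 * q 9 + p 16 * q 10 + p 17 * q 11 - 12 * (p 18 * q 13) + p 19 * q 20 + p 20 * q 19,
    p 18 * q 13 + p 19 * q 21 + p 21 * q 19].getD k 0

theorem aug_coord (z1 z2 z3 : ℚ) : aug (z1 • (1 : LocRing) + z2 • eta + z3 • xi) = z1 := by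
  simp

theorem coordMap_mul (p q : Fin 22 → ℚ) :
    coordMap p * coordMap q = coordMap (mulCoord p q) := by
  ext1
  case s =>
    rw [A.mul_s, coordMap_apply, coordMap_apply, coordMap_apply]
    ext i j
    rw [Matrix.mul_apply, Fin.sum_univ_three]
    fin_cases i <;> fin_cases j <;> rfl
  case t =>
    rw [A.mul_t, coordMap_apply, coordMap_apply, coordMap_apply]
    ext i j
    rw [Matrix.add_apply, Matrix.smul_apply, Matrix.mul_apply, Fin.sum_univ_three, aug_coord]
    fin_cases i <;> fin_cases j <;> rfl
  case x =>
    rw [A.mul_x, coordMap_apply, coordMap_apply, coordMap_apply]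
    ext i j
    rw [Matrix.add_apply, Matrix.smul_apply, Matrix.mul_apply, Fin.sum_univ_three, aug_coord]
    fin_cases i <;> fin_cases j <;> rfl
  case z =>
    rw [A.mul_z, coordMap_apply, coordMap_apply, coordMap_apply, Matrix.mul_apply,
      Fin.sum_univ_three]
    change (p 15 * q 9 + p 16 * q 10 + p 17 * q 11) • eta + (p 18 * q 13) •
      (xi - (12 : ℚ) • eta) + (p 19 • 1 + p 20 • eta + p 21 • xi) *
        (q 19 • 1 + q 20 • eta + q 21 • xi) = (p 19 * q 19) • 1 +
      (p 15 * q 9 + p 16 * q 10 + p 17 * q 11 - 12 * (p 18 * q 13) + p 19 * q 20 +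
        p 20 * q 19) • eta + (p 18 * q 13 + p 19 * q 21 + p 21 * q 19) • xi
    simp only [mul_add, add_mul, smul_mul_smul_comm, mul_one, one_mul, eta_mul_eta, eta_mul_xi,
      xi_mul_eta, xi_mul_xi, smul_zero]
    module
  case v =>
    rw [A.mul_v, coordMap_apply, coordMap_apply, coordMap_apply, aug_coord]
    rfl
  case y =>
    rw [A.mul_y, coordMap_apply, coordMap_apply, coordMap_apply, aug_coord]
    rfl
  all_goals rfl

/-- The structure constants are integers, so products of elements with integral coordinates can be
computed over `ℤ` and transported to `ℚ`. -/
theorem map_mulCoord {R S : Type} [CommRing R] [CommRing S] (f : R →+* S) (p q : Fin 22 → R)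
    (k : Fin 22) : mulCoord (fun k => f (p k)) (fun k => f (q k)) k = f (mulCoord p q k) := by
  unfold mulCoord
  rw [← List.getD_map (f := ⇑f), map_zero]
  simp only [List.map_cons, List.map_nil, map_add, map_mul, map_sub, map_ofNat]

/-- The element of `A` with integral coordinates `p`. -/
def intCoordMap (p : Fin 22 → ℤ) : A := coordMap fun k => (p k : ℚ)

theorem intCoordMap_mul (p q : Fin 22 → ℤ) :
    intCoordMap p * intCoordMap q = intCoordMap (mulCoord p q) := by
  rw [intCoordMap, intCoordMap, coordMap_mul]
  exact congrArg coordMap (funext fun k => map_mulCoord (Int.castRingHom ℚ) p q k)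

theorem intCoordMap_sum_smul {ι : Type*} (s : Finset ι) (n : ι → ℤ) (p : ι → Fin 22 → ℤ) :
    intCoordMap (fun k => ∑ i ∈ s, n i * p i k) = ∑ i ∈ s, (n i : ℚ) • intCoordMap (p i) := by
  simp only [intCoordMap, ← map_smul, ← map_sum]
  refine congrArg coordMap (funext fun k => ?_)
  simp

/-! ## The coordinates of the images of the transitive bisets -/

/-- The entry of a table of integers. -/
def entry (l : List (List ℤ)) (i k : ℕ) : ℤ := (l.getD i []).getD k 0

/-- The coordinates of `δ` of the transitive bisets. -/
def deltaList : List (List ℤ) := [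
  [0, -5, 0, 0, 6, 0, 0, -42, 0, 0, 0, 0, 0, 0, 0, 0, 252, 0, 0, 0, 0, 0],
  [15, -60, -10, -18, 72, 12, 126, -504, -84, -10, 12, -84, 0, 0, 0, -756, 3024, 504, 0, 0, 504,
    0],
  [20, -55, -10, -24, 66, 12, 168, -462, -84, -10, 12, -84, 0, 0, 0, -1008, 2772, 504, 0, 0, 504,
    0],
  [25, -85, -15, -30, 102, 18, 210, -714, -126, -10, 12, -84, 0, 0, 0, -1260, 4284, 756, 0, 0,
    504, 0],
  [0, -2, 0, 0, 3, 0, 0, -20, 0, 0, 0, 0, 0, 0, 0, 0, 120, 0, 0, 0, 0, 0],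
  [6, -24, -4, -9, 36, 6, 60, -240, -40, -4, 6, -40, 0, 0, 0, -360, 1440, 240, 0, 0, 240, 0],
  [8, -22, -4, -12, 33, 6, 80, -220, -40, -4, 6, -40, 0, 0, 0, -480, 1320, 240, 0, 0, 240, 0],
  [10, -34, -6, -15, 51, 9, 100, -340, -60, -4, 6, -40, 0, 0, 0, -600, 2040, 360, 0, 0, 240, 0],
  [0, -3, 0, 0, 2, 0, 0, -16, 0, 0, 0, 0, 0, 0, 0, 0, 96, 0, 0, 0, 0, 0],
  [9, -36, -6, -6, 24, 4, 48, -192, -32, -6, 4, -32, 0, 0, 0, -288, 1152, 192, 0, 0, 192, 0],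
  [12, -33, -6, -8, 22, 4, 64, -176, -32, -6, 4, -32, 0, 0, 0, -384, 1056, 192, 0, 0, 192, 0],
  [15, -51, -9, -10, 34, 6, 80, -272, -48, -6, 4, -32, 0, 0, 0, -480, 1632, 288, 0, 0, 192, 0],
  [0, -1, 0, 0, 1, 0, 0, -7, 0, 0, 0, 0, 0, 0, 0, 0, 36, 0, 0, 0, 0, 0],
  [3, -12, -2, -3, 12, 2, 21, -84, -14, -2, 2, -14, 0, 0, 0, -108, 432, 72, 0, 0, 72, 0],
  [4, -11, -2, -4, 11, 2, 28, -77, -14, -2, 2, -14, 0, 0, 0, -144, 396, 72, 0, 0, 72, 0],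
  [5, -17, -3, -5, 17, 3, 35, -119, -21, -2, 2, -14, 0, 0, 0, -180, 612, 108, 0, 0, 72, 0],
  [-3, 9, 2, 0, 3, 0, -6, 2, 4, 2, 0, 4, 1, 0, 0, 36, -12, -24, 0, 0, -24, 0],
  [8, -23, -4, 0, 2, 0, 12, -46, -6, -4, 0, -6, 0, 0, 2, -72, 276, 36, 0, 0, 36, 0],
  [1, 0, 0, 0, 1, 0, 0, 0, 1, 0, 0, 0, 1, 0, 1, 0, 0, 0, 0, 1, 0, 0],
  [7, -16, -3, -12, 33, 6, 78, -208, -38, -4, 6, -40, 1, -2, 0, -468, 1248, 228, 0, 0, 240, 0],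
  [-3, 10, 2, 0, 1, 0, -6, 15, 4, 2, 0, 4, 1, 0, 0, 72, -228, -48, -2, 0, -48, 0],
  [3, -5, -1, -4, 11, 2, 26, -65, -12, -2, 2, -14, 1, -2, 0, -120, 252, 48, -2, 0, 24, 4]]

/-- The coefficients of a basis of `Λ` with respect to `δ` of the transitive bisets. -/
def lamList : List (List ℤ) := [
  [-4, 4, -4, 0, 6, -6, 6, 0, 3, -3, 3, 0, 0, 0, 0, 0, 0, 0, 0, 0, 0, 0],
  [4, 0, 0, 0, -6, 0, 0, 0, -3, 0, 0, 0, 0, 0, 0, 0, 0, 0, 0, 0, 0, 0],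
  [-28, 4, -8, 4, 42, -6, 12, -6, 21, -3, 6, -3, 0, 0, 0, 0, 0, 0, 0, 0, 0, 0],
  [14, -14, 14, 0, -23, 23, -23, 0, -8, 8, -8, 0, 0, 0, 0, 0, 0, 0, 0, 0, 0, 0],
  [-14, 0, 0, 0, 23, 0, 0, 0, 8, 0, 0, 0, 0, 0, 0, 0, 0, 0, 0, 0, 0, 0],
  [98, -14, 28, -14, -161, 23, -46, 23, -56, 8, -16, 8, 0, 0, 0, 0, 0, 0, 0, 0, 0, 0],
  [3, -3, 3, 0, -5, 5, -5, 0, -2, 2, -2, 0, 1, -1, 1, 0, 0, 0, 0, 0, 0, 0],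
  [-3, 0, 0, 0, 5, 0, 0, 0, 2, 0, 0, 0, -1, 0, 0, 0, 0, 0, 0, 0, 0, 0],
  [21, -3, 6, -3, -35, 5, -10, 5, -14, 2, -4, 2, 7, -1, 2, -1, 0, 0, 0, 0, 0, 0],
  [-4, 8, 4, -8, 6, -12, -6, 12, 3, -6, -3, 6, 0, 0, 0, 0, 0, 0, 0, 0, 0, 0],
  [14, -28, -14, 28, -23, 46, 23, -46, -8, 16, 8, -16, 0, 0, 0, 0, 0, 0, 0, 0, 0, 0],
  [3, -6, -3, 6, -5, 10, 5, -10, -2, 4, 2, -4, 1, -2, -1, 2, 0, 0, 0, 0, 0, 0],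
  [-1, 1, 0, 0, 1, -2, 0, 0, 0, 0, 0, 0, 0, 0, 0, 0, 1, 0, 0, 0, 0, 0],
  [-1, 1, 1, -1, 1, -2, -1, 2, 0, 0, 0, 0, 0, 0, 0, 0, 1, 0, 0, -1, 0, 0],
  [-1, 0, 1, 0, 0, 0, 0, 0, 1, 0, -3, 0, 0, 0, 0, 0, 0, 2, 0, 0, 0, 0],
  [1, -1, 1, 0, -2, 2, -2, 0, -1, 1, -1, 0, 2, -2, 2, 0, 0, 0, 0, 0, 0, 0],
  [-1, 0, 0, 0, 2, 0, 0, 0, 1, 0, 0, 0, -2, 0, 0, 0, 0, 0, 0, 0, 0, 0],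
  [7, -1, 2, -1, -14, 2, -4, 2, -7, 1, -2, 1, 14, -2, 4, -2, 0, 0, 0, 0, 0, 0],
  [-1, 1, 0, 0, 1, -2, 0, 0, 1, -1, 0, 0, -1, 2, 0, 0, 1, 0, 0, 0, -1, 0],
  [-2, -2, -2, 3, 5, 3, 4, -5, 3, 1, 1, -2, -7, 1, -2, 1, -1, 0, 1, 0, 0, 0],
  [-1, -1, 1, 1, -1, 2, 1, -2, 1, 1, -4, -1, 1, -2, -1, 2, 0, 3, 0, 0, 0, 0],
  [1, -3, -1, 3, -3, 6, 3, -6, -1, 3, 1, -3, 3, -6, -3, 6, 1, 0, 0, -1, -1, 1]]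

/-- The coefficients, multiplied by `24`, of the basis of `B_ℚ` that defines `γ`. -/
def gammaList : List (List ℤ) := [
  [-12, 0, 0, 0, 24, 0, 0, 0, 12, 0, 0, 0, 0, 0, 0, 0, 0, 0, 0, 0, 0, 0],
  [12, -12, 0, 0, -24, 24, 0, 0, -12, 12, 0, 0, 0, 0, 0, 0, 0, 0, 0, 0, 0, 0],
  [-3, 12, -9, 0, 6, -24, 18, 0, 3, -12, 9, 0, 0, 0, 0, 0, 0, 0, 0, 0, 0, 0],
  [-32, 0, 0, 0, 48, 0, 0, 0, 24, 0, 0, 0, 0, 0, 0, 0, 0, 0, 0, 0, 0, 0],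
  [32, -32, 0, 0, -48, 48, 0, 0, -24, 24, 0, 0, 0, 0, 0, 0, 0, 0, 0, 0, 0, 0],
  [-8, 32, -24, 0, 12, -48, 36, 0, 6, -24, 18, 0, 0, 0, 0, 0, 0, 0, 0, 0, 0, 0],
  [-8, 0, 0, 0, 0, 0, 0, 0, 24, 0, 0, 0, 0, 0, 0, 0, 0, 0, 0, 0, 0, 0],
  [8, -8, 0, 0, 0, 0, 0, 0, -24, 24, 0, 0, 0, 0, 0, 0, 0, 0, 0, 0, 0, 0],
  [-2, 8, -6, 0, 0, 0, 0, 0, 6, -24, 18, 0, 0, 0, 0, 0, 0, 0, 0, 0, 0, 0],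
  [-3, 6, 3, -6, 6, -12, -6, 12, 3, -6, -3, 6, 0, 0, 0, 0, 0, 0, 0, 0, 0, 0],
  [-8, 16, 8, -16, 12, -24, -12, 24, 6, -12, -6, 12, 0, 0, 0, 0, 0, 0, 0, 0, 0, 0],
  [-2, 4, 2, -4, 0, 0, 0, 0, 6, -12, -6, 12, 0, 0, 0, 0, 0, 0, 0, 0, 0, 0],
  [-24, 24, 0, 0, 24, -48, 0, 0, 0, 0, 0, 0, 0, 0, 0, 0, 24, 0, 0, 0, 0, 0],
  [-12, 12, 12, -12, 12, -24, -12, 24, 0, 0, 0, 0, 0, 0, 0, 0, 12, 0, 0, -12, 0, 0],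
  [-6, 0, 6, 0, 0, 0, 0, 0, 6, 0, -18, 0, 0, 0, 0, 0, 0, 12, 0, 0, 0, 0],
  [4, 0, 0, 0, -8, 0, 0, 0, -4, 0, 0, 0, 8, 0, 0, 0, 0, 0, 0, 0, 0, 0],
  [-4, 4, 0, 0, 8, -8, 0, 0, 4, -4, 0, 0, -8, 8, 0, 0, 0, 0, 0, 0, 0, 0],
  [1, -4, 3, 0, -2, 8, -6, 0, -1, 4, -3, 0, 2, -8, 6, 0, 0, 0, 0, 0, 0, 0],
  [-12, 12, 0, 0, 12, -24, 0, 0, 12, -12, 0, 0, -12, 24, 0, 0, 12, 0, 0, 0, -12, 0],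
  [12, 0, 0, 0, 0, 0, 0, 0, 0, 0, 0, 0, 0, 0, 0, 0, -24, -12, 24, 0, 0, 0],
  [1, -2, -1, 2, -2, 4, 2, -4, -1, 2, 1, -2, 2, -4, -2, 4, 0, 0, 0, 0, 0, 0],
  [6, -18, -6, 18, -18, 36, 18, -36, -6, 18, 6, -18, 18, -36, -18, 36, 6, 0, 0, -6, -6, 6]]

/-- The coordinates of `δ` of the transitive biset with number `i`. -/
def deltaCoord (i : ℕ) (k : Fin 22) : ℤ := entry deltaList i k

/-- Whether `m` and `m'` are in the same double coset, in terms of the masks of two subgroups. -/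
def dcosetRel (n n' m m' : ℕ) : Bool :=
  (List.range 6).any fun k => ((List.range 6).any fun h => n.testBit (6 * h + k)) &&
    (List.range 6).any fun g => n'.testBit (6 * mul6 (mul6 (inv6 m) k) m' + g)

/-- The minimal elements of the double cosets. -/
def dcosetReps (n n' : ℕ) : List ℕ :=
  (List.range 6).filter fun m => !(List.range m).any fun m' => dcosetRel n n' m' m

/-- The index of the conjugacy class of a composition of two of the representatives. -/
def starIndex (i j m : ℕ) : ℕ := (findMask (starMask (maskOf i) (maskOf j) m) conjTable).1

/-- The default index 22 of a failed lookup never occurs: every composition in the Mackey formula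
has its mask in the table. -/
theorem starIndex_lt : ∀ i < 22, ∀ j < 22, ∀ m ∈ dcosetReps (maskOf i) (maskOf j),
    starIndex i j m < 22 := by
  decide +kernel

/-- This is multiplicativity of `δ` on generators, stated in integers: a product in `A` on the left,
the images of the Mackey summands on the right. -/
theorem mulCoord_deltaCoord : ∀ i < 22, ∀ j < 22, ∀ k : Fin 22,
    mulCoord (deltaCoord i) (deltaCoord j) k =
      ((dcosetReps (maskOf i) (maskOf j)).map fun m => deltaCoord (starIndex i j m) k).sum := by
  decide +kernel

theorem dcosetRel_iff {U V : Subgroup (S3 × S3)} {n n' m m' : ℕ} (hU : HasMask U n)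
    (hV : HasMask V n') (hm : m < 6) (hm' : m' < 6) :
    dcosetRel n n' m m' = true ↔ DoubleCosetRel U V (el m) (el m') := by
  have h1 : ∀ k < 6, (∃ h, (h, el k) ∈ U) ↔ ∃ h < 6, n.testBit (6 * h + k) = true := by
    intro k hk
    constructor
    · rintro ⟨h, hh⟩
      obtain ⟨i, hi, rfl⟩ := exists_el h
      exact ⟨i, hi, by rwa [← hU _ (by omega), elPair_six_mul_add hk]⟩
    · rintro ⟨i, hi, hh⟩
      exact ⟨el i, by rwa [← hU _ (by omega), elPair_six_mul_add hk] at hh⟩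
  have h2 : ∀ l < 6, (∃ h, (el l, h) ∈ V) ↔ ∃ h < 6, n'.testBit (6 * l + h) = true := by
    intro l hl
    constructor
    · rintro ⟨h, hh⟩
      obtain ⟨i, hi, rfl⟩ := exists_el h
      exact ⟨i, hi, by rwa [← hV _ (by omega), elPair_six_mul_add hi]⟩
    · rintro ⟨i, hi, hh⟩
      exact ⟨el i, by rwa [← hV _ (by omega), elPair_six_mul_add hi] at hh⟩
  have h3 : ∀ k < 6, el (mul6 (mul6 (inv6 m) k) m') = (el m)⁻¹ * el k * el m' := by
    intro k hk
    rw [el_mul (mul6_lt _ _) hm', el_mul (inv6_lt hm) hk, el_inv hm]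
  simp only [dcosetRel, List.any_eq_true, List.mem_range, Bool.and_eq_true]
  constructor
  · rintro ⟨k, hk, h4, h5⟩
    exact ⟨el k, (h1 k hk).2 h4, by rw [← h3 k hk]; exact (h2 _ (mul6_lt _ _)).2 h5⟩
  · rintro ⟨x, h4, h5⟩
    obtain ⟨k, hk, rfl⟩ := exists_el x
    exact ⟨k, hk, (h1 k hk).1 h4, (h2 _ (mul6_lt _ _)).1 (by rw [h3 k hk]; exact h5)⟩

/-- The representative of a conjugacy class of subgroups with a given number. -/
def repNat (i : ℕ) : Subgroup (S3 × S3) := if hi : i < 22 then rep ⟨i, hi⟩ else ⊥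

/-- The products of the transitive bisets. -/
theorem cls_rep_mul (R : Type) [CommRing R] (i j : Fin 22) :
    cls R (Biset.ofSubgroup (rep i)) * cls R (Biset.ofSubgroup (rep j)) =
      ((dcosetReps (maskOf i) (maskOf j)).map fun m =>
        cls R (Biset.ofSubgroup (repNat (starIndex i j m)))).sum := by
  have hi := hasMask_rep i
  have hj := hasMask_rep j
  have hmem : ∀ m, m ∈ dcosetReps (maskOf i) (maskOf j) ↔ m < 6 ∧ ∀ m' < m,
      ¬ dcosetRel (maskOf i) (maskOf j) m' m = true := by
    intro m
    simp [dcosetReps]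
  -- The double coset relation is equality of orbits in the tensor product, from which symmetry and
  -- transitivity are inherited.
  have hsymm : ∀ m m', DoubleCosetRel (rep i) (rep j) m m' →
      DoubleCosetRel (rep i) (rep j) m' m := fun m m' hm =>
    orb_tensorMk.1 (orb_tensorMk.2 hm).symm
  have hnodup : (dcosetReps (maskOf i) (maskOf j)).Nodup := List.nodup_range.filter _
  -- The list keeps the minimal element of each double coset, so two related entries cannot differ.
  have hlt : ∀ m ∈ dcosetReps (maskOf i) (maskOf j), ∀ m' ∈ dcosetReps (maskOf i) (maskOf j),
      DoubleCosetRel (rep i) (rep j) (el m) (el m') → ¬ m < m' := fun m hm m' hm' hr hlt =>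
    ((hmem m').1 hm').2 m hlt
      ((dcosetRel_iff hi hj ((hmem m).1 hm).1 ((hmem m').1 hm').1).2 hr)
  rw [cls_ofSubgroup_mul R (rep i) (rep j) (dcosetReps (maskOf i) (maskOf j)).toFinset el,
    List.sum_toFinset _ hnodup]
  · refine congrArg List.sum (List.map_congr_left fun m hm => ?_)
    have hlt := starIndex_lt i i.2 j j.2 m hm
    rw [repNat, dif_pos hlt]
    exact cls_ofSubgroup_eq R ((hi.starConj hj ((hmem m).1 hm).1).isConjRep hlt)
  · intro m hm m' hm' hr
    rw [List.mem_toFinset] at hm hm'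
    exact le_antisymm (not_lt.1 (hlt m' hm' m hm (hsymm _ _ hr))) (not_lt.1 (hlt m hm m' hm' hr))
  · intro x
    obtain ⟨m, hm, rfl⟩ := exists_el x
    -- A number that is not in the list is related to a smaller one, so descent reaches a listed
    -- representative.
    induction m using Nat.strong_induction_on with
    | _ m ih =>
      by_cases hr : m ∈ dcosetReps (maskOf i) (maskOf j)
      · exact ⟨m, List.mem_toFinset.2 hr, orb_tensorMk.1 rfl⟩
      · rw [hmem] at hr
        push Not at hr
        obtain ⟨m', hlt', hr'⟩ := hr hm
        obtain ⟨k, hk, hkr⟩ := ih m' hlt' (hlt'.trans hm)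
        rw [dcosetRel_iff hi hj (hlt'.trans hm) hm] at hr'
        exact ⟨k, hk, orb_tensorMk.1 ((orb_tensorMk.2 hkr).trans (orb_tensorMk.2 hr'))⟩

/-! ## The images of the transitive bisets -/

/-- The class of the transitive biset with number `i`. -/
def transCls (R : Type) [CommRing R] (i : Fin 22) : Burnside R S3 :=
  cls R (Biset.ofSubgroup (rep i))

theorem span_transCls (R : Type) [CommRing R] :
    Submodule.span R (Set.range (transCls R)) = ⊤ := by
  rw [← span_cls_ofSubgroup R]
  congr 1
  ext y
  constructor
  · rintro ⟨i, rfl⟩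
    exact ⟨rep i, rfl⟩
  · rintro ⟨U, rfl⟩
    obtain ⟨i, hi⟩ := exists_isConjRep U
    exact ⟨i, (cls_ofSubgroup_eq R hi).symm⟩

theorem exists_eq_sum_transCls (R : Type) [CommRing R] (y : Burnside R S3) :
    ∃ n : Fin 22 → R, ∑ i, n i • transCls R i = y :=
  Submodule.mem_span_range_iff_exists_fun R |>.1 (span_transCls R ▸ Submodule.mem_top)

/-- Every point `m` is given the weight `1 / index` times the tabulated value for the class of its
stabilizer. The `index` many points of a transitive biset then add up to exactly that value. -/
theorem exists_deltaLin : ∃ f : Burnside ℚ S3 →ₗ[ℚ] A,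
    ∀ i, f (transCls ℚ i) = intCoordMap (deltaCoord i) := by
  obtain ⟨f, hf⟩ := exists_linearMap_stab ℚ fun U : Subgroup (S3 × S3) =>
    (U.index : ℚ)⁻¹ • intCoordMap (deltaCoord (conjIndex U))
  refine ⟨f, fun i => ?_⟩
  rw [transCls, hf, finsum_stab_ofSubgroup
    (w := fun U => (U.index : ℚ)⁻¹ • intCoordMap (deltaCoord (conjIndex U))),
    (isConjRep_rep i).conjIndex_eq, ← Nat.cast_smul_eq_nsmul ℚ, smul_smul, mul_inv_cancel₀,
    one_smul]
  · exact Nat.cast_ne_zero.2 (Subgroup.index_ne_zero_of_finite)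
  · intro U c
    have h1 : (U.map (MulAut.conj c).toMonoidHom).index = U.index :=
      U.index_map_equiv (MulAut.conj c)
    rw [conjIndex_map_conj, h1]

/-- The linear extension of `δ`. -/
def deltaLin : Burnside ℚ S3 →ₗ[ℚ] A := exists_deltaLin.choose

theorem deltaLin_transCls (i : Fin 22) :
    deltaLin (transCls ℚ i) = intCoordMap (deltaCoord i) :=
  exists_deltaLin.choose_spec i

theorem intCoordMap_list_sum {ι : Type*} (l : List ι) (p : ι → Fin 22 → ℤ) :
    intCoordMap (fun k => (l.map fun i => p i k).sum) = (l.map fun i => intCoordMap (p i)).sum := by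
  induction l with
  | nil =>
    refine (congrArg coordMap (funext fun k => ?_)).trans (map_zero coordMap)
    simp
  | cons i l ih =>
    simp only [List.map_cons, List.sum_cons, ← ih]
    refine (congrArg coordMap (funext fun k => ?_)).trans (map_add coordMap _ _)
    simp

/-- The Mackey formula on the biset side meets the integer check `mulCoord_deltaCoord` on the side
of `A`; both sums run over the same double coset representatives. -/
theorem deltaLin_mul_transCls (i j : Fin 22) :
    deltaLin (transCls ℚ i * transCls ℚ j) =
      deltaLin (transCls ℚ i) * deltaLin (transCls ℚ j) := by
  have h : mulCoord (deltaCoord i) (deltaCoord j) = _ :=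
    funext fun k => mulCoord_deltaCoord i i.2 j j.2 k
  rw [deltaLin_transCls, deltaLin_transCls, intCoordMap_mul, h,
    intCoordMap_list_sum _ fun m => deltaCoord (starIndex i j m), transCls, transCls, cls_rep_mul,
    map_list_sum, List.map_map]
  refine congrArg List.sum (List.map_congr_left fun m hm => ?_)
  have hlt := starIndex_lt i i.2 j j.2 m hm
  rw [Function.comp_apply, repNat, dif_pos hlt]
  exact deltaLin_transCls ⟨_, hlt⟩

theorem deltaLin_mul (x y : Burnside ℚ S3) : deltaLin (x * y) = deltaLin x * deltaLin y := by
  obtain ⟨m, rfl⟩ := exists_eq_sum_transCls ℚ x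
  obtain ⟨n, rfl⟩ := exists_eq_sum_transCls ℚ y
  simp only [Finset.sum_mul_sum, map_sum, smul_mul_smul_comm, map_smul, deltaLin_mul_transCls]

/-! ## The coordinates of `Λ` -/

/-- The elements of `Λ` in terms of coordinates with respect to a basis of `Λ`. -/
def lamCoord {R : Type} [CommRing R] (c : Fin 22 → R) (k : Fin 22) : R :=
  [c 0, c 1, c 2, c 3, c 4, c 5, c 6, c 7, c 8, 2 * c 9, 2 * c 10, 2 * c 11, c 12, 2 * c 13,
    c 19 + 6 * c 20 + 4 * c 14, 12 * c 15, 12 * c 16, 12 * c 17, 2 * c 18, c 19, 12 * c 20,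
    4 * c 21].getD k 0

theorem map_lamCoord {R S : Type} [CommRing R] [CommRing S] (f : R →+* S) (c : Fin 22 → R)
    (k : Fin 22) : lamCoord (fun k => f (c k)) k = f (lamCoord c k) := by
  unfold lamCoord
  rw [← List.getD_map (f := ⇑f), map_zero]
  simp only [List.map_cons, List.map_nil, map_add, map_mul, map_ofNat]

/-- `lamCoord` as a linear map. -/
def lamLin : (Fin 22 → ℚ) →ₗ[ℚ] (Fin 22 → ℚ) where
  toFun c := lamCoord c
  map_add' c d := by
    funext k
    fin_cases k
    all_goals first | rfl | exact mul_add _ _ _ | skip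
    change c 19 + d 19 + 6 * (c 20 + d 20) + 4 * (c 14 + d 14) =
      c 19 + 6 * c 20 + 4 * c 14 + (d 19 + 6 * d 20 + 4 * d 14)
    ring
  map_smul' r c := by
    funext k
    fin_cases k
    all_goals first | rfl | exact mul_left_comm _ _ _ | skip
    change r * c 19 + 6 * (r * c 20) + 4 * (r * c 14) = r * (c 19 + 6 * c 20 + 4 * c 14)
    ring

theorem lamLin_surjective : Function.Surjective lamLin := by
  intro p
  -- The system is triangular with nonzero diagonal. Entry 14 solves `w = z₁ + 6 k + 4 m` for `m`,
  -- where `k = z₂ / 12`.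
  refine ⟨![p 0, p 1, p 2, p 3, p 4, p 5, p 6, p 7, p 8, p 9 / 2, p 10 / 2, p 11 / 2, p 12,
    p 13 / 2, (p 14 - p 19 - p 20 / 2) / 4, p 15 / 12, p 16 / 12, p 17 / 12, p 18 / 2, p 19,
    p 20 / 12, p 21 / 4], ?_⟩
  funext k
  have h2 : ∀ x : ℚ, 2 * (x / 2) = x := fun x => by ring
  have h4 : ∀ x : ℚ, 4 * (x / 4) = x := fun x => by ring
  have h12 : ∀ x : ℚ, 12 * (x / 12) = x := fun x => by ring
  fin_cases k
  all_goals first | rfl | exact h2 _ | exact h4 _ | exact h12 _ | skip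
  change p 19 + 6 * (p 20 / 12) + 4 * ((p 14 - p 19 - p 20 / 2) / 4) = p 14
  ring

/-- The matrix `lamList` times the matrix `deltaList` is the coordinate matrix of a basis of `Λ`. As
`lamList` is integral, this yields both that the images span `A` over `ℚ` and that `Λ` lies in the
image of `B_ℤ`. -/
theorem lamCoord_single : ∀ j k : Fin 22,
    lamCoord (fun i => if i = j then (1 : ℤ) else 0) k =
      ∑ i : Fin 22, entry lamList j i * deltaCoord i k := by
  decide +kernel

/-- The preimages under `δ` of a basis of `Λ`. -/
def lamBasis (R : Type) [CommRing R] (j : Fin 22) : Burnside R S3 :=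
  ∑ i, (entry lamList j (i : Fin 22) : R) • transCls R i

theorem deltaLin_lamBasis (j : Fin 22) :
    deltaLin (lamBasis ℚ j) = coordMap (lamLin (Pi.single j 1)) := by
  simp only [lamBasis, map_sum, map_smul, deltaLin_transCls]
  rw [← intCoordMap_sum_smul, ← funext (lamCoord_single j)]
  refine congrArg coordMap (funext fun k => ?_)
  refine (map_lamCoord (Int.castRingHom ℚ) _ k).symm.trans ?_
  refine congrFun (congrArg lamCoord (funext fun i => ?_)) k
  by_cases hij : i = j <;> simp [hij]

theorem coordMap_lamLin (c : Fin 22 → ℚ) :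
    coordMap (lamLin c) = deltaLin (∑ j, c j • lamBasis ℚ j) := by
  rw [LinearMap.pi_apply_eq_sum_univ lamLin c]
  simp only [map_sum, map_smul, deltaLin_lamBasis]
  refine Finset.sum_congr rfl fun j _ => ?_
  congr 3
  funext i
  simp [Pi.single_apply, eq_comm]

/-- The image contains a basis of `Λ`, and `Λ` spans `A` over `ℚ`. -/
theorem deltaLin_surjective : Function.Surjective deltaLin := by
  intro p
  obtain ⟨c, rfl⟩ := coordMap_surjective p
  obtain ⟨d, rfl⟩ := lamLin_surjective c
  exact ⟨_, (coordMap_lamLin d).symm⟩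

/-- The images of the transitive bisets are linearly independent. -/
theorem deltaLin_sum_eq_zero {n : Fin 22 → ℚ} (hn : deltaLin (∑ i, n i • transCls ℚ i) = 0) :
    n = 0 := by
  let T : (Fin 22 → ℚ) →ₗ[ℚ] A := deltaLin.comp (Fintype.linearCombination ℚ (transCls ℚ))
  let E := LinearEquiv.ofBijective coordMap ⟨coordMap_injective, coordMap_surjective⟩
  -- In coordinates `T` becomes a surjective endomorphism of `ℚ ^ 22`, which is injective by
  -- dimension.
  have hT : Function.Surjective T := by
    intro p
    obtain ⟨y, rfl⟩ := deltaLin_surjective p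
    obtain ⟨m, rfl⟩ := exists_eq_sum_transCls ℚ y
    exact ⟨m, rfl⟩
  have hE : Function.Injective (E.symm.toLinearMap.comp T) :=
    LinearMap.injective_iff_surjective.2 (E.symm.surjective.comp hT)
  refine hE ?_
  rw [map_zero]
  change E.symm (deltaLin (∑ i, n i • transCls ℚ i)) = 0
  rw [hn, map_zero]

theorem deltaLin_injective : Function.Injective deltaLin := by
  refine (injective_iff_map_eq_zero _).2 fun y hy => ?_
  obtain ⟨n, rfl⟩ := exists_eq_sum_transCls ℚ y
  rw [deltaLin_sum_eq_zero hy]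
  simp

/-- If `f` is multiplicative and `f y = 1`, then `f 1 = f 1 * f y = f y = 1`; the unit biset need
not be decomposed into orbits. -/
theorem deltaLin_one : deltaLin 1 = 1 := by
  obtain ⟨y, hy⟩ := deltaLin_surjective 1
  rw [← mul_one (deltaLin 1), ← hy, ← deltaLin_mul, one_mul]

/-- The algebra isomorphism from `B_ℚ(S₃,S₃)` to `A` that extends `δ`. -/
def deltaAlgEquiv : Burnside ℚ S3 ≃ₐ[ℚ] A :=
  AlgEquiv.ofLinearEquiv
    (LinearEquiv.ofBijective deltaLin ⟨deltaLin_injective, deltaLin_surjective⟩)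
    deltaLin_one deltaLin_mul

/-! ## The integral double Burnside ring -/

theorem map_transCls (i : Fin 22) :
    Burnside.map (Int.castRingHom ℚ) S3 (transCls ℤ i) = transCls ℚ i := by
  rw [transCls, transCls, cls, cls, Burnside.map, Ideal.Quotient.lift_mk, RingHom.comp_apply]
  congr 1
  simp [freeClass]

theorem map_sum_transCls (n : Fin 22 → ℤ) :
    Burnside.map (Int.castRingHom ℚ) S3 (∑ i, n i • transCls ℤ i) =
      ∑ i, (n i : ℚ) • transCls ℚ i := by
  rw [map_sum]
  refine Finset.sum_congr rfl fun i _ => ?_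
  rw [map_zsmul, map_transCls, Int.cast_smul_eq_zsmul]

/-- The restriction of `deltaAlgEquiv` to `B_ℤ(S₃,S₃)`. -/
def deltaInt : Burnside ℤ S3 →+* A :=
  (deltaAlgEquiv : Burnside ℚ S3 →+* A).comp (Burnside.map (Int.castRingHom ℚ) S3)

theorem deltaInt_sum (n : Fin 22 → ℤ) :
    deltaInt (∑ i, n i • transCls ℤ i) = deltaLin (∑ i, (n i : ℚ) • transCls ℚ i) := by
  rw [← map_sum_transCls]
  rfl

/-- The 22 generators span `B_ℤ` and have linearly independent images over `ℚ`, so a vanishing image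
forces all integral coefficients to vanish. That `B_ℤ` embeds in `B_ℚ` is not needed beforehand. -/
theorem deltaInt_injective : Function.Injective deltaInt := by
  refine (injective_iff_map_eq_zero _).2 fun y hy => ?_
  obtain ⟨n, rfl⟩ := exists_eq_sum_transCls ℤ y
  rw [deltaInt_sum] at hy
  have h := deltaLin_sum_eq_zero hy
  refine Finset.sum_eq_zero fun i _ => ?_
  have hi : (n i : ℚ) = 0 := congrFun h i
  rw [Int.cast_eq_zero.1 hi, zero_smul]

theorem intElt_eq_intCoordMap (p : Fin 22 → ℤ) :
    intElt !![p 0, p 1, p 2; p 3, p 4, p 5; p 6, p 7, p 8] ![p 9, p 10, p 11] (p 12) (p 13) (p 14)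
      ![p 15, p 16, p 17] (p 18) (p 19) (p 20) (p 21) = intCoordMap p := by
  rw [intCoordMap, coordMap_apply]
  ext1
  case s => ext i j; fin_cases i <;> fin_cases j <;> rfl
  case t => ext i j; fin_cases i <;> fin_cases j <;> rfl
  case x => ext i j; fin_cases i <;> fin_cases j <;> rfl
  all_goals rfl

/-- The congruences appear as a plain conjunction so that they can be decided for each row of the
table. -/
theorem intCoordMap_mem_Lam {p : Fin 22 → ℤ}
    (h : 2 * p 14 - 2 * p 19 ≡ p 20 [ZMOD 8] ∧ p 20 ≡ p 21 [ZMOD 4] ∧ p 21 ≡ 0 [ZMOD 4] ∧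
      (∀ j, (![p 15, p 16, p 17] : Fin 3 → ℤ) j ≡ 0 [ZMOD 4]) ∧ p 18 ≡ 0 [ZMOD 2] ∧
      (∀ j, (![p 9, p 10, p 11] : Fin 3 → ℤ) j ≡ 0 [ZMOD 2]) ∧ p 13 ≡ 0 [ZMOD 2] ∧
      (∀ j, (![p 15, p 16, p 17] : Fin 3 → ℤ) j ≡ 0 [ZMOD 3]) ∧ p 20 ≡ 0 [ZMOD 3]) :
    intCoordMap p ∈ Lam := by
  obtain ⟨h1, h2, h3, h4, h5, h6, h7, h8, h9⟩ := h
  rw [← intElt_eq_intCoordMap]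
  exact ⟨_, _, _, _, _, _, _, _, _, _, rfl, ⟨h1, h2, h3, h4, h5, h6, h7, h8, h9⟩⟩

theorem deltaCoord_mem_Lam (i : Fin 22) : intCoordMap (deltaCoord i) ∈ Lam := by
  refine intCoordMap_mem_Lam ?_
  revert i
  decide +kernel

/-- The congruences are solved by `z₂ = 12 k` and `w = z₁ + 6 k + 4 m`, together with plain
divisibilities of the other entries; the quotients are the coordinates in the basis of `Λ`. -/
theorem exists_lamCoord {q : A} (hq : q ∈ Lam) :
    ∃ c : Fin 22 → ℤ, q = coordMap (lamLin fun k => (c k : ℚ)) := by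
  obtain ⟨s, t, u, v, w, x, y, z1, z2, z3, rfl, hc⟩ := hq
  rw [Congruences.iff] at hc
  obtain ⟨⟨k, m, rfl, rfl⟩, ⟨c, rfl⟩, h4, ⟨d, rfl⟩, h6, ⟨f, rfl⟩⟩ := hc
  choose X hX using h4
  choose T hT using h6
  have hs : s = !![s 0 0, s 0 1, s 0 2; s 1 0, s 1 1, s 1 2; s 2 0, s 2 1, s 2 2] := by
    ext i j
    fin_cases i <;> fin_cases j <;> rfl
  have ht : t = ![2 * T 0, 2 * T 1, 2 * T 2] := by
    funext i
    fin_cases i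
    exacts [hT 0, hT 1, hT 2]
  have hx : x = ![12 * X 0, 12 * X 1, 12 * X 2] := by
    funext i
    fin_cases i
    exacts [hX 0, hX 1, hX 2]
  refine ⟨![s 0 0, s 0 1, s 0 2, s 1 0, s 1 1, s 1 2, s 2 0, s 2 1, s 2 2, T 0, T 1, T 2, u, f,
    m, X 0, X 1, X 2, d, z1, k, c], ?_⟩
  refine Eq.trans ?_ ((intElt_eq_intCoordMap (lamCoord _)).trans
    (congrArg coordMap (funext fun l => (map_lamCoord (Int.castRingHom ℚ) _ l).symm)))
  conv_lhs => rw [ht, hx, hs]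
  rfl

theorem Lam_le_AZ : Lam ≤ AZ := by
  rintro _ ⟨s, t, u, v, w, x, y, z1, z2, z3, rfl, _⟩
  exact ⟨s, t, u, v, w, x, y, z1, z2, z3, rfl⟩

theorem deltaInt_range : deltaInt.range = Lam := by
  refine le_antisymm ?_ ?_
  · rintro _ ⟨y, rfl⟩
    obtain ⟨n, rfl⟩ := exists_eq_sum_transCls ℤ y
    rw [map_sum]
    refine sum_mem fun i _ => ?_
    rw [map_zsmul]
    refine zsmul_mem ?_ _
    have h : deltaInt (transCls ℤ i) = intCoordMap (deltaCoord i) := by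
      rw [← deltaLin_transCls, ← map_transCls]
      rfl
    rw [h]
    exact deltaCoord_mem_Lam i
  · intro q hq
    obtain ⟨c, rfl⟩ := exists_lamCoord hq
    rw [coordMap_lamLin, map_sum]
    refine sum_mem fun j _ => ?_
    rw [map_smul, Int.cast_smul_eq_zsmul]
    refine zsmul_mem ?_ _
    exact ⟨∑ i : Fin 22, entry lamList j i • transCls ℤ i, deltaInt_sum _⟩

/-! ## The isomorphism `γ` -/

/-- Conjugation by a unit of `A`. -/
def conjUnit (X : Aˣ) : A ≃ₐ[ℚ] A where
  toFun p := ↑X⁻¹ * p * ↑X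
  invFun p := ↑X * p * ↑X⁻¹
  left_inv p := by simp [mul_assoc]
  right_inv p := by simp [mul_assoc]
  map_mul' p q := by simp [mul_assoc]
  map_add' p q := by simp [mul_add, add_mul]
  commutes' r := by rw [← Algebra.commutes, mul_assoc, Units.inv_mul, mul_one]

/-- The isomorphism `γ`. -/
def gammaEquiv : A ≃ₐ[ℚ] Burnside ℚ S3 :=
  (conjUnit (x1 * x2 * x3)).trans deltaAlgEquiv.symm

/-- Conjugation by `X₁X₂X₃` is built into `gammaEquiv` and is undone in the definition of `delta`.
-/
theorem delta_gammaEquiv : delta gammaEquiv = deltaInt := by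
  refine RingHom.ext fun y => ?_
  change (↑x3⁻¹ * ↑x2⁻¹ * ↑x1⁻¹ * (↑(x1 * x2 * x3) * deltaInt y * ↑(x1 * x2 * x3)⁻¹) *
    ↑x1 * ↑x2 * ↑x3 : A) = deltaInt y
  simp [mul_assoc]

/-- The basis of `B_ℚ(S₃,S₃)` that defines `γ`. -/
def gammaBasis : Fin 22 → Burnside ℚ S3 :=
  ![e, b_e_g, b_e_h, b_g_e, g, b_g_h, b_h_e, b_h_g, h, b_e_ε4, b_g_ε4, b_h_ε4, ε2, b_ε2_ε4, ε3,
    b_ε4_e, b_ε4_g, b_ε4_h, b_ε4_ε2, ε4, b'_ε4_ε4, b''_ε4_ε4]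

theorem sum_transCls (f : Fin 22 → ℚ) : ∑ i, f i • transCls ℚ i =
    f 0 • H00 + f 1 • H01 + f 2 • H04 + f 3 • H05 + f 4 • H10 + f 5 • H11 + f 6 • H14 +
      f 7 • H15 + f 8 • H40 + f 9 • H41 + f 10 • H44 + f 11 • H45 + f 12 • H50 + f 13 • H51 +
      f 14 • H54 + f 15 • H55 + f 16 • HΔ1 + f 17 • HΔ4 + f 18 • HΔ5 + f 19 • H6 + f 20 • H7 +
      f 21 • H8 := by
  simp only [Fin.sum_univ_castSucc, Fin.sum_univ_zero, zero_add]
  rfl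

set_option maxHeartbeats 1000000 in
theorem smul_gammaBasis (k : Fin 22) :
    (24 : ℚ) • gammaBasis k = ∑ i, (entry gammaList k (i : Fin 22) : ℚ) • transCls ℚ i := by
  -- The factor 24 is a common denominator of all coefficients in the definition of `γ`, so the
  -- tabulated rows are integral.
  rw [sum_transCls]
  fin_cases k
  · change (24 : ℚ) • e = _
    simp [entry, gammaList, e]
    module
  · change (24 : ℚ) • b_e_g = _
    simp [entry, gammaList, b_e_g]
    module
  · change (24 : ℚ) • b_e_h = _
    simp [entry, gammaList, b_e_h]
    module
  · change (24 : ℚ) • b_g_e = _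
    simp [entry, gammaList, b_g_e]
    module
  · change (24 : ℚ) • g = _
    simp [entry, gammaList, g]
    module
  · change (24 : ℚ) • b_g_h = _
    simp [entry, gammaList, b_g_h]
    module
  · change (24 : ℚ) • b_h_e = _
    simp [entry, gammaList, b_h_e]
    module
  · change (24 : ℚ) • b_h_g = _
    simp [entry, gammaList, b_h_g]
    module
  · change (24 : ℚ) • h = _
    simp [entry, gammaList, h]
    module
  · change (24 : ℚ) • b_e_ε4 = _
    simp [entry, gammaList, b_e_ε4]
    module
  · change (24 : ℚ) • b_g_ε4 = _
    simp [entry, gammaList, b_g_ε4]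
    module
  · change (24 : ℚ) • b_h_ε4 = _
    simp [entry, gammaList, b_h_ε4]
    module
  · change (24 : ℚ) • ε2 = _
    simp [entry, gammaList, ε2]
    module
  · change (24 : ℚ) • b_ε2_ε4 = _
    simp [entry, gammaList, b_ε2_ε4]
    module
  · change (24 : ℚ) • ε3 = _
    simp [entry, gammaList, ε3]
    module
  · change (24 : ℚ) • b_ε4_e = _
    simp [entry, gammaList, b_ε4_e]
    module
  · change (24 : ℚ) • b_ε4_g = _
    simp [entry, gammaList, b_ε4_g]
    module
  · change (24 : ℚ) • b_ε4_h = _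
    simp [entry, gammaList, b_ε4_h]
    module
  · change (24 : ℚ) • b_ε4_ε2 = _
    simp [entry, gammaList, b_ε4_ε2]
    module
  · change (24 : ℚ) • ε4 = _
    simp [entry, gammaList, ε4]
    module
  · change (24 : ℚ) • b'_ε4_ε4 = _
    simp [entry, gammaList, b'_ε4_ε4]
    module
  · change (24 : ℚ) • b''_ε4_ε4 = _
    simp [entry, gammaList, b''_ε4_ε4]
    module

/-! ### The conjugating unit and the values of `γ` -/

theorem coe_x1 : (x1 : A) = intCoordMap fun k =>
    [0, -2, 0, 6, 6, -4, 0, 0, 1, 0, 0, 0, 1, 0, 1, 0, 0, 0, 0, 1, 0, 0].getD k 0 := by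
  rw [← intElt_eq_intCoordMap]
  ext1
  case s => ext i j; fin_cases i <;> fin_cases j <;> simp [x1, intElt]
  case t => ext i j; fin_cases i <;> fin_cases j <;> simp [x1, intElt]
  case x => ext i j; fin_cases i <;> fin_cases j <;> simp [x1, intElt]
  all_goals simp [x1, intElt]

theorem coe_x2 : (x2 : A) = intCoordMap fun k =>
    [1, 0, 0, 0, 1, 0, 0, 7, 1, 0, 0, 0, 1, 0, 1, 0, 0, 0, 0, 1, 0, 0].getD k 0 := by
  rw [← intElt_eq_intCoordMap]
  ext1
  case s => ext i j; fin_cases i <;> fin_cases j <;> simp [x2, intElt]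
  case t => ext i j; fin_cases i <;> fin_cases j <;> simp [x2, intElt]
  case x => ext i j; fin_cases i <;> fin_cases j <;> simp [x2, intElt]
  all_goals simp [x2, intElt]

theorem coe_x3 : (x3 : A) = intCoordMap fun k =>
    [1, 0, 0, 0, 1, 0, 0, 0, 1, 0, 0, 1, 1, 0, 1, 0, 0, 6, 0, 1, 0, 0].getD k 0 := by
  rw [← intElt_eq_intCoordMap]
  ext1
  case s => ext i j; fin_cases i <;> fin_cases j <;> simp [x3, intElt]
  case t => ext i j; fin_cases i <;> fin_cases j <;> simp [x3, intElt]
  case x => ext i j; fin_cases i <;> fin_cases j <;> simp [x3, intElt]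
  all_goals simp [x3, intElt]

/-- The unit that conjugates `δ` into the inverse of `γ`, multiplied out. -/
def unitCoord (k : Fin 22) : ℤ :=
  [0, -2, 0, 6, -22, -4, 0, 7, 1, 0, -4, 1, 1, 0, 1, 0, 0, 6, 0, 1, 0, 0].getD k 0

theorem coe_units : ((x1 * x2 * x3 : Aˣ) : A) = intCoordMap unitCoord := by
  rw [Units.val_mul, Units.val_mul, coe_x1, coe_x2, coe_x3, intCoordMap_mul, intCoordMap_mul]
  exact congrArg intCoordMap (funext (by decide +kernel))

/-- With `X` the product of the three units, this is `24 E X = X · deltaLin (24 b)` for the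
coordinate vector `E` with index `j` and the prescribed image `b`. In this form neither the inverse
of `X` nor any fraction enters the computation. -/
theorem mulCoord_unitCoord : ∀ j k : Fin 22,
    mulCoord (fun i => if i = j then (24 : ℤ) else 0) unitCoord k =
      mulCoord unitCoord (fun k => ∑ i : Fin 22, entry gammaList j i * deltaCoord i k) k := by
  decide +kernel

theorem gammaEquiv_single (j : Fin 22) :
    gammaEquiv (coordMap (Pi.single j 1)) = gammaBasis j := by
  refine (conjUnit (x1 * x2 * x3)).trans deltaAlgEquiv.symm |>.symm_apply_eq.1 ?_ |>.symm
  change ↑(x1 * x2 * x3) * deltaLin (gammaBasis j) * ↑(x1 * x2 * x3)⁻¹ = _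
  -- Moving `X⁻¹` to the other side and scaling by 24 turns the claim into `mulCoord_unitCoord`.
  rw [Units.mul_inv_eq_iff_eq_mul, coe_units]
  have h24 : (24 : ℚ) ≠ 0 := by norm_num
  refine smul_right_injective A h24 ?_
  change (24 : ℚ) • _ = (24 : ℚ) • _
  have h : (24 : ℚ) • coordMap (Pi.single j 1) =
      intCoordMap fun i => if i = j then (24 : ℤ) else 0 := by
    rw [← map_smul]
    refine congrArg coordMap (funext fun i => ?_)
    by_cases hij : i = j <;> simp [hij]
  rw [← mul_smul_comm, ← smul_mul_assoc, ← map_smul, smul_gammaBasis, h, intCoordMap_mul,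
    funext (mulCoord_unitCoord j), ← intCoordMap_mul, intCoordMap_sum_smul]
  simp only [map_sum, map_smul, deltaLin_transCls]

theorem isGamma_gammaEquiv : IsGamma gammaEquiv := by
  intro r t u v w x y z1 z2 z3
  have h : (⟨r, t, u, v, w, x, y, z1 • 1 + z2 • eta + z3 • xi⟩ : A) =
      coordMap ![r 0 0, r 0 1, r 0 2, r 1 0, r 1 1, r 1 2, r 2 0, r 2 1, r 2 2, t 0 0, t 1 0,
        t 2 0, u, v, w, x 0 0, x 0 1, x 0 2, y, z1, z2, z3] := by
    rw [coordMap_apply]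
    ext1
    case s => ext i j; fin_cases i <;> fin_cases j <;> rfl
    case t => ext i j; fin_cases i <;> fin_cases j <;> rfl
    case x => ext i j; fin_cases i <;> fin_cases j <;> rfl
    all_goals rfl
  rw [h, LinearMap.pi_apply_eq_sum_univ coordMap, map_sum]
  have h' : ∀ j : Fin 22, (fun i => if j = i then (1 : ℚ) else 0) = Pi.single j 1 := by
    intro j
    funext i
    simp [Pi.single_apply, eq_comm]
  simp only [map_smul, h', gammaEquiv_single]
  simp only [Fin.sum_univ_castSucc, Fin.sum_univ_zero, zero_add]
  rfl

end DoubleBurnside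

end

/-! ### The theorem -/

theorem theorem5p2 :
    ∃ γ : DoubleBurnside.A ≃ₐ[ℚ] DoubleBurnside.Burnside ℚ DoubleBurnside.S3,
      DoubleBurnside.IsGamma γ ∧
      Function.Injective (DoubleBurnside.delta γ) ∧
      (DoubleBurnside.delta γ).range ≤ DoubleBurnside.AZ ∧
      (DoubleBurnside.delta γ).range = DoubleBurnside.Lam ∧
      Nonempty (DoubleBurnside.Burnside ℤ DoubleBurnside.S3 ≃+* DoubleBurnside.Lam) := by
  refine ⟨DoubleBurnside.gammaEquiv, DoubleBurnside.isGamma_gammaEquiv, ?_⟩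
  rw [DoubleBurnside.delta_gammaEquiv, DoubleBurnside.deltaInt_range]
  exact ⟨DoubleBurnside.deltaInt_injective, DoubleBurnside.Lam_le_AZ, rfl,
    -- An injective ring morphism is an isomorphism onto its range, and the range is `Λ`.
    ⟨(RingEquiv.ofLeftInverse (Function.leftInverse_invFun
      DoubleBurnside.deltaInt_injective)).trans
        (RingEquiv.subringCongr DoubleBurnside.deltaInt_range)⟩⟩
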